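/- **Setting.** Let $n\ge 1$ and $T>n$ be integers and let $\mathcal K\subset\mathbb R^n$ be a convex body that contains a unit ball and has diameter at most $T$. At each round $t$ an adversary picks (possibly at random and depending on the past) a convex $T$-Lipschitz loss $\ell_t:\mathcal K\to[0,1]$. Put $$\epsilon=\tfrac1{80e\cdot 20},\quad \alpha=(2e)^{17}n^2\log^2T,\quad \lambda=\frac{\epsilon^4}{10^6\,n^4\alpha^2\log^2T},\quad \beta=4,\quad \gamma=\frac1{5n\log_2T},\quad \eta_1=\frac1{20e^2\sqrt{nT\log T}} .$$ For a probability measure $p$ with mean $\mu(p)$ and covariance $\mathrm{Cov}(p)$, let $\mathcal E_p(r)=\{x:(x-\mu(p))^\top\mathrm{Cov}(p)^{-1}(x-\mu(p))\le r^2\}$, let $c[p]=\mathcal N\big(\mu(p),\frac{\epsilon^2}{n\log T}\frac{\lambda}{2-\lambda}\mathrm{Cov}(p)\big)$, let $K[p](\cdot,y)$ be the density of $(1-\lambda)C+\lambda y$ with $C\sim c[p]$, and let $K[p]q(x)=\int K[p](x,y)\,dq(y)$ and $K[p]^*f(y)=\int_{\mathbb R^n} f(x)K[p](x,y)\,dx$.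 Write $\langle p,f\rangle=\int f\,dp$. **Algorithm (up to its first restart).** Start with $F_1=\mathcal K$, with the rate $\eta_1$, and with $p_1$ uniform on $\mathcal K$. At round $t$, given the past and $\ell_t$, draw a point from $K[p_t]p_t$; $x_t$ is this point if it lies in $\mathcal K$, and an arbitrary point of $\mathcal K$ otherwise. Let $\Omega_t=\mathcal K\cap\mathcal E_{p_t}(10n\alpha\lambda+20\sqrt\lambda\,\epsilon)$ and $$\tilde\ell_t(y)=\frac{\ell_t(x_t)\mathbf 1\{x_t\in\Omega_t\}}{K[p_t]p_t(x_t)}K[p_t](x_t,y)\ \text{ for } y\in F_t,\qquad \tilde\ell_t(y)=+\infty\ \text{ for } y\notin F_t .$$ Let $p_{t+1}$ be the probability measure with density proportional to $\exp\big(-\sum_{s\le t}\eta_s\tilde\ell_s\big)$. If $\mathrm{Vol}(F_t\cap\mathcal E_{p_{t+1}}(\alpha))\le\frac12\mathrm{Vol}(F_t)$, put $F_{t+1}=F_t\cap\mathcal E_{p_{t+1}}(\alpha)$ and $\eta_{t+1}=(1+\gamma)\eta_t$; otherwise $F_{t+1}=F_t$ and $\eta_{t+1}=\eta_t$. With $\tilde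 L_t=\sum_{s\le t}\tilde\ell_s$, the algorithm restarts after round $t$ if some $x\in\partial F_{t+1}\cap\mathrm{int}(\mathcal K)$ satisfies $\eta_1\big(\tilde L_t(x)-\min_{F_t}\tilde L_t\big)\le\beta$. Let $\tau$ be the minimum of $T$ and the first time at which the algorithm restarts. **Fault time.** Let $\ell_t^{ext}(x)=\max\big(\sup_h h(x),\inf_{\mathcal K}\ell_t\big)$ for $x\in\mathbb R^n$, where $h$ runs over the affine functions with $h\le\ell_t$ on $\mathcal K$ and $h(x_0)=\ell_t(x_0)$ for some $x_0\in\mathrm{int}(\mathcal K)$. Put $\underline\ell_t=\ell_t\mathbf 1_{\Omega_t}$ and $L_t=\sum_{s\le t}K[p_s]^*\ell_s^{ext}$, and $$\Delta^{(1)}_t=\eta_1\Big|\sum_{s\le t}\big(\langle p_s,K[p_s]^*\underline\ell_s\rangle-\ell_s(x_s)\big)\Big|,\qquad \Delta^{(2)}_t=\max_{y\in F_t}\eta_1|\tilde L_t(y)-L_t(y)|,$$ $$\Delta^{(3)}_t=\max_{y\in F_t}\Big|\sum_{s\le t}\eta_s\big(\tilde\ell_s-K[p_s]^*\ell_s^{ext}\big)(y)\Big|,\qquad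 \Delta^{(4)}_t=\eta_1\Big|\sum_{s\le t}\int_{F_s}\big(\tilde\ell_s-K[p_s]^*\ell_s^{ext}\big)\,dp_s\Big| .$$ Let $B_t$ be the event $\max(\Delta^{(1)}_t,\dots,\Delta^{(4)}_t)\le1$, and let $\mathcal T=\inf\{t\le\tau:\ B_t\text{ does not hold or }x_t\notin\Omega_t\}\wedge\tau$. **Proposition.** Almost surely, $$\max_{x\in\mathcal K}\sum_{t=1}^{\mathcal T}\big(\ell_t(x_t)-\ell_t(x)\big)\le\begin{cases}C\,n^{9.5}\log^{7.5}(T)\sqrt T & \text{if }\mathcal T=\tau=T,\\ 0&\text{if }\mathcal T=\tau<T,\\ \mathcal T&\text{otherwise,}\end{cases}\qquad C=6^{90}.$$ -/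

import Mathlib

open MeasureTheory ProbabilityTheory Set
open scoped ENNReal NNReal Matrix

noncomputable section

namespace KernelBandit

/-- The Euclidean space `ℝⁿ`. -/
abbrev E (n : ℕ) : Type := EuclideanSpace ℝ (Fin n)

/-! ### Mean, covariance and ellipsoids of a measure -/

/-- The mean `μ(p)`. -/
def mean {n : ℕ} (p : Measure (E n)) : E n := ∫ x, x ∂p

/-- The covariance matrix `Cov(p)`. -/
def covMat {n : ℕ} (p : Measure (E n)) : Matrix (Fin n) (Fin n) ℝ :=
  Matrix.of fun i j => cov[fun x : E n => x i, fun x : E n => x j; p]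

/-- The norm `‖v‖_A = √(vᵀ A v)`. -/
def matNorm {n : ℕ} (A : Matrix (Fin n) (Fin n) ℝ) (v : E n) : ℝ :=
  Real.sqrt (v.ofLp ⬝ᵥ (A *ᵥ v.ofLp))

/-- The ellipsoid `𝓔_p(r) = {x : ‖x - μ(p)‖_{Cov(p)⁻¹} ≤ r}`. -/
def ellipsoid {n : ℕ} (p : Measure (E n)) (r : ℝ) : Set (E n) :=
  {x | matNorm (covMat p)⁻¹ (x - mean p) ≤ r}

/-- The density of the Gaussian `𝒩(m, S)` on `ℝⁿ` (for a positive definite `S`). -/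
def gaussianDensity {n : ℕ} (m : E n) (S : Matrix (Fin n) (Fin n) ℝ) (x : E n) : ℝ :=
  (Real.sqrt ((2 * Real.pi) ^ n * S.det))⁻¹ * Real.exp (-(matNorm S⁻¹ (x - m)) ^ 2 / 2)

/-! ### Parameters -/

/-- The horizon `T`, the kernel parameters `ε, λ` and the parameters `η₁, α, β, γ`. -/
structure Params where
  T : ℕ
  eps : ℝ
  lam : ℝ
  eta1 : ℝ
  alpha : ℝ
  beta : ℝ
  gamma : ℝ

/-- The values of the parameters in dimension `n` with horizon `T`. -/
def params (n T : ℕ) : Params :=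
  let eps : ℝ := 1 / (80 * Real.exp 1 * 20)
  let alpha : ℝ := (2 * Real.exp 1) ^ 17 * (n : ℝ) ^ 2 * Real.log T ^ 2
  { T := T
    eps := eps
    lam := eps ^ 4 / (((10 : ℝ) ^ 3) ^ 2 * (n : ℝ) ^ 4 * alpha ^ 2 * Real.log T ^ 2)
    eta1 := 1 / (20 * Real.exp 1 ^ 2 * Real.sqrt (n * T * Real.log T))
    alpha := alpha
    beta := 4
    gamma := 1 / (5 * n * Real.logb 2 T) }

/-! ### The kernel -/

/-- The density of the Gaussian core
`c[p] = 𝒩(μ(p), (ε² / (n log T)) (λ / (2 - λ)) Cov(p))`. -/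
def coreDensity {n : ℕ} (P : Params) (p : Measure (E n)) : E n → ℝ :=
  gaussianDensity (mean p)
    ((P.eps ^ 2 / (n * Real.log P.T) * (P.lam / (2 - P.lam))) • covMat p)

/-- `K[p](x, y)`, the density at `x` of `(1 - λ) C + λ y` with `C ∼ c[p]`. -/
def kernel {n : ℕ} (P : Params) (p : Measure (E n)) (x y : E n) : ℝ :=
  coreDensity P p ((1 - P.lam)⁻¹ • (x - P.lam • y)) * ((1 - P.lam) ^ n)⁻¹

/-- `K[p] q (x) = ∫ K[p](x, y) dq(y)`, the density of the law of `(1 - λ) C + λ X` with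
independent `C ∼ c[p]` and `X ∼ q`. -/
def kernelApply {n : ℕ} (P : Params) (p q : Measure (E n)) (x : E n) : ℝ :=
  ∫ y, kernel P p x y ∂q

/-- `K[p]^* f (y) = ∫ f(x) K[p](x, y) dx`. -/
def kernelAdjoint {n : ℕ} (P : Params) (p : Measure (E n)) (f : E n → ℝ) (y : E n) : ℝ :=
  ∫ x, f x * kernel P p x y

/-- The sampling distribution `K[p] p`, as a measure on `ℝⁿ`. -/
def playLaw {n : ℕ} (P : Params) (p : Measure (E n)) : Measure (E n) :=
  volume.withDensity fun x => ENNReal.ofReal (kernelApply P p p x)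

/-- The set `K ∩ 𝓔_p(10 n α λ + 20 √λ ε)` of typical points. -/
def typical {n : ℕ} (P : Params) (K : Set (E n)) (p : Measure (E n)) : Set (E n) :=
  K ∩ ellipsoid p (10 * n * P.alpha * P.lam + 20 * Real.sqrt P.lam * P.eps)

/-- The convex extension `ℓ^ext` of a loss `ℓ : K → ℝ` to `ℝⁿ`: the larger of `inf_K ℓ` and of the
supremum of the affine minorants of `ℓ` on `K` that touch `ℓ` at an interior point of `K`. -/
def lossExt {n : ℕ} (K : Set (E n)) (l : E n → ℝ) (x : E n) : ℝ :=
  max (sSup {a : ℝ | ∃ h : E n →ᵃ[ℝ] ℝ,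
        (∀ y ∈ K, h y ≤ l y) ∧ (∃ x₀ ∈ interior K, h x₀ = l x₀) ∧ a = h x})
    (sInf (l '' K))

/-! ### The algorithm along a sequence of actions and losses -/

/-- The actions `x_t` and the losses `ℓ_t`, `t = 1, 2, …` (the values at `t = 0` are not used). -/
structure Transcript (n : ℕ) where
  action : ℕ → E n
  loss : ℕ → E n → ℝ

/-- The state of the algorithm at the beginning of round `t`: the set `F_{t-1}` (`K` if `t = 1`)
that supports `p_t`, the focus region `F_t`, the learning rate `η_t`, and the function
`∑_{s < t} η_s ℓ̃_s`. The estimates `ℓ̃_s` are `+∞` outside `F_s`; since the sets `F_s` decrease,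
that sum is finite exactly on the support, and only its values there are meaningful. -/
structure State (n : ℕ) where
  support : Set (E n)
  focus : Set (E n)
  rate : ℝ
  score : E n → ℝ

/-- `Q_{t-1} = ∑_{s < t} η_s ℓ̃_s - q`, where `q` makes the minimum over the support `0`. -/
def State.potential {n : ℕ} (S : State n) (x : E n) : ℝ :=
  S.score x - sInf (S.score '' S.support)

/-- The exponential weights distribution `p_t = exp(-Q_{t-1}) / Z_t`, on the support. -/
def State.weights {n : ℕ} (S : State n) : Measure (E n) :=
  volume.withDensity fun x => ENNReal.ofReal
    (S.support.indicator
      (fun y => Real.exp (-S.potential y) / ∫ z in S.support, Real.exp (-S.potential z)) x)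

open Classical in
/-- The loss estimate `ℓ̃_t(y) = ℓ_t(x_t) 1{x_t ∈ Ω_t} K_t(x_t, y) / K_t p_t(x_t)` for `y ∈ F_t`,
where `K_t = K[p_t]`, `x = x_t` and `l = ℓ_t`. Off `F_t` the estimate is `+∞`; that is expressed by
the support of `p_{t+1}` and by never evaluating the real number below outside `F_t`. -/
def State.lossEst {n : ℕ} (S : State n) (P : Params) (K : Set (E n)) (x : E n) (l : E n → ℝ)
    (y : E n) : ℝ :=
  (if x ∈ typical P K S.weights then l x else 0) / kernelApply P S.weights S.weights x *
    kernel P S.weights x y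

/-- The state at the beginning of round `1`. -/
def State.init {n : ℕ} (P : Params) (K : Set (E n)) : State n where
  support := K
  focus := K
  rate := P.eta1
  score := fun _ => 0

/-- The update of the exponential weights at the end of a round with action `x` and loss `l`,
before the focus region and the learning rate are updated. -/
def State.update {n : ℕ} (S : State n) (P : Params) (K : Set (E n)) (x : E n) (l : E n → ℝ) :
    State n where
  support := S.focus
  focus := S.focus
  rate := S.rate
  score := fun y => S.score y + S.rate * S.lossEst P K x l y

open Classical in
/-- One round: the weights are updated; then, if
`Vol(F_t ∩ 𝓔_{p_{t+1}}(α)) ≤ Vol(F_t) / 2`, the focus region becomes `F_t ∩ 𝓔_{p_{t+1}}(α)` and the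
learning rate is multiplied by `1 + γ`. -/
def State.step {n : ℕ} (S : State n) (P : Params) (K : Set (E n)) (x : E n) (l : E n → ℝ) :
    State n :=
  let S' := S.update P K x l
  let F' := S.focus ∩ ellipsoid S'.weights P.alpha
  if volume F' ≤ volume S.focus / 2 then
    { S' with focus := F', rate := (1 + P.gamma) * S.rate }
  else S'

variable {n : ℕ} (P : Params) (K : Set (E n)) (R : Transcript n)

/-- The state at the beginning of round `t ≥ 1` (round `0` is a placeholder). -/
def state : ℕ → State n
  | 0 => State.init P K
  | 1 => State.init P K
  | t + 2 => (state (t + 1)).step P K (R.action (t + 1)) (R.loss (t + 1))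

/-- The exponential weights distribution `p_t`. -/
def weights (t : ℕ) : Measure (E n) := (state P K R t).weights

/-- The focus region `F_t`. -/
def focus (t : ℕ) : Set (E n) := (state P K R t).focus

/-- The learning rate `η_t`. -/
def rate (t : ℕ) : ℝ := (state P K R t).rate

/-- The loss estimate `ℓ̃_t`, on `F_t`. -/
def lossEst (t : ℕ) (y : E n) : ℝ :=
  (state P K R t).lossEst P K (R.action t) (R.loss t) y

/-- The cumulative estimate `L̃_t = ∑_{s ≤ t} ℓ̃_s`, on `F_t` (it is `+∞` elsewhere). -/
def cumEst (t : ℕ) (y : E n) : ℝ := ∑ s ∈ Finset.Icc 1 t, lossEst P K R s y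

/-- The set `Ω_t` of typical points at round `t`. -/
def typicalAt (t : ℕ) : Set (E n) := typical P K (weights P K R t)

/-- `K[p_t]^* ℓ_t^ext`. -/
def smoothedLoss (t : ℕ) (y : E n) : ℝ :=
  kernelAdjoint P (weights P K R t) (lossExt K (R.loss t)) y

/-- `L_t = ∑_{s ≤ t} K[p_s]^* ℓ_s^ext`. -/
def cumLoss (t : ℕ) (y : E n) : ℝ := ∑ s ∈ Finset.Icc 1 t, smoothedLoss P K R s y

/-- The truncated loss `ℓ_t(y) 1{y ∈ Ω_t}`. -/
def truncLoss (t : ℕ) : E n → ℝ := (typicalAt P K R t).indicator (R.loss t)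

/-- The restart condition at the end of round `t`: some `x ∈ ∂F_{t+1} ∩ int K` satisfies
`η₁ (L̃_t(x) - L̃_t^*) ≤ β`, where `L̃_t^*` is the minimum of `L̃_t`, which is finite on `F_t` only. -/
def Restart (t : ℕ) : Prop :=
  ∃ x ∈ frontier (focus P K R (t + 1)) ∩ interior K,
    P.eta1 * (cumEst P K R t x - sInf (cumEst P K R t '' focus P K R t)) ≤ P.beta

/-- `τ`, the minimum of `T` and of the first time at which the algorithm restarts. -/
def restartTime : ℕ := sInf ({t | 1 ≤ t ∧ Restart P K R t} ∪ {P.T})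

/-- `Δ_t^(1) = η₁ |∑_{s ≤ t} (⟨p_s, K[p_s]^* (ℓ_s 1_{Ω_s})⟩ - ℓ_s(x_s))|`. -/
def Delta1 (t : ℕ) : ℝ :=
  P.eta1 * |∑ s ∈ Finset.Icc 1 t,
    ((∫ y, kernelAdjoint P (weights P K R s) (truncLoss P K R s) y ∂(weights P K R s)) -
      R.loss s (R.action s))|

/-- The quantity whose maximum over `y ∈ F_t` is `Δ_t^(2)`. -/
def Delta2 (t : ℕ) (y : E n) : ℝ := P.eta1 * |cumEst P K R t y - cumLoss P K R t y|

/-- The quantity whose maximum over `y ∈ F_t` is `Δ_t^(3)`. -/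
def Delta3 (t : ℕ) (y : E n) : ℝ :=
  |∑ s ∈ Finset.Icc 1 t, rate P K R s * (lossEst P K R s y - smoothedLoss P K R s y)|

/-- `Δ_t^(4) = η₁ |∑_{s ≤ t} ⟨p_s, ℓ̃_s - K[p_s]^* ℓ_s^ext⟩|`; the difference of functions is
taken on `F_s`, where the estimate is finite, and counts as `0` elsewhere. -/
def Delta4 (t : ℕ) : ℝ :=
  P.eta1 * |∑ s ∈ Finset.Icc 1 t,
    ∫ y in focus P K R s, (lossEst P K R s y - smoothedLoss P K R s y) ∂(weights P K R s)|

/-- The event `B_t = {max(Δ_t^(1), …, Δ_t^(4)) ≤ 1}`. -/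
def Good (t : ℕ) : Prop :=
  Delta1 P K R t ≤ 1 ∧ (∀ y ∈ focus P K R t, Delta2 P K R t y ≤ 1) ∧
    (∀ y ∈ focus P K R t, Delta3 P K R t y ≤ 1) ∧ Delta4 P K R t ≤ 1

/-- The fault time `𝒯 = inf {t ≤ τ : B_t fails or x_t ∉ Ω_t} ∧ τ`. -/
def faultTime : ℕ :=
  sInf ({t | 1 ≤ t ∧ t ≤ restartTime P K R ∧
      (¬ Good P K R t ∨ R.action t ∉ typicalAt P K R t)} ∪ {restartTime P K R})

/-! ### The game -/

/-- The sequence of actions and losses at the sample point `ω`. -/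
def transcript {Ω : Type*} (x : ℕ → Ω → E n) (l : ℕ → Ω → E n → ℝ) (ω : Ω) : Transcript n where
  action := fun t => x t ω
  loss := fun t => l t ω

/-- The information `σ(ℓ_1, x_1, …, ℓ_{t-1}, x_{t-1}, ℓ_t)` that precedes the choice of `x_t`. -/
abbrev history {Ω : Type*} (K : Set (E n)) (x : ℕ → Ω → E n) (l : ℕ → Ω → E n → ℝ) (t : ℕ) :
    MeasurableSpace Ω :=
  (⨆ s ∈ Finset.Icc 1 t, ⨆ y ∈ K, MeasurableSpace.comap (fun ω => l s ω y) inferInstance) ⊔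
    (⨆ s ∈ Finset.Ico 1 t, MeasurableSpace.comap (x s) inferInstance)

/-- The game on a probability space `(Ω, μ)`, up to the first restart. The adversary
picks random convex losses `ℓ_t : K → [0, 1]`, which are `T`-Lipschitz and may depend on the past.
At each round `t ≤ τ`, given the past and `ℓ_t`, the algorithm draws a point with law `K[p_t] p_t`;
`x_t` is that point if it lies in `K`, and some point of `K` otherwise. -/
structure IsRun {Ω : Type*} [MeasurableSpace Ω] (μ : Measure Ω) (P : Params) (K : Set (E n))
    (l : ℕ → Ω → E n → ℝ) (draw x : ℕ → Ω → E n) : Prop where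
  measurable_loss : ∀ t, ∀ y ∈ K, Measurable fun ω => l t ω y
  convex_loss : ∀ t ω, ConvexOn ℝ K (l t ω)
  loss_mem : ∀ t ω, ∀ y ∈ K, l t ω y ∈ Icc (0 : ℝ) 1
  lipschitz_loss : ∀ t ω, LipschitzOnWith (P.T : ℝ≥0) (l t ω) K
  measurable_draw : ∀ t, Measurable (draw t)
  measurable_action : ∀ t, Measurable (x t)
  action_mem : ∀ t ω, x t ω ∈ K
  action_eq : ∀ t ω, draw t ω ∈ K → x t ω = draw t ω
  law_draw : ∀ t ∈ Finset.Icc 1 P.T, ∀ A : Set (E n), MeasurableSet A →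
    ∀ᵐ ω ∂μ, t ≤ restartTime P K (transcript x l ω) →
      (μ⟦draw t ⁻¹' A | history K x l t⟧) ω =
        (playLaw P (weights P K (transcript x l ω) t)).real A

end KernelBandit

end

noncomputable section

namespace KernelBandit

open scoped InnerProductSpace

/-! The bound is deterministic: the fault time stops the sum at the first failure of the
concentration events, so all earlier rounds satisfy `Good`, and only that is used. The last round is
estimated trivially.

*From losses to smoothed losses.* Since `Delta3` is at most 1, the weights `p_t` agree up to a
bounded factor with a Gibbs measure whose potential `weightedLoss` is convex. Prékopa–Leindler gives
such laws a reverse Hölder inequality for linear functionals (`State.Close.le_integral_abs`). Hence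
every convex function has nearly as large a mean under `p_t` as under the Gaussian with the same
mean and covariance `ε² / (n log T)` times that of `p_t` (`integral_gaussian_le_of_spread`). The
core is what the kernel makes of this Gaussian, and this yields `lam_mul_sub_le`: up to `1 / T`, `λ`
times the instantaneous regret of `p_t` against the loss is at most its regret against the smoothed
loss. Passing from the loss to the smoothed loss thus costs a factor `1 / λ`.

*Bounded estimates.* The focus region always lies in the ellipsoid of radius `10 n α`: either it was
just cut to radius `α`, or more than half of it lies within that radius. The kernel is nearly
constant there, so the estimates lie in `[0, 2]` (`State.Regular.lossEst_mem`).

*Exponential weights.* Writing `Z` and `Q` for the partition function and the potential, the level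
`log Z + Q(x)` telescopes. Summation by parts with increasing rates bounds the estimated regret
against `x` by `(slack + 1) / η₁` minus nonnegative terms: `Q(x) / η` at the end, or `Q(x)` at an
earlier round times the decrease of `1 / η` there. These terms are large when `x` is at whitened
distance at least `α` from the mean, because `Q(x) ≥ α / 25` then (`State.Close.le_potential`) and
`α γ` exceeds `100 slack`.

*Three scenarios.* Without a restart, convexity of the cumulative loss leaves two possibilities
(`inside_or_outside`). If the minimum stays inside the new focus region, the region keeps a fraction
`T^(-3n)` of the volume, the rates at most double, and any competitor may be replaced by one in the
focus region; the regret is then of order `slack / (λ η₁)`. If a restart occurs, its witness lies on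
the boundary of an earlier cut, where the rate increased while the witness was far away; that gain
makes the regret negative. If the minimum leaves the focus region, it is far at that moment and the
regret is already very negative. From then on every round must cut the region, which halves the
volume, while the partition function loses at most a factor `4 / 5`; so only `O(n log T)` more
rounds are possible (`lt_add_chainLength`), too few to spoil the sign. -/

/-! ### The midpoint Prékopa–Leindler inequality -/

/-- The midpoint Prékopa–Leindler inequality for a measure on a real vector space. -/
def MidpointPL {X : Type*} [AddCommGroup X] [Module ℝ X] [MeasurableSpace X]
    (μ : Measure X) : Prop :=
  ∀ f g h : X → ℝ≥0∞, Measurable f → Measurable g → Measurable h →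
    (∀ x y, f x * g y ≤ h ((1 / 2 : ℝ) • (x + y)) ^ 2) →
    (∫⁻ x, f x ∂μ) * (∫⁻ x, g x ∂μ) ≤ (∫⁻ x, h x ∂μ) ^ 2

-- The translates of `A` by `min B` and of `B` by `max A` lie in `A + B`, hence in `2 C`, and share
-- only the point `max A + min B`.
open scoped Pointwise in
lemma volume_add_volume_le_of_isCompact {A B C : Set ℝ} (hA : IsCompact A) (hB : IsCompact B)
    (hA' : A.Nonempty) (hB' : B.Nonempty)
    (h : ∀ x ∈ A, ∀ y ∈ B, (1 / 2 : ℝ) • (x + y) ∈ C) :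
    volume A + volume B ≤ 2 * volume C := by
  set a := sSup A
  set b := sInf B
  have ha : a ∈ A := hA.sSup_mem hA'
  have hb : b ∈ B := hB.sInf_mem hB'
  set U : Set ℝ := (fun x => x + b) '' A
  set W : Set ℝ := (fun x => a + x) '' B
  have hU : volume U = volume A := by
    simp only [U, image_add_right]; exact measure_preimage_add_right _ _ _
  have hW : volume W = volume B := by
    simp only [W, image_add_left]; exact measure_preimage_add _ _ _
  have hUW : volume (U ∪ W) = volume U + volume W := by
    apply measure_union₀
    · exact (hB.image (by fun_prop)).measurableSet.nullMeasurableSet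
    · refine measure_mono_null (t := {a + b}) ?_ (by simp)
      rintro _ ⟨⟨x, hx, rfl⟩, ⟨y, hy, hxy⟩⟩
      have h1 := le_csSup hA.bddAbove hx
      have h2 := csInf_le hB.bddBelow hy
      simp only [mem_singleton_iff]
      simp only at hxy
      change x ≤ a at h1
      change b ≤ y at h2
      linarith
  have hsub : U ∪ W ⊆ (2 : ℝ) • C := by
    rintro _ (⟨x, hx, rfl⟩ | ⟨x, hx, rfl⟩)
    · exact ⟨_, h x hx b hb, by simp⟩
    · exact ⟨_, h a ha x hx, by simp⟩
  calc volume A + volume B = volume (U ∪ W) := by rw [hUW, hU, hW]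
    _ ≤ volume ((2 : ℝ) • C) := measure_mono hsub
    _ = 2 * volume C := by simp [Measure.addHaar_smul]

/-- Inner regularity reduces to the compact case, one set at a time. The base points `x₀` and `y₀`
are adjoined because an approximating compact set may be empty. -/
lemma volume_add_volume_le {A B C : Set ℝ} (hA : MeasurableSet A) (hB : MeasurableSet B)
    (hA' : A.Nonempty) (hB' : B.Nonempty)
    (h : ∀ x ∈ A, ∀ y ∈ B, (1 / 2 : ℝ) • (x + y) ∈ C) :
    volume A + volume B ≤ 2 * volume C := by
  obtain ⟨x₀, hx₀⟩ := hA'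
  obtain ⟨y₀, hy₀⟩ := hB'
  have key : ∀ L, L ⊆ B → IsCompact L → L.Nonempty → volume A + volume L ≤ 2 * volume C := by
    intro L hL hLc hLn
    have hfin : volume L ≠ ∞ := hLc.measure_lt_top.ne
    have : volume A ≤ 2 * volume C - volume L := by
      rw [hA.measure_eq_iSup_isCompact]
      refine iSup₂_le fun S hS => iSup_le fun hSc => ?_
      refine ENNReal.le_sub_of_add_le_right hfin ?_
      refine le_trans (add_le_add_left (measure_mono (subset_insert x₀ S)) _) ?_
      exact volume_add_volume_le_of_isCompact (hSc.insert x₀) hLc (insert_nonempty _ _) hLn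
        (fun x hx y hy => h x (by rcases hx with rfl | hx; exacts [hx₀, hS hx]) y (hL hy))
    -- Undoing the truncated subtraction needs `volume L ≤ 2 * volume C`, which the compact case
    -- provides with `{x₀}` in place of `A`.
    by_cases hle : volume L ≤ 2 * volume C
    · calc volume A + volume L ≤ (2 * volume C - volume L) + volume L := by gcongr
        _ = 2 * volume C := tsub_add_cancel_of_le hle
    · exfalso
      apply hle
      have := volume_add_volume_le_of_isCompact (isCompact_singleton (x := x₀)) hLc
        (singleton_nonempty _) hLn
        (C := C) (fun x hx y hy => h x (by rw [mem_singleton_iff.1 hx]; exact hx₀) y (hL hy))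
      exact le_trans le_add_self this
  by_cases hfin : volume A = ∞
  · have := key {y₀} (by simpa using hy₀) isCompact_singleton (singleton_nonempty _)
    rw [hfin] at this ⊢
    simpa using this
  have hle : volume A ≤ 2 * volume C :=
    le_trans le_self_add (key {y₀} (by simpa using hy₀) isCompact_singleton (singleton_nonempty _))
  have : volume B ≤ 2 * volume C - volume A := by
    rw [hB.measure_eq_iSup_isCompact]
    refine iSup₂_le fun S hS => iSup_le fun hSc => ?_
    refine ENNReal.le_sub_of_add_le_left hfin ?_
    refine le_trans (add_le_add_right (measure_mono (subset_insert y₀ S)) _) ?_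
    exact key _ (insert_subset hy₀ hS) (hSc.insert y₀) (insert_nonempty _ _)
  calc volume A + volume B ≤ volume A + (2 * volume C - volume A) := by gcongr
    _ = 2 * volume C := add_tsub_cancel_of_le hle

lemma lintegral_eq_lintegral_Ioo_volume_lt {f : ℝ → ℝ≥0∞} (hf : Measurable f)
    (hf1 : ∀ x, f x ≤ 1) :
    ∫⁻ x, f x = ∫⁻ t in Ioo (0 : ℝ) 1, volume {x | t < (f x).toReal} := by
  have h1 : ∫⁻ x, f x = ∫⁻ x, ENNReal.ofReal (f x).toReal :=
    lintegral_congr fun x =>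
      (ENNReal.ofReal_toReal (ne_top_of_le_ne_top ENNReal.one_ne_top (hf1 x))).symm
  rw [h1, lintegral_eq_lintegral_meas_lt volume (Filter.Eventually.of_forall fun x => by positivity)
    hf.ennreal_toReal.aemeasurable, ← Ioo_union_Ici_eq_Ioi (zero_lt_one' ℝ),
    lintegral_union measurableSet_Ici]
  · rw [setLIntegral_congr_fun (g := fun _ => 0) measurableSet_Ici]
    · simp
    · intro t ht
      have : {x | t < (f x).toReal} = ∅ := by
        ext x
        simp only [mem_ofPred_eq, mem_empty_iff_false, iff_false, not_lt]
        exact le_trans (ENNReal.toReal_mono ENNReal.one_ne_top (hf1 x)) (by simpa using ht)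
      simp [this]
  · rw [Set.disjoint_left]
    intro x hx hx'
    exact absurd hx.2 (not_lt.2 hx')

lemma four_mul_mul_le_add_sq (a b : ℝ≥0∞) : 4 * (a * b) ≤ (a + b) ^ 2 := by
  have aux : ∀ a d : ℝ≥0∞, 4 * (a * (a + d)) ≤ (a + (a + d)) ^ 2 := by
    intro a d
    calc 4 * (a * (a + d)) ≤ 4 * (a * (a + d)) + d ^ 2 := le_self_add
      _ = (a + (a + d)) ^ 2 := by ring
  rcases le_total a b with hab | hab
  · obtain ⟨d, rfl⟩ := exists_add_of_le hab
    exact aux a d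
  · obtain ⟨d, rfl⟩ := exists_add_of_le hab
    rw [mul_comm (b + d), add_comm (b + d)]
    exact aux b d

/-- With both suprema equal to 1, the superlevel sets at every level below 1 are nonempty, so the
one-dimensional inequality for sets applies level by level. It integrates to a bound on the
arithmetic mean, stronger than the one claimed. Capping `h` at 1 keeps the hypothesis and confines
the levels to `(0, 1)`. -/
lemma lintegral_mul_lintegral_le_of_le_one {f g h : ℝ → ℝ≥0∞} (hf : Measurable f)
    (hg : Measurable g) (hh : Measurable h) (hf1 : ∀ x, f x ≤ 1) (hg1 : ∀ x, g x ≤ 1)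
    (hfs : ∀ u < 1, ∃ x, u < f x) (hgs : ∀ u < 1, ∃ x, u < g x)
    (H : ∀ x y, f x * g y ≤ h ((1 / 2 : ℝ) • (x + y)) ^ 2) :
    (∫⁻ x, f x) * (∫⁻ x, g x) ≤ (∫⁻ x, h x) ^ 2 := by
  set h' : ℝ → ℝ≥0∞ := fun x => min (h x) 1
  have hh' : Measurable h' := hh.min measurable_const
  have H' : ∀ x y, f x * g y ≤ h' ((1 / 2 : ℝ) • (x + y)) ^ 2 := by
    intro x y
    rcases le_total (h ((1 / 2 : ℝ) • (x + y))) 1 with hle | hle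
    · rw [show h' _ = _ from min_eq_left hle]
      exact H x y
    · rw [show h' _ = _ from min_eq_right hle, one_pow]
      exact mul_le_one' (hf1 x) (hg1 y)
  have hmain : (∫⁻ x, f x) + (∫⁻ x, g x) ≤ 2 * ∫⁻ x, h' x := by
    rw [lintegral_eq_lintegral_Ioo_volume_lt hf hf1, lintegral_eq_lintegral_Ioo_volume_lt hg hg1,
      lintegral_eq_lintegral_Ioo_volume_lt hh' fun x => min_le_right _ _,
      ← lintegral_const_mul' _ _ (by simp), ← lintegral_add_left']
    · refine setLIntegral_mono' measurableSet_Ioo fun t ht => ?_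
      have hlt : ENNReal.ofReal t < 1 := by simpa using ht.2
      have key : ∀ {k : ℝ → ℝ≥0∞}, (∀ x, k x ≤ 1) → ∀ x, t < (k x).toReal ↔
          ENNReal.ofReal t < k x := fun hk x =>
        (ENNReal.ofReal_lt_iff_lt_toReal ht.1.le
          (ne_top_of_le_ne_top ENNReal.one_ne_top (hk x))).symm
      apply volume_add_volume_le (hf.ennreal_toReal measurableSet_Ioi)
        (hg.ennreal_toReal measurableSet_Ioi)
      · obtain ⟨x, hx⟩ := hfs _ hlt
        exact ⟨x, (key hf1 x).2 hx⟩
      · obtain ⟨x, hx⟩ := hgs _ hlt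
        exact ⟨x, (key hg1 x).2 hx⟩
      · intro x hx y hy
        refine (key (fun x => min_le_right _ _) _).2 ?_
        have h1 : ENNReal.ofReal t ^ 2 < h' ((1 / 2 : ℝ) • (x + y)) ^ 2 := by
          refine lt_of_lt_of_le ?_ (H' x y)
          rw [sq]
          exact ENNReal.mul_lt_mul ((key hf1 x).1 hx) ((key hg1 y).1 hy)
        exact lt_of_pow_lt_pow_left' 2 h1
    · refine (Antitone.measurable fun s t hst => measure_mono fun x hx => ?_).aemeasurable
      exact lt_of_le_of_lt hst hx
  have h2 : (∫⁻ x, h' x) ≤ ∫⁻ x, h x := lintegral_mono fun x => min_le_left _ _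
  have h3 := four_mul_mul_le_add_sq (∫⁻ x, f x) (∫⁻ x, g x)
  have h4 : 4 * ((∫⁻ x, f x) * (∫⁻ x, g x)) ≤ 4 * (∫⁻ x, h x) ^ 2 := by
    calc _ ≤ _ := h3
      _ ≤ (2 * ∫⁻ x, h x) ^ 2 := by gcongr; exact hmain.trans (by gcongr)
      _ = 4 * (∫⁻ x, h x) ^ 2 := by ring
  exact (ENNReal.mul_le_mul_iff_right (by norm_num) (by norm_num)).1 h4

lemma lintegral_mul_lintegral_le_of_le_const {f g h : ℝ → ℝ≥0∞} (hf : Measurable f)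
    (hg : Measurable g) (hh : Measurable h) {N M : ℝ≥0∞} (hN : N ≠ ∞) (hM : M ≠ ∞)
    (hf1 : ∀ x, f x ≤ N) (hg1 : ∀ x, g x ≤ M)
    (H : ∀ x y, f x * g y ≤ h ((1 / 2 : ℝ) • (x + y)) ^ 2) :
    (∫⁻ x, f x) * (∫⁻ x, g x) ≤ (∫⁻ x, h x) ^ 2 := by
  set a := ⨆ x, f x
  set b := ⨆ x, g x
  have ha : a ≠ ∞ := ne_top_of_le_ne_top hN (iSup_le hf1)
  have hb : b ≠ ∞ := ne_top_of_le_ne_top hM (iSup_le hg1)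
  by_cases ha0 : a = 0
  · have : ∀ x, f x = 0 := fun x => le_antisymm (ha0 ▸ le_iSup f x) zero_le
    simp [this]
  by_cases hb0 : b = 0
  · have : ∀ x, g x = 0 := fun x => le_antisymm (hb0 ▸ le_iSup g x) zero_le
    simp [this]
  -- Both sides scale alike when `f`, `g`, `h` are divided by `a`, `b`, `√(a b)`; this normalizes
  -- the suprema to 1.
  set c : ℝ≥0∞ := (a * b) ^ (1 / 2 : ℝ)
  have hc2 : c ^ 2 = a * b := by
    rw [← ENNReal.rpow_natCast, ← ENNReal.rpow_mul]; norm_num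
  have hab : a * b ≠ ∞ := ENNReal.mul_ne_top ha hb
  have hab0 : a * b ≠ 0 := mul_ne_zero ha0 hb0
  have key := lintegral_mul_lintegral_le_of_le_one (f := fun x => a⁻¹ * f x)
    (g := fun x => b⁻¹ * g x) (h := fun x => c⁻¹ * h x) (hf.const_mul _) (hg.const_mul _)
    (hh.const_mul _) (fun x => ?_) (fun x => ?_) (fun u hu => ?_) (fun u hu => ?_)
    (fun x y => ?_)
  · rw [lintegral_const_mul _ hf, lintegral_const_mul _ hg, lintegral_const_mul _ hh, mul_pow,
      ← ENNReal.inv_pow, hc2, mul_mul_mul_comm,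
      ← ENNReal.mul_inv (Or.inl ha0) (Or.inl ha)] at key
    exact (ENNReal.mul_le_mul_iff_right (ENNReal.inv_ne_zero.2 hab)
      (ENNReal.inv_ne_top.2 hab0)).1 key
  · rw [ENNReal.inv_mul_le_iff ha0 ha, mul_one]; exact le_iSup f x
  · rw [ENNReal.inv_mul_le_iff hb0 hb, mul_one]; exact le_iSup g x
  · have : a * u < a := by
      calc a * u < a * 1 := (ENNReal.mul_lt_mul_iff_right ha0 ha).2 hu
        _ = a := mul_one a
    obtain ⟨x, hx⟩ := lt_iSup_iff.1 this
    refine ⟨x, ?_⟩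
    rw [mul_comm, ← div_eq_mul_inv]
    exact (ENNReal.lt_div_iff_mul_lt (Or.inl ha0) (Or.inl ha)).2 (by rwa [mul_comm])
  · have : b * u < b := by
      calc b * u < b * 1 := (ENNReal.mul_lt_mul_iff_right hb0 hb).2 hu
        _ = b := mul_one b
    obtain ⟨x, hx⟩ := lt_iSup_iff.1 this
    refine ⟨x, ?_⟩
    rw [mul_comm, ← div_eq_mul_inv]
    exact (ENNReal.lt_div_iff_mul_lt (Or.inl hb0) (Or.inl hb)).2 (by rwa [mul_comm])
  · rw [mul_pow, ← ENNReal.inv_pow, hc2, mul_mul_mul_comm,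
      ← ENNReal.mul_inv (Or.inl ha0) (Or.inl ha)]
    gcongr
    exact H x y

lemma lintegral_iSup_min_natCast {X : Type*} [MeasurableSpace X] {μ : Measure X}
    {f : X → ℝ≥0∞} (hf : Measurable f) :
    ∫⁻ x, f x ∂μ = ⨆ N : ℕ, ∫⁻ x, min (f x) N ∂μ := by
  rw [← lintegral_iSup (fun N => hf.min measurable_const)
    (fun i j hij x => min_le_min le_rfl (by exact_mod_cast hij))]
  refine lintegral_congr fun x => ?_
  refine le_antisymm ?_ (iSup_le fun N => min_le_left _ _)
  refine le_of_forall_lt fun c hc => ?_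
  obtain ⟨N, hN⟩ := ENNReal.exists_nat_gt (ne_top_of_lt hc)
  exact lt_iSup_iff.2 ⟨N, lt_min hc hN⟩

theorem midpointPL_real : MidpointPL (volume : Measure ℝ) := by
  intro f g h hf hg hh H
  rw [lintegral_iSup_min_natCast hf, lintegral_iSup_min_natCast hg, ENNReal.iSup_mul]
  refine iSup_le fun N => ?_
  rw [ENNReal.mul_iSup]
  refine iSup_le fun M => ?_
  exact lintegral_mul_lintegral_le_of_le_const (hf.min measurable_const) (hg.min measurable_const)
    hh (ENNReal.natCast_ne_top N) (ENNReal.natCast_ne_top M) (fun x => min_le_right _ _)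
    (fun x => min_le_right _ _)
    (fun x y => (mul_le_mul' (min_le_left _ _) (min_le_left _ _)).trans (H x y))

/-- Tensorization: the inequality on the second factor, applied to slices, says that the partial
integrals satisfy the hypothesis on the first factor. -/
theorem MidpointPL.prod {X Y : Type*} [AddCommGroup X] [Module ℝ X] [MeasurableSpace X]
    [AddCommGroup Y] [Module ℝ Y] [MeasurableSpace Y] {μ : Measure X} {ν : Measure Y}
    [SFinite ν] (hμ : MidpointPL μ) (hν : MidpointPL ν) : MidpointPL (μ.prod ν) := by
  intro f g h hf hg hh H
  rw [lintegral_prod _ hf.aemeasurable, lintegral_prod _ hg.aemeasurable,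
    lintegral_prod _ hh.aemeasurable]
  refine hμ _ _ _ hf.lintegral_prod_right' hg.lintegral_prod_right' hh.lintegral_prod_right' ?_
  intro x y
  exact hν _ _ _ (hf.comp measurable_prodMk_left) (hg.comp measurable_prodMk_left)
    (hh.comp measurable_prodMk_left) fun v w => H (x, v) (y, w)

theorem MidpointPL.of_measurePreserving {X Y : Type*} [AddCommGroup X] [Module ℝ X]
    [MeasurableSpace X] [AddCommGroup Y] [Module ℝ Y] [MeasurableSpace Y] {μ : Measure X}
    {ν : Measure Y} (hμ : MidpointPL μ) (e : X → Y) (he : MeasurePreserving e μ ν)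
    (hlin : ∀ x y, e ((1 / 2 : ℝ) • (x + y)) = (1 / 2 : ℝ) • (e x + e y)) : MidpointPL ν := by
  intro f g h hf hg hh H
  rw [← he.lintegral_comp hf, ← he.lintegral_comp hg, ← he.lintegral_comp hh]
  refine hμ _ _ _ (hf.comp he.measurable) (hg.comp he.measurable) (hh.comp he.measurable) ?_
  intro x y
  rw [hlin]
  exact H _ _

theorem midpointPL_pi (n : ℕ) : MidpointPL (volume : Measure (Fin n → ℝ)) := by
  induction n with
  | zero =>
    intro f g h hf hg hh H
    have := H 0 0
    have key : ∀ k : (Fin 0 → ℝ) → ℝ≥0∞, ∫⁻ x, k x = k 0 := by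
      intro k
      rw [volume_pi, Measure.pi_of_empty (x := (0 : Fin 0 → ℝ)), lintegral_dirac]
    rw [key, key, key]
    convert this using 2
    simp
  | succ n ih =>
    refine (midpointPL_real.prod ih).of_measurePreserving
      (MeasurableEquiv.piFinSuccAbove (fun _ : Fin (n + 1) => ℝ) 0).symm
      (volume_preserving_piFinSuccAbove (fun _ : Fin (n + 1) => ℝ) 0).symm ?_
    rintro ⟨a, v⟩ ⟨b, w⟩
    ext i
    refine Fin.cases ?_ (fun j => ?_) i <;>
      simp [MeasurableEquiv.piFinSuccAbove, Fin.insertNthEquiv, mul_add]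

/-- The midpoint **Prékopa–Leindler inequality** on Euclidean space. -/
theorem midpointPL_euclidean (n : ℕ) : MidpointPL (volume : Measure (E n)) :=
  (midpointPL_pi n).of_measurePreserving (MeasurableEquiv.toLp 2 (Fin n → ℝ))
    (PiLp.volume_preserving_toLp (Fin n)) fun x y => by ext i; simp

/-! ### Convex functions -/

/-- The point `(x, f x)` is separated from the strict epigraph over `interior K`, which is open
because `f` is continuous there. The separating functional is not vertical since `(x, f x + 1)` is
in the epigraph. A boundary point `y` is reached by convexity, the midpoint of `x` and `y` being
interior. -/
lemma exists_subgradient {V : Type*} [NormedAddCommGroup V] [InnerProductSpace ℝ V]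
    [FiniteDimensional ℝ V] {K : Set V} {f : V → ℝ} (hf : ConvexOn ℝ K f) {x : V}
    (hx : x ∈ interior K) : ∃ g : V, ∀ y ∈ K, f x + ⟪g, y - x⟫_ℝ ≤ f y := by
  have hU : IsOpen (interior K) := isOpen_interior
  have hfU : ConvexOn ℝ (interior K) f := hf.subset interior_subset hf.1.interior
  have hc : ContinuousOn f (interior K) := hf.continuousOn_interior
  set S : Set (V × ℝ) := {p | p.1 ∈ interior K ∧ f p.1 < p.2}
  have hSconv : Convex ℝ S := hfU.convex_strict_epigraph
  have hSopen : IsOpen S := by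
    have : ContinuousOn (fun p : V × ℝ => f p.1 - p.2) (interior K ×ˢ univ) :=
      (hc.comp continuousOn_fst fun p hp => hp.1).sub continuousOn_snd
    have h2 := this.isOpen_inter_preimage (hU.prod isOpen_univ) (isOpen_Iio (a := (0 : ℝ)))
    convert h2 using 1
    ext p
    simp [S]
  have hxS : (x, f x) ∉ S := fun h => lt_irrefl _ h.2
  obtain ⟨L, hL⟩ := geometric_hahn_banach_open_point hSconv hSopen hxS
  have hLsplit : ∀ y r, L (y, r) = L (y, 0) + r * L (0, 1) := by
    intro y r
    have : ((y, r) : V × ℝ) = (y, 0) + r • (0, 1) := by simp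
    rw [this, map_add, map_smul, smul_eq_mul]
  set c := -L (0, 1)
  have hcpos : 0 < c := by
    have := hL (x, f x + 1) ⟨hx, by simp⟩
    rw [hLsplit x, hLsplit x (f x)] at this
    simp only [c]
    linarith
  set g : V := (InnerProductSpace.toDual ℝ V).symm (L.comp (ContinuousLinearMap.inl ℝ V ℝ))
  have hg : ∀ y, ⟪g, y⟫_ℝ = L (y, 0) := by
    intro y
    simp [g]
  have hint : ∀ y ∈ interior K, f x + ⟪c⁻¹ • g, y - x⟫_ℝ ≤ f y := by
    intro y hy
    rw [inner_smul_left, inner_sub_right, hg, hg]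
    refine le_of_forall_pos_le_add fun e he => ?_
    have := hL (y, f y + e) ⟨hy, by simpa using he⟩
    rw [hLsplit y, hLsplit x (f x)] at this
    have h3 : L (y, 0) - L (x, 0) < c * (f y + e - f x) := by simp only [c]; linarith
    have h4 : c⁻¹ * (L (y, 0) - L (x, 0)) < f y + e - f x := by
      rwa [inv_mul_lt_iff₀ hcpos]
    simp only [conj_trivial]
    linarith
  refine ⟨c⁻¹ • g, fun y hy => ?_⟩
  have hmid : (1 / 2 : ℝ) • x + (1 / 2 : ℝ) • y ∈ interior K :=
    hf.1.combo_interior_self_mem_interior hx hy (by norm_num) (by norm_num) (by norm_num)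
  have h1 := hint _ hmid
  have h2 := hf.2 (interior_subset hx) hy (show (0 : ℝ) ≤ 1 / 2 by norm_num)
    (show (0 : ℝ) ≤ 1 / 2 by norm_num) (by norm_num)
  have h3 : (1 / 2 : ℝ) • x + (1 / 2 : ℝ) • y - x = (1 / 2 : ℝ) • (y - x) := by module
  rw [h3, inner_smul_right] at h1
  simp only [smul_eq_mul] at h2
  linarith

/-- A convex function that exceeds `c` on the part of the boundary of `F` inside `K` and is smaller
than `c` somewhere in `F` is at least `c` on `K \ F`. -/
lemma le_of_lt_on_frontier {V : Type*} [NormedAddCommGroup V] [NormedSpace ℝ V]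
    {F K : Set V} {f : V → ℝ} {c : ℝ} (hK : Convex ℝ K) (hF : IsClosed F) (hFc : Convex ℝ F)
    (hFK : F ⊆ K) (hFi : (interior F).Nonempty) (hf : ConvexOn ℝ K f) (hfc : Continuous f)
    (hb : ∀ b ∈ frontier F ∩ interior K, c < f b) {z : V} (hz : z ∈ F) (hzc : f z < c) :
    ∀ x ∈ K \ F, c ≤ f x := by
  have hKi : (interior K).Nonempty := hFi.mono (interior_mono hFK)
  -- The starting point is moved into `interior F` so that segments to interior points of `K` stay
  -- in `interior K`, where the hypothesis on the frontier applies.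
  obtain ⟨z', hz', hz'c⟩ : ∃ z' ∈ interior F, f z' < c := by
    have hzcl : z ∈ closure (interior F) := by
      rw [hFc.closure_interior_eq_closure_of_nonempty_interior hFi]; exact subset_closure hz
    obtain ⟨w, hw, hw'⟩ := mem_closure_iff.1 hzcl (f ⁻¹' Iio c) (isOpen_Iio.preimage hfc) hzc
    exact ⟨w, hw', hw⟩
  have hint : ∀ x ∈ interior K, x ∉ F → c ≤ f x := by
    intro x hx hxF
    have hseg : IsPreconnected (segment ℝ z' x) := (convex_segment z' x).isPreconnected
    obtain ⟨b, hbs, hbF⟩ : (segment ℝ z' x ∩ frontier F).Nonempty := by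
      by_contra hne
      have hcov : segment ℝ z' x ⊆ interior F ∪ Fᶜ := by
        intro w hw
        by_contra hw'
        simp only [mem_union, mem_compl_iff, not_or, not_not] at hw'
        exact hne ⟨w, hw, ⟨subset_closure hw'.2, hw'.1⟩⟩
      obtain ⟨w, -, hw1, hw2⟩ := hseg _ _ isOpen_interior hF.isOpen_compl hcov
        ⟨z', left_mem_segment ℝ z' x, hz'⟩ ⟨x, right_mem_segment ℝ z' x, hxF⟩
      exact hw2 (interior_subset hw1)
    have hbK : b ∈ interior K :=
      hK.interior.segment_subset (interior_mono hFK hz') hx hbs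
    have h1 := hb b ⟨hbF, hbK⟩
    have h2 : f b ≤ max (f z') (f x) :=
      (hf.subset (interior_subset) hK.interior).le_on_segment (interior_mono hFK hz') hx hbs
    rcases le_max_iff.1 h2 with h | h <;> linarith
  rintro x ⟨hxK, hxF⟩
  have hxcl : x ∈ closure (interior K ∩ Fᶜ) := by
    have : x ∈ closure (interior K) := by
      rw [hK.closure_interior_eq_closure_of_nonempty_interior hKi]; exact subset_closure hxK
    rw [mem_closure_iff] at this ⊢
    intro o ho hxo
    obtain ⟨w, hw, hw'⟩ := this (o ∩ Fᶜ) (ho.inter hF.isOpen_compl) ⟨hxo, hxF⟩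
    exact ⟨w, hw.1, hw', hw.2⟩
  have : closure (interior K ∩ Fᶜ) ⊆ {y | c ≤ f y} :=
    closure_minimal (fun y hy => hint y hy.1 hy.2) (isClosed_le continuous_const hfc)
  exact this hxcl

/-! ### The extension of a loss -/

/-- A convex body: a compact convex set with nonempty interior. -/
structure IsBody {n : ℕ} (K : Set (E n)) : Prop where
  compact : IsCompact K
  convex : Convex ℝ K
  interior_nonempty : (interior K).Nonempty

/-- A convex `T`-Lipschitz loss with values in `[0, 1]`. -/
structure IsLoss {n : ℕ} (K : Set (E n)) (T : ℝ≥0) (l : E n → ℝ) : Prop where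
  convex : ConvexOn ℝ K l
  mem : ∀ y ∈ K, l y ∈ Icc (0 : ℝ) 1
  lipschitz : LipschitzOnWith T l K

section LossExt

variable {n : ℕ} {K : Set (E n)} {T : ℝ≥0} {l : E n → ℝ}

/-- The affine minorants of `l` that touch it in the interior of `K`. -/
def touching (K : Set (E n)) (l : E n → ℝ) : Set (E n →ᵃ[ℝ] ℝ) :=
  {h | (∀ y ∈ K, h y ≤ l y) ∧ ∃ x₀ ∈ interior K, h x₀ = l x₀}

lemma lossExt_eq (x : E n) :
    lossExt K l x = max (sSup ((fun h : E n →ᵃ[ℝ] ℝ => h x) '' touching K l))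
      (sInf (l '' K)) := by
  have : {a : ℝ | ∃ h : E n →ᵃ[ℝ] ℝ,
        (∀ y ∈ K, h y ≤ l y) ∧ (∃ x₀ ∈ interior K, h x₀ = l x₀) ∧ a = h x} =
      (fun h : E n →ᵃ[ℝ] ℝ => h x) '' touching K l := by
    ext a
    simp only [touching, mem_ofPred_eq, mem_image]
    constructor
    · rintro ⟨h, h1, h2, h3⟩; exact ⟨h, ⟨h1, h2⟩, h3.symm⟩
    · rintro ⟨h, ⟨h1, h2⟩, h3⟩; exact ⟨h, h1, h2, h3.symm⟩
  rw [lossExt, this]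

/-- Near an interior contact point a minorant of `l` cannot climb faster than `l` in any direction,
and for an affine function a bound on the slope is global. This makes `lossExt` finite and Lipschitz
on the whole space. -/
lemma touching_lipschitz (hl : IsLoss K T l) {h : E n →ᵃ[ℝ] ℝ} (hh : h ∈ touching K l)
    (x y : E n) : h x ≤ h y + T * ‖x - y‖ := by
  obtain ⟨h1, x₀, hx₀, h2⟩ := hh
  set v := x - y
  have hlin : ∀ w : E n, ∀ t : ℝ, h (t • v + w) = t * h.linear v + h w := by
    intro w t
    have := h.map_vadd w (t • v)
    simpa [vadd_eq_add] using this
  have hev : ∀ᶠ t : ℝ in nhdsWithin 0 (Ioi 0), t • v + x₀ ∈ K := by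
    have hcont : Filter.Tendsto (fun t : ℝ => t • v + x₀) (nhds 0) (nhds ((0 : ℝ) • v + x₀)) :=
      (Continuous.tendsto (by fun_prop) _)
    rw [zero_smul, zero_add] at hcont
    exact (hcont.mono_left nhdsWithin_le_nhds).eventually (mem_interior_iff_mem_nhds.1 hx₀)
  obtain ⟨t, htK, ht0⟩ := (hev.and self_mem_nhdsWithin).exists
  have ht0 : 0 < t := ht0
  have h3 := h1 _ htK
  rw [hlin, h2] at h3
  have h4 := hl.lipschitz.dist_le_mul _ htK _ (interior_subset hx₀)
  rw [Real.dist_eq, dist_eq_norm, add_sub_cancel_right, norm_smul, Real.norm_eq_abs,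
    abs_of_pos ht0] at h4
  have h5 := (le_abs_self _).trans h4
  have h6 : t * h.linear v ≤ t * (T * ‖v‖) := by linarith
  have h7 := le_of_mul_le_mul_left h6 ht0
  have h8 := hlin y 1
  rw [one_smul, one_mul, show v + y = x by simp [v]] at h8
  linarith

lemma touching_bddAbove (hK : IsBody K) (hl : IsLoss K T l) (x : E n) :
    BddAbove ((fun h : E n →ᵃ[ℝ] ℝ => h x) '' touching K l) := by
  obtain ⟨R, hR⟩ := hK.compact.isBounded.subset_closedBall x
  refine ⟨1 + T * R, ?_⟩
  rintro _ ⟨h, hh, rfl⟩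
  obtain ⟨h1, x₀, hx₀, h2⟩ := id hh
  have h3 := touching_lipschitz hl hh x x₀
  have h4 : ‖x - x₀‖ ≤ R := by
    have := hR (interior_subset hx₀)
    rwa [Metric.mem_closedBall, dist_comm, dist_eq_norm] at this
  have h5 := (hl.mem x₀ (interior_subset hx₀)).2
  have h6 : (T : ℝ) * ‖x - x₀‖ ≤ T * R := by gcongr
  simp only
  linarith

lemma exists_mem_touching (hl : IsLoss K T l) {x : E n} (hx : x ∈ interior K) :
    ∃ h ∈ touching K l, h x = l x := by
  obtain ⟨g, hg⟩ := exists_subgradient hl.convex hx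
  set h : E n →ᵃ[ℝ] ℝ :=
    ((innerSL ℝ g).toLinearMap.toAffineMap) + AffineMap.const ℝ (E n) (l x - ⟪g, x⟫_ℝ)
  have hh : ∀ y, h y = l x + ⟪g, y - x⟫_ℝ := by
    intro y
    simp [h, inner_sub_right]
    ring
  refine ⟨h, ⟨fun y hy => ?_, x, hx, ?_⟩, ?_⟩
  · rw [hh]; exact hg y hy
  · rw [hh]; simp
  · rw [hh]; simp

lemma touching_nonempty (hK : IsBody K) (hl : IsLoss K T l) : (touching K l).Nonempty := by
  obtain ⟨x, hx⟩ := hK.interior_nonempty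
  obtain ⟨h, hh, -⟩ := exists_mem_touching hl hx
  exact ⟨h, hh⟩

lemma lossExt_nonneg (hl : IsLoss K T l) (x : E n) : 0 ≤ lossExt K l x := by
  rw [lossExt_eq]
  refine le_max_of_le_right (Real.sInf_nonneg ?_)
  rintro _ ⟨y, hy, rfl⟩
  exact (hl.mem y hy).1

lemma lossExt_le (hK : IsBody K) (hl : IsLoss K T l) {x : E n} (hx : x ∈ K) :
    lossExt K l x ≤ l x := by
  rw [lossExt_eq]
  refine max_le (csSup_le ((touching_nonempty hK hl).image _) ?_)
    (csInf_le ⟨0, ?_⟩ (mem_image_of_mem _ hx))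
  · rintro _ ⟨h, hh, rfl⟩
    exact hh.1 x hx
  · rintro _ ⟨y, hy, rfl⟩
    exact (hl.mem y hy).1

lemma lossExt_eq_of_mem_interior (hK : IsBody K) (hl : IsLoss K T l) {x : E n}
    (hx : x ∈ interior K) : lossExt K l x = l x := by
  refine le_antisymm (lossExt_le hK hl (interior_subset hx)) ?_
  obtain ⟨h, hh, hhx⟩ := exists_mem_touching hl hx
  rw [lossExt_eq]
  exact le_max_of_le_left (le_csSup (touching_bddAbove hK hl x) ⟨h, hh, hhx⟩)

lemma lossExt_le_add (hK : IsBody K) (hl : IsLoss K T l) (x y : E n) :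
    lossExt K l x ≤ lossExt K l y + T * ‖x - y‖ := by
  have hT : 0 ≤ (T : ℝ) * ‖x - y‖ := by positivity
  rw [lossExt_eq, lossExt_eq]
  refine max_le (csSup_le ((touching_nonempty hK hl).image _) ?_) ?_
  · rintro _ ⟨h, hh, rfl⟩
    refine (touching_lipschitz hl hh x y).trans ?_
    gcongr
    exact le_max_of_le_left (le_csSup (touching_bddAbove hK hl y) ⟨h, hh, rfl⟩)
  · exact (le_max_right _ _).trans (le_add_of_nonneg_right hT)

lemma lossExt_lipschitz (hK : IsBody K) (hl : IsLoss K T l) : LipschitzWith T (lossExt K l) := by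
  refine LipschitzWith.of_le_add_mul T fun x y => ?_
  rw [dist_eq_norm]
  exact lossExt_le_add hK hl x y

lemma lossExt_convex (hK : IsBody K) (hl : IsLoss K T l) :
    ConvexOn ℝ univ (lossExt K l) := by
  refine ⟨convex_univ, fun x _ y _ a b ha hb hab => ?_⟩
  rw [lossExt_eq, lossExt_eq x, lossExt_eq y, smul_eq_mul, smul_eq_mul]
  refine max_le (csSup_le ((touching_nonempty hK hl).image _) ?_) ?_
  · rintro _ ⟨h, hh, rfl⟩
    have h1 : h (a • x + b • y) = a * h x + b * h y := by
      simpa using Convex.combo_affine_apply (f := h) (x := x) (y := y) hab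
    simp only [h1]
    gcongr
    · exact le_max_of_le_left (le_csSup (touching_bddAbove hK hl x) ⟨h, hh, rfl⟩)
    · exact le_max_of_le_left (le_csSup (touching_bddAbove hK hl y) ⟨h, hh, rfl⟩)
  · calc sInf (l '' K) = a * sInf (l '' K) + b * sInf (l '' K) := by rw [← add_mul, hab, one_mul]
      _ ≤ _ := by gcongr <;> exact le_max_right _ _

end LossExt

/-! ### Second moments of compactly supported laws -/

/-- An absolutely continuous probability measure supported on the compact set `K`. -/
structure IsLawOn {n : ℕ} (p : Measure (E n)) (K : Set (E n)) : Prop where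
  prob : IsProbabilityMeasure p
  compact : IsCompact K
  null : p Kᶜ = 0
  ac : p ≪ volume

/-- The linear map `A` makes the law `p` isotropic. -/
structure Whitens {n : ℕ} (A : E n ≃L[ℝ] E n) (p : Measure (E n)) : Prop where
  norm : ∀ v, matNorm (covMat p)⁻¹ v = ‖A v‖
  moment : ∀ w : E n, ∫ x, ⟪w, A (x - mean p)⟫_ℝ ^ 2 ∂p = ‖w‖ ^ 2
  det : (covMat p).det = (LinearMap.det (A : E n →ₗ[ℝ] E n) ^ 2)⁻¹

section Law

variable {n : ℕ} {p : Measure (E n)} {K : Set (E n)}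

lemma IsLawOn.ae_mem (hp : IsLawOn p K) : ∀ᵐ x ∂p, x ∈ K := hp.null

lemma IsLawOn.integrable_of_continuousOn {F : Type*} [NormedAddCommGroup F] (hp : IsLawOn p K)
    {f : E n → F} (hf : ContinuousOn f K) : Integrable f p := by
  have := hp.prob
  rw [← Measure.restrict_eq_self_of_ae_mem hp.ae_mem]
  exact hf.integrableOn_compact hp.compact

lemma IsLawOn.integrable {F : Type*} [NormedAddCommGroup F] (hp : IsLawOn p K)
    {f : E n → F} (hf : Continuous f) : Integrable f p :=
  hp.integrable_of_continuousOn hf.continuousOn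

lemma IsLawOn.mean_mem (hp : IsLawOn p K) (hK : Convex ℝ K) : mean p ∈ K := by
  have := hp.prob
  exact hK.integral_mem hp.compact.isClosed hp.ae_mem (hp.integrable continuous_id)

lemma IsLawOn.integral_inner_sub_mean (hp : IsLawOn p K) (v : E n) :
    ∫ x, ⟪v, x - mean p⟫_ℝ ∂p = 0 := by
  have := hp.prob
  have h1 : ∫ x, (x - mean p) ∂p = 0 := by
    rw [integral_sub (f := fun x : E n => x) (hp.integrable continuous_id) (integrable_const _)]
    simp [mean]
  rw [integral_inner (hp.integrable (by fun_prop)), h1, inner_zero_right]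

lemma IsLawOn.integral_inner_sub_mean_sq (hp : IsLawOn p K) (v : E n) :
    ∫ x, ⟪v, x - mean p⟫_ℝ ^ 2 ∂p = v.ofLp ⬝ᵥ (covMat p *ᵥ v.ofLp) := by
  have := hp.prob
  have hmean : ∀ i, ∫ x : E n, x i ∂p = mean p i := by
    intro i
    exact (EuclideanSpace.proj (𝕜 := ℝ) i).integral_comp_comm (hp.integrable continuous_id)
  have h1 : ∀ x : E n, ⟪v, x - mean p⟫_ℝ ^ 2 =
      ∑ i, ∑ j, v i * (v j * ((x i - mean p i) * (x j - mean p j))) := by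
    intro x
    rw [sq, PiLp.inner_apply, Finset.sum_mul_sum]
    refine Finset.sum_congr rfl fun i _ => Finset.sum_congr rfl fun j _ => ?_
    simp
    ring
  simp only [h1]
  have hint : ∀ i j, Integrable
      (fun x : E n => v i * (v j * ((x i - mean p i) * (x j - mean p j)))) p := fun i j =>
    hp.integrable (by fun_prop)
  rw [integral_finsetSum _ fun i _ => integrable_finsetSum _ fun j _ => hint i j]
  simp only [dotProduct, Matrix.mulVec, Finset.mul_sum]
  refine Finset.sum_congr rfl fun i _ => ?_
  rw [integral_finsetSum _ fun j _ => hint i j]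
  refine Finset.sum_congr rfl fun j _ => ?_
  rw [integral_const_mul, integral_const_mul, covMat, Matrix.of_apply, covariance, hmean, hmean]
  ring

/-- A direction of zero variance would put all the mass in a hyperplane, which is Lebesgue-null. -/
lemma IsLawOn.covMat_posDef (hp : IsLawOn p K) : (covMat p).PosDef := by
  have := hp.prob
  refine Matrix.PosDef.of_dotProduct_mulVec_pos ?_ ?_
  · ext i j
    simp [covMat, covariance_comm (fun x : E n => x i)]
  · intro w hw
    set v : E n := WithLp.toLp 2 w
    have hv : v ≠ 0 := by
      intro h
      apply hw
      have : v.ofLp = 0 := by rw [h]; rfl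
      simpa [v] using this
    have h0 := hp.integral_inner_sub_mean_sq v
    have hnn : 0 ≤ ∫ x, ⟪v, x - mean p⟫_ℝ ^ 2 ∂p := integral_nonneg fun x => sq_nonneg _
    rw [star_trivial]
    change 0 < v.ofLp ⬝ᵥ (covMat p *ᵥ v.ofLp)
    rw [← h0]
    refine lt_of_le_of_ne hnn fun hzero => ?_
    have hae := (integral_eq_zero_iff_of_nonneg (fun x => sq_nonneg _)
      (hp.integrable ((continuous_const.inner (by fun_prop)).pow 2))).1 hzero.symm
    have hnull : volume {x : E n | ⟪v, x - mean p⟫_ℝ = 0} = 0 := by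
      set W : Submodule ℝ (E n) := (ℝ ∙ v)ᗮ
      have hW : W ≠ ⊤ := by
        intro htop
        have : v ∈ W := htop ▸ Submodule.mem_top
        rw [Submodule.mem_orthogonal_singleton_iff_inner_right] at this
        exact hv (inner_self_eq_zero.1 this)
      have h2 := Measure.addHaar_submodule (volume : Measure (E n)) W hW
      have h3 : {x : E n | ⟪v, x - mean p⟫_ℝ = 0} = (fun x => x - mean p) ⁻¹' (W : Set (E n)) := by
        ext x
        simp [W, Submodule.mem_orthogonal_singleton_iff_inner_right]
      rw [h3]
      simpa [sub_eq_add_neg, measure_preimage_add_right] using h2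
    have h4 : p {x : E n | ⟪v, x - mean p⟫_ℝ = 0} = 0 := hp.ac hnull
    have h5 : ∀ᵐ x ∂p, False := by
      filter_upwards [hae, measure_eq_zero_iff_ae_notMem.1 h4] with x hx hx'
      exact hx' (by simpa using hx)
    simp at h5
    exact (IsProbabilityMeasure.ne_zero p) h5

-- The whitening map is the symmetric square root of the inverse covariance.
open scoped MatrixOrder Matrix.Norms.L2Operator in
theorem IsLawOn.exists_whitens (hp : IsLawOn p K) : ∃ A : E n ≃L[ℝ] E n, Whitens A p := by
  have hpos := hp.covMat_posDef
  obtain ⟨M, hM⟩ : ∃ M : Matrix (Fin n) (Fin n) ℝ, (covMat p)⁻¹ = Mᵀ * M := by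
    have hnn := hpos.inv.posSemidef.nonneg
    refine ⟨CFC.sqrt (covMat p)⁻¹, ?_⟩
    have h1 := (CFC.sqrt_nonneg (covMat p)⁻¹).isSelfAdjoint.star_eq
    rw [Matrix.star_eq_conjTranspose, Matrix.conjTranspose_eq_transpose_of_trivial] at h1
    rw [h1, CFC.sqrt_mul_sqrt_self _ hnn]
  have hdetS : (covMat p).det ≠ 0 := hpos.det_pos.ne'
  have hdet : (covMat p)⁻¹.det = M.det ^ 2 := by
    rw [hM, Matrix.det_mul, Matrix.det_transpose, sq]
  have hMdet : M.det ≠ 0 := by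
    intro h
    rw [h, Matrix.det_nonsing_inv, Ring.inverse_eq_inv'] at hdet
    simp [hdetS] at hdet
  have hMu : IsUnit M.det := isUnit_iff_ne_zero.2 hMdet
  set L : E n →ₗ[ℝ] E n := Matrix.toEuclideanLin M
  have hLdet : LinearMap.det L = M.det := by
    simp only [L, Matrix.toLpLin_eq_toLin]
    exact LinearMap.det_toLin _ _
  have hL : ∀ v : E n, (L v).ofLp = M *ᵥ v.ofLp := fun v => by
    simp [L, Matrix.toLpLin_apply]
  set A : E n ≃L[ℝ] E n :=
    (LinearEquiv.ofIsUnitDet (v := (EuclideanSpace.basisFun (Fin n) ℝ).toBasis)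
      (v' := (EuclideanSpace.basisFun (Fin n) ℝ).toBasis) (f := L) (by
        rw [LinearMap.det_toMatrix, hLdet]; exact hMu)).toContinuousLinearEquiv
  have hA : ∀ v, A v = L v := fun v => rfl
  have hinner : ∀ w v : E n, ⟪w, v⟫_ℝ = w.ofLp ⬝ᵥ v.ofLp := by
    intro w v
    rw [EuclideanSpace.inner_eq_star_dotProduct, star_trivial, dotProduct_comm]
  refine ⟨A, ?_, ?_, ?_⟩
  · intro v
    have h1 : v.ofLp ⬝ᵥ ((covMat p)⁻¹ *ᵥ v.ofLp) = ‖A v‖ ^ 2 := by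
      rw [← real_inner_self_eq_norm_sq, hinner, hA, hL, hM, ← Matrix.mulVec_mulVec,
        Matrix.dotProduct_mulVec, Matrix.vecMul_transpose]
    rw [matNorm, h1, Real.sqrt_sq (norm_nonneg _)]
  · intro w
    set v : E n := WithLp.toLp 2 (Mᵀ *ᵥ w.ofLp)
    have h1 : ∀ x : E n, ⟪w, A (x - mean p)⟫_ℝ = ⟪v, x - mean p⟫_ℝ := by
      intro x
      rw [hinner, hinner, hA, hL, Matrix.dotProduct_mulVec, ← Matrix.mulVec_transpose]
    simp only [h1]
    rw [hp.integral_inner_sub_mean_sq, ← real_inner_self_eq_norm_sq, hinner]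
    have h2 : M * covMat p * Mᵀ = 1 := by
      have h3 : covMat p = M⁻¹ * (Mᵀ)⁻¹ := by
        rw [← Matrix.mul_inv_rev, ← hM, Matrix.nonsing_inv_nonsing_inv _
          (isUnit_iff_ne_zero.2 hdetS)]
      rw [h3, ← Matrix.mul_assoc, Matrix.mul_nonsing_inv _ hMu, Matrix.one_mul,
        Matrix.nonsing_inv_mul _ (by rwa [Matrix.det_transpose])]
    have h4 : v.ofLp = Mᵀ *ᵥ w.ofLp := rfl
    rw [h4, Matrix.mulVec_mulVec, Matrix.dotProduct_mulVec, Matrix.mulVec_transpose,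
      Matrix.vecMul_vecMul, ← Matrix.mul_assoc, h2, Matrix.vecMul_one]
  · have : LinearMap.det (A : E n →ₗ[ℝ] E n) = M.det := hLdet
    rw [this, ← hdet, Matrix.det_nonsing_inv, Ring.inverse_eq_inv', inv_inv]

variable {A : E n ≃L[ℝ] E n}

lemma Whitens.ellipsoid_eq (hA : Whitens A p) (r : ℝ) :
    ellipsoid p r = {x | ‖A (x - mean p)‖ ≤ r} := by
  ext x
  simp [ellipsoid, hA.norm]

lemma Whitens.isClosed_ellipsoid (hA : Whitens A p) (r : ℝ) : IsClosed (ellipsoid p r) := by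
  rw [hA.ellipsoid_eq]
  exact isClosed_le (by fun_prop) continuous_const

lemma Whitens.convex_ellipsoid (hA : Whitens A p) (r : ℝ) : Convex ℝ (ellipsoid p r) := by
  have : ellipsoid p r =
      (fun x => x + -mean p) ⁻¹' ((A : E n →ₗ[ℝ] E n) ⁻¹' Metric.closedBall 0 r) := by
    rw [hA.ellipsoid_eq]; ext x; simp [sub_eq_add_neg]
  rw [this]
  exact ((convex_closedBall _ _).linear_preimage _).translate_preimage_left _

lemma Whitens.integral_norm_sq (hA : Whitens A p) (hp : IsLawOn p K) :
    ∫ x, ‖A (x - mean p)‖ ^ 2 ∂p = n := by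
  have h1 : ∀ x, ‖A (x - mean p)‖ ^ 2 =
      ∑ i, ⟪EuclideanSpace.basisFun (Fin n) ℝ i, A (x - mean p)⟫_ℝ ^ 2 := fun x =>
    ((EuclideanSpace.basisFun (Fin n) ℝ).sum_sq_inner_right _).symm
  simp only [h1]
  rw [integral_finsetSum _ fun i _ =>
    hp.integrable ((continuous_const.inner (by fun_prop)).pow 2)]
  simp only [hA.moment]
  simp

lemma Whitens.measure_compl_ellipsoid_le (hA : Whitens A p) (hp : IsLawOn p K) {r : ℝ}
    (hr : 0 < r) : p.real (ellipsoid p r)ᶜ ≤ n / r ^ 2 := by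
  have := hp.prob
  have h1 := mul_meas_ge_le_integral_of_nonneg (μ := p) (f := fun x => ‖A (x - mean p)‖ ^ 2)
    (Filter.Eventually.of_forall fun x => by positivity) (hp.integrable (by fun_prop)) (r ^ 2)
  rw [hA.integral_norm_sq hp] at h1
  rw [le_div_iff₀ (by positivity), mul_comm]
  refine le_trans (mul_le_mul_of_nonneg_left (measureReal_mono fun x hx => ?_) (sq_nonneg _)) h1
  rw [hA.ellipsoid_eq] at hx
  have hx' : r < ‖A (x - mean p)‖ := by simpa using hx
  change r ^ 2 ≤ ‖A (x - mean p)‖ ^ 2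
  gcongr

lemma Whitens.measure_le_abs_inner_le (hA : Whitens A p) (hp : IsLawOn p K) (w : E n) {t : ℝ}
    (ht : 0 < t) : p.real {x | t ≤ |⟪w, A (x - mean p)⟫_ℝ|} ≤ ‖w‖ ^ 2 / t ^ 2 := by
  have := hp.prob
  have h1 := mul_meas_ge_le_integral_of_nonneg (μ := p)
    (f := fun x => ⟪w, A (x - mean p)⟫_ℝ ^ 2)
    (Filter.Eventually.of_forall fun x => by positivity)
    (hp.integrable ((continuous_const.inner (by fun_prop)).pow 2)) (t ^ 2)
  rw [hA.moment] at h1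
  rw [le_div_iff₀ (by positivity), mul_comm]
  refine le_trans (mul_le_mul_of_nonneg_left (measureReal_mono fun x hx => ?_) (sq_nonneg _)) h1
  change t ^ 2 ≤ ⟪w, A (x - mean p)⟫_ℝ ^ 2
  rw [← sq_abs ⟪w, A (x - mean p)⟫_ℝ]
  gcongr
  exact hx

lemma Whitens.integral_inner_eq_zero (hp : IsLawOn p K) (A : E n ≃L[ℝ] E n) (w : E n) :
    ∫ x, ⟪w, A (x - mean p)⟫_ℝ ∂p = 0 := by
  have := hp.integral_inner_sub_mean ((ContinuousLinearMap.adjoint (A : E n →L[ℝ] E n)) w)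
  simpa [ContinuousLinearMap.adjoint_inner_left] using this

end Law

/-! ### Bounds on the parameters -/

section Params

variable {n T : ℕ}

lemma log_two_le_log (hn : 1 ≤ n) (hT : n < T) : (0.69 : ℝ) ≤ Real.log T := by
  have h2 : (2 : ℝ) ≤ T := by exact_mod_cast (by omega : 2 ≤ T)
  have h3 := Real.log_le_log (by norm_num) h2
  have := Real.log_two_gt_d9
  linarith

lemma eps_pos : 0 < (params n T).eps := by simp only [params]; positivity

lemma eps_eq : (params n T).eps = 1 / (1600 * Real.exp 1) := by
  simp only [params]; congr 1; ring

lemma eps_le : (params n T).eps ≤ 1 / 4348 := by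
  have h := Real.exp_one_gt_d9
  rw [eps_eq]
  apply one_div_le_one_div_of_le <;> linarith

lemma alpha_ge' : 3 * 10 ^ 12 * ((n : ℝ) ^ 2 * Real.log T ^ 2) ≤ (params n T).alpha := by
  have h := Real.exp_one_gt_d9
  have h1 : (5.4365 : ℝ) ^ 17 ≤ (2 * Real.exp 1) ^ 17 := by
    gcongr; linarith
  have h2 : (3 * 10 ^ 12 : ℝ) ≤ (5.4365 : ℝ) ^ 17 := by norm_num
  simp only [params]
  rw [mul_assoc ((2 * Real.exp 1) ^ 17)]
  gcongr
  exact h2.trans h1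

lemma alpha_ge (hn : 1 ≤ n) (hT : n < T) : 10 ^ 12 * (n : ℝ) ≤ (params n T).alpha := by
  refine le_trans ?_ alpha_ge'
  have hL := log_two_le_log hn hT
  have hn' : (1 : ℝ) ≤ n := by exact_mod_cast hn
  have h1 : (0.47 : ℝ) ≤ Real.log T ^ 2 := by nlinarith
  have h2 : (n : ℝ) * 0.47 ≤ (n : ℝ) ^ 2 * Real.log T ^ 2 := by
    apply mul_le_mul _ h1 (by norm_num) (by positivity)
    nlinarith
  linarith

lemma alpha_pos (hn : 1 ≤ n) (hT : n < T) : 0 < (params n T).alpha := by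
  have := alpha_ge hn hT
  have hn' : (1 : ℝ) ≤ n := by exact_mod_cast hn
  linarith

/-- `lam` is a perfect square, so its root, which enters the radius of the typical set, is explicit.
-/
lemma lam_eq : (params n T).lam =
    ((params n T).eps ^ 2 / (10 ^ 3 * (n : ℝ) ^ 2 * (params n T).alpha * Real.log T)) ^ 2 := by
  simp only [params]
  rw [div_pow]
  ring

lemma lam_pos (hn : 1 ≤ n) (hT : n < T) : 0 < (params n T).lam := by
  have hL := log_two_le_log hn hT
  have hn' : (1 : ℝ) ≤ n := by exact_mod_cast hn
  have h1 := eps_pos (n := n) (T := T)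
  have h2 := alpha_pos hn hT
  rw [lam_eq]
  positivity

lemma sqrt_lam (hn : 1 ≤ n) (hT : n < T) : Real.sqrt (params n T).lam =
    (params n T).eps ^ 2 / (10 ^ 3 * (n : ℝ) ^ 2 * (params n T).alpha * Real.log T) := by
  have hL := log_two_le_log hn hT
  have h2 := alpha_pos hn hT
  rw [lam_eq, Real.sqrt_sq (by positivity)]

lemma lam_le (hn : 1 ≤ n) (hT : n < T) : (params n T).lam ≤ 1 / 10 ^ 6 := by
  have hL := log_two_le_log hn hT
  have hn' : (1 : ℝ) ≤ n := by exact_mod_cast hn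
  have h1 := eps_pos (n := n) (T := T)
  have h1' := eps_le (n := n) (T := T)
  have h2 := alpha_ge hn hT
  have h2' := alpha_pos hn hT
  have hL' : 0 < Real.log T := by linarith
  have h3 : (params n T).eps ^ 2 / (10 ^ 3 * (n : ℝ) ^ 2 * (params n T).alpha * Real.log T) ≤
      1 / 10 ^ 3 := by
    rw [div_le_iff₀ (by positivity)]
    have h4 : (1 : ℝ) ≤ (n : ℝ) ^ 2 * ((params n T).alpha * Real.log T) := by
      have h5 : (1 : ℝ) ≤ (n : ℝ) ^ 2 := by nlinarith
      have h6 : (1 : ℝ) ≤ (params n T).alpha * Real.log T := by nlinarith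
      nlinarith
    have h7 : (params n T).eps ^ 2 ≤ 1 := by nlinarith
    nlinarith
  rw [lam_eq]
  calc _ ≤ (1 / 10 ^ 3 : ℝ) ^ 2 := by gcongr
    _ = 1 / 10 ^ 6 := by norm_num

end Params

/-- The variance `(ε² / (n log T)) (λ / (2 - λ))` of the core in isotropic position. -/
def coreVar (P : Params) (n : ℕ) : ℝ := P.eps ^ 2 / (n * Real.log P.T) * (P.lam / (2 - P.lam))

lemma coreVar_pos {n T : ℕ} (hn : 1 ≤ n) (hT : n < T) : 0 < coreVar (params n T) n := by
  have hL := log_two_le_log hn hT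
  have hn' : (1 : ℝ) ≤ n := by exact_mod_cast hn
  have h1 := eps_pos (n := n) (T := T)
  have h2 := lam_pos hn hT
  have h3 := lam_le hn hT
  have h4 : 0 < 2 - (params n T).lam := by norm_num at h3; linarith
  have h5 : 0 < Real.log ((params n T).T : ℝ) := by change 0 < Real.log (T : ℝ); linarith
  unfold coreVar
  positivity

/-! ### Continuity of the estimates -/

lemma continuous_matNorm {n : ℕ} (A : Matrix (Fin n) (Fin n) ℝ) : Continuous (matNorm A) := by
  unfold matNorm dotProduct Matrix.mulVec dotProduct
  fun_prop

lemma continuous_gaussianDensity {n : ℕ} (m : E n) (S : Matrix (Fin n) (Fin n) ℝ) :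
    Continuous (gaussianDensity m S) := by
  unfold gaussianDensity
  have := continuous_matNorm S⁻¹
  fun_prop

lemma continuous_kernel {n : ℕ} (P : Params) (p : Measure (E n)) :
    Continuous fun z : E n × E n => kernel P p z.1 z.2 := by
  unfold kernel coreDensity
  have := continuous_gaussianDensity (mean p)
    ((P.eps ^ 2 / (n * Real.log P.T) * (P.lam / (2 - P.lam))) • covMat p)
  fun_prop

lemma continuous_lossEst {n : ℕ} (S : State n) (P : Params) (K : Set (E n)) (x : E n)
    (l : E n → ℝ) : Continuous (S.lossEst P K x l) := by
  unfold State.lossEst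
  have := (continuous_kernel P S.weights).comp (Continuous.prodMk_right x)
  exact continuous_const.mul this

/-! ### Regular states -/

/-- The properties that all the states of the algorithm share. -/
structure State.Regular {n : ℕ} (S : State n) : Prop where
  support_compact : IsCompact S.support
  support_convex : Convex ℝ S.support
  focus_closed : IsClosed S.focus
  focus_convex : Convex ℝ S.focus
  focus_subset : S.focus ⊆ S.support
  volume_focus : volume S.focus ≠ 0
  score_cont : Continuous S.score
  rate_pos : 0 < S.rate

/-- The normalizing constant of the exponential weights. -/
def State.partition {n : ℕ} (S : State n) : ℝ := ∫ z in S.support, Real.exp (-S.potential z)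

namespace State.Regular

variable {n : ℕ} {S : State n}

lemma focus_compact (hS : S.Regular) : IsCompact S.focus :=
  hS.support_compact.of_isClosed_subset hS.focus_closed hS.focus_subset

lemma focus_nonempty (hS : S.Regular) : S.focus.Nonempty :=
  nonempty_of_measure_ne_zero hS.volume_focus

lemma interior_focus_nonempty (hS : S.Regular) : (interior S.focus).Nonempty := by
  by_contra h
  rw [not_nonempty_iff_eq_empty] at h
  apply hS.volume_focus
  have h1 : frontier S.focus = S.focus := by
    rw [frontier, h, sdiff_empty, hS.focus_closed.closure_eq]
  rw [← h1]
  exact hS.focus_convex.addHaar_frontier volume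

lemma volume_support (hS : S.Regular) : volume S.support ≠ 0 := fun h =>
  hS.volume_focus (measure_mono_null hS.focus_subset h)

lemma support_nonempty (hS : S.Regular) : S.support.Nonempty :=
  nonempty_of_measure_ne_zero hS.volume_support

lemma potential_cont (hS : S.Regular) : Continuous S.potential :=
  hS.score_cont.sub continuous_const

lemma potential_nonneg (hS : S.Regular) {x : E n} (hx : x ∈ S.support) : 0 ≤ S.potential x :=
  sub_nonneg.2 (csInf_le (hS.support_compact.image hS.score_cont).bddBelow
    (mem_image_of_mem _ hx))

lemma exists_potential_eq_zero (hS : S.Regular) : ∃ z ∈ S.support, S.potential z = 0 := by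
  obtain ⟨z, hz, hz'⟩ := hS.support_compact.exists_sInf_image_eq hS.support_nonempty
    hS.score_cont.continuousOn
  exact ⟨z, hz, by simp [State.potential, hz']⟩

lemma exp_cont (hS : S.Regular) : Continuous fun z => Real.exp (-S.potential z) :=
  Real.continuous_exp.comp hS.potential_cont.neg

lemma integrableOn_exp (hS : S.Regular) :
    IntegrableOn (fun z => Real.exp (-S.potential z)) S.support :=
  hS.exp_cont.continuousOn.integrableOn_compact hS.support_compact

lemma partition_pos (hS : S.Regular) : 0 < S.partition := by
  unfold State.partition
  rw [setIntegral_pos_iff_support_of_nonneg_ae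
    (Filter.Eventually.of_forall fun z => (Real.exp_pos _).le) hS.integrableOn_exp]
  have : Function.support (fun z => Real.exp (-S.potential z)) = univ := by
    ext z; simp [(Real.exp_pos _).ne']
  rw [this, univ_inter]
  exact pos_iff_ne_zero.2 hS.volume_support

lemma weights_eq (hS : S.Regular) : S.weights = (volume.restrict S.support).withDensity
    fun x => ENNReal.ofReal (Real.exp (-S.potential x) / S.partition) := by
  rw [← withDensity_indicator hS.support_compact.measurableSet]
  unfold State.weights
  congr 1
  ext x
  by_cases hx : x ∈ S.support
  · simp [hx, State.partition]
  · simp [hx]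

lemma integral_weights (hS : S.Regular) (g : E n → ℝ) :
    ∫ x, g x ∂S.weights =
      (∫ x in S.support, Real.exp (-S.potential x) * g x) / S.partition := by
  have hZ := hS.partition_pos
  have hc := hS.exp_cont
  rw [hS.weights_eq, integral_withDensity_eq_integral_toReal_smul]
  · rw [← integral_div]
    refine integral_congr_ae (Filter.Eventually.of_forall fun x => ?_)
    simp only [smul_eq_mul]
    rw [ENNReal.toReal_ofReal (div_nonneg (Real.exp_pos _).le hZ.le)]
    ring
  · exact (by fun_prop : Continuous fun x => Real.exp (-S.potential x) / S.partition).measurable.ennreal_ofReal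
  · exact Filter.Eventually.of_forall fun x => ENNReal.ofReal_lt_top

lemma setIntegral_weights (hS : S.Regular) (g : E n → ℝ) {A : Set (E n)}
    (hA : MeasurableSet A) (hAS : A ⊆ S.support) : ∫ x in A, g x ∂S.weights =
      (∫ x in A, Real.exp (-S.potential x) * g x) / S.partition := by
  rw [← integral_indicator hA, hS.integral_weights]
  congr 1
  have : (fun x => Real.exp (-S.potential x) * A.indicator g x) =
      A.indicator fun x => Real.exp (-S.potential x) * g x := by
    ext x
    by_cases hx : x ∈ A <;> simp [hx]
  rw [this, integral_indicator hA, Measure.restrict_restrict hA, inter_eq_left.2 hAS]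

lemma isLawOn (hS : S.Regular) : IsLawOn S.weights S.support := by
  have hZ := hS.partition_pos
  have hnull : S.weights S.supportᶜ = 0 := by
    rw [hS.weights_eq]
    exact withDensity_absolutelyContinuous _ _ (by simp [Measure.restrict_apply
      hS.support_compact.measurableSet.compl])
  have hac : S.weights ≪ volume := by
    unfold State.weights; exact withDensity_absolutelyContinuous _ _
  have hc := hS.exp_cont
  refine ⟨⟨?_⟩, hS.support_compact, hnull, hac⟩
  rw [hS.weights_eq, withDensity_apply _ MeasurableSet.univ, Measure.restrict_univ,
    ← ofReal_integral_eq_lintegral_ofReal]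
  · rw [integral_div]
    change ENNReal.ofReal (S.partition / S.partition) = 1
    rw [div_self hZ.ne', ENNReal.ofReal_one]
  · exact hS.integrableOn_exp.div_const _
  · exact Filter.Eventually.of_forall fun x => div_nonneg (Real.exp_pos _).le hZ.le

lemma weights_real (hS : S.Regular) {A : Set (E n)} (hA : MeasurableSet A)
    (hAS : A ⊆ S.support) :
    S.weights.real A = (∫ x in A, Real.exp (-S.potential x)) / S.partition := by
  have := hS.setIntegral_weights (fun _ => 1) hA hAS
  simpa using this

lemma update (hS : S.Regular) (P : Params) (K : Set (E n)) (x : E n) (l : E n → ℝ) :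
    (S.update P K x l).Regular where
  support_compact := hS.focus_compact
  support_convex := hS.focus_convex
  focus_closed := hS.focus_closed
  focus_convex := hS.focus_convex
  focus_subset := subset_rfl
  volume_focus := hS.volume_focus
  score_cont := hS.score_cont.add (continuous_const.mul (continuous_lossEst S P K x l))
  rate_pos := hS.rate_pos

/-- Chebyshev: the whitened norm has second moment `n`. -/
lemma one_half_lt_weights_ellipsoid {r : ℝ} (hS : S.Regular) (hr : (n : ℝ) / r ^ 2 < 1 / 100)
    (hr0 : 0 < r) : 99 / 100 < S.weights.real (S.support ∩ ellipsoid S.weights r) := by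
  have hp := hS.isLawOn
  have := hp.prob
  obtain ⟨A, hA⟩ := hp.exists_whitens
  have h1 := hA.measure_compl_ellipsoid_le hp hr0
  have h2 := measureReal_add_measureReal_compl (μ := S.weights)
    (hA.isClosed_ellipsoid r).measurableSet
  have h3 : S.weights.real (S.support ∩ ellipsoid S.weights r) =
      S.weights.real (ellipsoid S.weights r) := by
    rw [inter_comm]
    refine measureReal_congr ?_
    exact inter_ae_eq_left_of_ae_eq_univ (ae_eq_univ.2 hp.null)
  rw [h3]
  simp only [probReal_univ] at h2
  linarith

end State.Regular

lemma div_sq_alpha_lt {n T : ℕ} (hn : 1 ≤ n) (hT : n < T) {r : ℝ}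
    (hr : (params n T).alpha ≤ r) : (n : ℝ) / r ^ 2 < 1 / 100 := by
  have h := alpha_ge hn hT
  have hn' : (1 : ℝ) ≤ n := by exact_mod_cast hn
  have hr1 : (10 : ℝ) ^ 12 ≤ r := by linarith
  rw [div_lt_div_iff₀ (by positivity) (by norm_num)]
  nlinarith

/-- The cut region has positive volume because the weights, which are absolutely continuous, charge
it. -/
lemma State.Regular.focus_inter_ellipsoid {n T : ℕ} {S : State n} (hn : 1 ≤ n) (hT : n < T)
    (hS : S.Regular) (hfs : S.focus = S.support) :
    IsClosed (S.focus ∩ ellipsoid S.weights (params n T).alpha) ∧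
    Convex ℝ (S.focus ∩ ellipsoid S.weights (params n T).alpha) ∧
    volume (S.focus ∩ ellipsoid S.weights (params n T).alpha) ≠ 0 := by
  obtain ⟨A, hA⟩ := hS.isLawOn.exists_whitens
  refine ⟨hS.focus_closed.inter (hA.isClosed_ellipsoid _),
    hS.focus_convex.inter (hA.convex_ellipsoid _), fun h0 => ?_⟩
  have h1 := hS.one_half_lt_weights_ellipsoid (div_sq_alpha_lt hn hT le_rfl) (alpha_pos hn hT)
  rw [← hfs] at h1
  have h2 := hS.isLawOn.ac h0
  rw [measureReal_def, h2] at h1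
  norm_num at h1

lemma gamma_pos {n T : ℕ} (hn : 1 ≤ n) (hT : n < T) : 0 < (params n T).gamma := by
  have hL := log_two_le_log hn hT
  have hn' : (1 : ℝ) ≤ n := by exact_mod_cast hn
  have : 0 < Real.logb 2 T := Real.logb_pos (by norm_num) (by exact_mod_cast (by omega : 1 < T))
  simp only [params]
  positivity

lemma State.Regular.step {n T : ℕ} {S : State n} (hn : 1 ≤ n) (hT : n < T) (hS : S.Regular)
    (K : Set (E n)) (x : E n) (l : E n → ℝ) : (S.step (params n T) K x l).Regular := by
  have hS' := hS.update (params n T) K x l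
  obtain ⟨h1, h2, h3⟩ := hS'.focus_inter_ellipsoid hn hT rfl
  have hg := gamma_pos hn hT
  simp only [State.step]
  split_ifs with h
  · exact
    { support_compact := hS'.support_compact
      support_convex := hS'.support_convex
      focus_closed := h1
      focus_convex := h2
      focus_subset := inter_subset_left
      volume_focus := h3
      score_cont := hS'.score_cont
      rate_pos := mul_pos (by linarith) hS.rate_pos }
  · exact hS'

lemma State.Regular.init {n T : ℕ} {K : Set (E n)} (hn : 1 ≤ n) (hT : n < T) (hK : IsBody K) :
    (State.init (params n T) K).Regular where
  support_compact := hK.compact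
  support_convex := hK.convex
  focus_closed := hK.compact.isClosed
  focus_convex := hK.convex
  focus_subset := subset_rfl
  volume_focus := fun h => (isOpen_interior.measure_pos volume hK.interior_nonempty).ne'
    (measure_mono_null interior_subset h)
  score_cont := continuous_const
  rate_pos := by
    have hL := log_two_le_log hn hT
    have hn' : (1 : ℝ) ≤ n := by exact_mod_cast hn
    have hT' : (1 : ℝ) ≤ T := by exact_mod_cast (by omega : 1 ≤ T)
    simp only [State.init, params]
    positivity

/-- More than half of a convex set cannot lie in an ellipsoid far from one of its points. -/
lemma subset_ellipsoid_of_volume_lt {n : ℕ} (hn : 1 ≤ n) {p : Measure (E n)}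
    {A : E n ≃L[ℝ] E n} (hA : Whitens A p) {F : Set (E n)} (hF : IsCompact F)
    (hFc : Convex ℝ F) {r : ℝ} (hr : 0 < r)
    (hvol : volume F / 2 < volume (F ∩ ellipsoid p r)) : F ⊆ ellipsoid p (10 * n * r) := by
  intro y hy
  by_contra hne
  have hn' : (1 : ℝ) ≤ n := by exact_mod_cast hn
  set G := F ∩ ellipsoid p r
  have hG : IsCompact G := hF.inter_right (hA.isClosed_ellipsoid r)
  set R := ‖A (y - mean p)‖
  have hR : 10 * n * r < R := by
    rw [hA.ellipsoid_eq] at hne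
    exact not_le.1 hne
  set h : ℝ → E n → E n := fun s => AffineMap.homothety y (1 - s)
  have hh : ∀ s z, h s z = (1 - s) • z + s • y := by
    intro s z
    simp only [h, AffineMap.homothety_apply, vsub_eq_sub, vadd_eq_add]
    module
  have hsub : ∀ s, 0 ≤ s → s ≤ 1 → h s '' G ⊆ F := by
    rintro s hs hs1 _ ⟨z, hz, rfl⟩
    rw [hh]
    exact hFc hz.1 hy (by linarith) hs (by ring)
  have hcomp : ∀ s, IsCompact (h s '' G) := fun s =>
    hG.image (by
      have : h s = fun z => (1 - s) • z + s • y := funext (hh s)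
      rw [this]; fun_prop)
  have hbd : ∀ s, 0 ≤ s → s ≤ 1 → ∀ w ∈ h s '' G, s * R - (1 - s) * r ≤ ‖A (w - mean p)‖ ∧
      ‖A (w - mean p)‖ ≤ s * R + (1 - s) * r := by
    rintro s hs hs1 _ ⟨z, hz, rfl⟩
    have hz2 : ‖A (z - mean p)‖ ≤ r := by
      have := hz.2; rwa [hA.ellipsoid_eq] at this
    have h1 : A (h s z - mean p) = s • A (y - mean p) + (1 - s) • A (z - mean p) := by
      rw [hh, ← map_smul, ← map_smul, ← map_add]
      congr 1
      module
    have h2 : ‖s • A (y - mean p)‖ = s * R := by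
      rw [norm_smul, Real.norm_of_nonneg hs]
    have h3 : ‖(1 - s) • A (z - mean p)‖ ≤ (1 - s) * r := by
      rw [norm_smul, Real.norm_of_nonneg (by linarith)]
      exact mul_le_mul_of_nonneg_left hz2 (by linarith)
    rw [h1]
    constructor
    · have := norm_sub_le_norm_add (s • A (y - mean p)) ((1 - s) • A (z - mean p))
      linarith
    · exact (norm_add_le _ _).trans (by linarith)
  have hvs : ∀ s, 0 ≤ s → s ≤ 1 → ENNReal.ofReal (1 - n * s) * volume G ≤ volume (h s '' G) := by
    intro s hs hs1
    simp only [h]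
    rw [Measure.addHaar_image_homothety]
    gcongr
    rw [finrank_euclideanSpace_fin]
    have := one_add_mul_le_pow (show -2 ≤ -s by linarith) n
    rw [abs_of_nonneg (pow_nonneg (by linarith) _)]
    calc 1 - n * s = 1 + n * -s := by ring
      _ ≤ (1 + -s) ^ n := this
      _ = (1 - s) ^ n := by ring
  -- Two copies of `G` contracted towards `y` keep at least `4/5` and `3/5` of its volume. Since `s₁
  -- R > 2 r`, these two and `G` itself are disjoint subsets of `F`, of total volume at least `12/5`
  -- that of `G`; but `G` is more than half of `F`.
  set s₁ : ℝ := 1 / (5 * n)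
  set s₂ : ℝ := 2 / (5 * n)
  have hs1 : 0 ≤ s₁ := by positivity
  have hs12 : s₂ = 2 * s₁ := by simp only [s₁, s₂]; ring
  have hns1 : n * s₁ = 1 / 5 := by simp only [s₁]; field_simp
  have hs1' : s₁ ≤ 1 / 5 := by nlinarith
  have hRs : 2 * r < s₁ * R := by
    have : s₁ * (10 * n * r) < s₁ * R :=
      mul_lt_mul_of_pos_left hR (by positivity)
    calc 2 * r = (n * s₁) * (10 * r) := by rw [hns1]; ring
      _ = s₁ * (10 * n * r) := by ring
      _ < _ := this
  have hd1 : Disjoint G (h s₁ '' G) := by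
    rw [Set.disjoint_left]
    intro w hw hw'
    have h1 := (hbd s₁ hs1 (by linarith) w hw').1
    have h2 : ‖A (w - mean p)‖ ≤ r := by
      have := hw.2; rwa [hA.ellipsoid_eq] at this
    nlinarith
  have hd2 : Disjoint (G ∪ h s₁ '' G) (h s₂ '' G) := by
    rw [Set.disjoint_left]
    intro w hw hw'
    have h1 := (hbd s₂ (by linarith) (by linarith) w hw').1
    rw [hs12] at h1
    rcases hw with hw | hw
    · have h2 : ‖A (w - mean p)‖ ≤ r := by
        have := hw.2; rwa [hA.ellipsoid_eq] at this
      nlinarith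
    · have h2 := (hbd s₁ hs1 (by linarith) w hw).2
      nlinarith
  have hvF : volume F ≠ ∞ := hF.measure_lt_top.ne
  have hvG : volume G ≠ ∞ := hG.measure_lt_top.ne
  have htot : volume G + volume (h s₁ '' G) + volume (h s₂ '' G) ≤ volume F := by
    rw [← measure_union hd1 (hcomp s₁).measurableSet, ← measure_union hd2 (hcomp s₂).measurableSet]
    exact measure_mono (union_subset (union_subset inter_subset_left
      (hsub s₁ hs1 (by linarith))) (hsub s₂ (by linarith) (by linarith)))
  have h1 := hvs s₁ hs1 (by linarith)
  have h2 := hvs s₂ (by linarith) (by linarith)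
  rw [hns1] at h1
  rw [show n * s₂ = 2 / 5 by rw [hs12]; linarith] at h2
  have h3 : volume G + ENNReal.ofReal (1 - 1 / 5) * volume G +
      ENNReal.ofReal (1 - 2 / 5) * volume G ≤ volume F := le_trans (by gcongr) htot
  have h4 := ENNReal.toReal_mono hvF h3
  have h5 := (ENNReal.toReal_lt_toReal (ENNReal.div_ne_top hvF (by norm_num)) hvG).2 hvol
  rw [ENNReal.toReal_add (by finiteness) (by finiteness), ENNReal.toReal_add (by finiteness)
    (by finiteness), ENNReal.toReal_mul, ENNReal.toReal_mul, ENNReal.toReal_ofReal (by norm_num),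
    ENNReal.toReal_ofReal (by norm_num)] at h4
  rw [ENNReal.toReal_div] at h5
  norm_num at h5
  linarith [ENNReal.toReal_nonneg (a := volume F)]

/-! ### The standard Gaussian law -/

/-- The density of the standard Gaussian law on `ℝⁿ`. -/
def stdDensity (n : ℕ) (z : E n) : ℝ :=
  (Real.sqrt ((2 * Real.pi) ^ n))⁻¹ * Real.exp (-‖z‖ ^ 2 / 2)

lemma stdDensity_pos {n : ℕ} (z : E n) : 0 < stdDensity n z := by
  unfold stdDensity; positivity

lemma continuous_stdDensity (n : ℕ) : Continuous (stdDensity n) := by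
  unfold stdDensity; fun_prop

lemma integral_exp_neg_mul_norm_sq {n : ℕ} {b : ℝ} (hb : 0 < b) :
    ∫ z : E n, Real.exp (-b * ‖z‖ ^ 2) = Real.sqrt ((Real.pi / b) ^ n) := by
  rw [GaussianFourier.integral_rexp_neg_mul_sq_norm hb, finrank_euclideanSpace_fin,
    Real.sqrt_eq_rpow, ← Real.rpow_natCast, ← Real.rpow_mul (by positivity)]
  congr 1
  ring

lemma integrable_exp_neg_mul_norm_sq {n : ℕ} {b : ℝ} (hb : 0 < b) :
    Integrable fun z : E n => Real.exp (-b * ‖z‖ ^ 2) := by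
  by_contra h
  have h1 := integral_undef h
  rw [integral_exp_neg_mul_norm_sq hb] at h1
  have : 0 < Real.sqrt ((Real.pi / b) ^ n) := by positivity
  linarith

lemma stdDensity_eq {n : ℕ} (z : E n) :
    stdDensity n z = (Real.sqrt ((2 * Real.pi) ^ n))⁻¹ * Real.exp (-(1 / 2) * ‖z‖ ^ 2) := by
  unfold stdDensity
  congr 2
  ring

lemma integrable_stdDensity (n : ℕ) : Integrable (stdDensity n) := by
  have := (integrable_exp_neg_mul_norm_sq (n := n) (b := 1 / 2) (by norm_num)).const_mul
    (Real.sqrt ((2 * Real.pi) ^ n))⁻¹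
  exact this.congr (Filter.Eventually.of_forall fun z => (stdDensity_eq z).symm)

/-- The characteristic functions agree. This links the explicit density to the moment and
convolution properties of `stdGaussian`. -/
theorem withDensity_stdDensity (n : ℕ) :
    volume.withDensity (fun z => ENNReal.ofReal (stdDensity n z)) = stdGaussian (E n) := by
  have hfin : IsFiniteMeasure
      (volume.withDensity (fun z => ENNReal.ofReal (stdDensity n z))) :=
    isFiniteMeasure_withDensity_ofReal (integrable_stdDensity n).2
  refine Measure.ext_of_charFun ?_
  ext t
  rw [charFun_stdGaussian, charFun_apply, integral_withDensity_eq_integral_toReal_smul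
    (continuous_stdDensity n).measurable.ennreal_ofReal
    (Filter.Eventually.of_forall fun _ => ENNReal.ofReal_lt_top)]
  have h1 := GaussianFourier.integral_cexp_neg_mul_sq_norm_add (b := 1 / 2) (by norm_num)
    Complex.I t
  have h2 : ∀ x : E n, (ENNReal.ofReal (stdDensity n x)).toReal • Complex.exp (⟪x, t⟫_ℝ * Complex.I)
      = ((Real.sqrt ((2 * Real.pi) ^ n))⁻¹ : ℝ) *
        Complex.exp (-(1 / 2) * (‖x‖ : ℂ) ^ 2 + Complex.I * ⟪t, x⟫_ℝ) := by
    intro x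
    rw [ENNReal.toReal_ofReal (stdDensity_pos x).le, stdDensity_eq, Complex.exp_add,
      Complex.real_smul, real_inner_comm x t]
    push_cast
    ring_nf
  simp only [h2]
  rw [integral_const_mul, h1, finrank_euclideanSpace_fin]
  have h3 : ((Real.pi : ℂ) / (1 / 2)) ^ ((n : ℂ) / 2) =
      ((Real.sqrt ((2 * Real.pi) ^ n) : ℝ) : ℂ) := by
    rw [Real.sqrt_eq_rpow, ← Real.rpow_natCast, ← Real.rpow_mul (by positivity),
      Complex.ofReal_cpow (by positivity)]
    push_cast
    congr 1 <;> ring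
  rw [h3, ← mul_assoc, ← Complex.ofReal_mul, inv_mul_cancel₀ (by positivity), Complex.ofReal_one,
    one_mul, Complex.I_sq]
  congr 1
  ring

lemma integral_stdGaussian {n : ℕ} {F : Type*} [NormedAddCommGroup F] [NormedSpace ℝ F]
    (g : E n → F) : ∫ z, g z ∂(stdGaussian (E n)) = ∫ z, stdDensity n z • g z := by
  rw [← withDensity_stdDensity, integral_withDensity_eq_integral_toReal_smul
    (continuous_stdDensity n).measurable.ennreal_ofReal
    (Filter.Eventually.of_forall fun _ => ENNReal.ofReal_lt_top)]
  exact integral_congr_ae (Filter.Eventually.of_forall fun z => by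
    simp only [ENNReal.toReal_ofReal (stdDensity_pos z).le])

lemma integrable_stdGaussian_iff {n : ℕ} {g : E n → ℝ} :
    Integrable g (stdGaussian (E n)) ↔ Integrable fun z => stdDensity n z * g z := by
  rw [← withDensity_stdDensity, integrable_withDensity_iff_integrable_smul'
    (continuous_stdDensity n).measurable.ennreal_ofReal
    (Filter.Eventually.of_forall fun _ => ENNReal.ofReal_lt_top)]
  refine integrable_congr (Filter.Eventually.of_forall fun z => ?_)
  simp only [ENNReal.toReal_ofReal (stdDensity_pos z).le, smul_eq_mul]

lemma stdDensity_mul_exp {n : ℕ} (s : ℝ) (z : E n) :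
    stdDensity n z * Real.exp (s * ‖z‖ ^ 2) =
      (Real.sqrt ((2 * Real.pi) ^ n))⁻¹ * Real.exp (-(1 / 2 - s) * ‖z‖ ^ 2) := by
  rw [stdDensity_eq, mul_assoc, ← Real.exp_add]
  congr 2
  ring

lemma integrable_exp_stdGaussian {n : ℕ} {s : ℝ} (hs : s < 1 / 2) :
    Integrable (fun z => Real.exp (s * ‖z‖ ^ 2)) (stdGaussian (E n)) := by
  rw [integrable_stdGaussian_iff]
  simp only [stdDensity_mul_exp]
  exact (integrable_exp_neg_mul_norm_sq (by linarith)).const_mul _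

lemma integral_exp_stdGaussian {n : ℕ} {s : ℝ} (hs : s < 1 / 2) :
    ∫ z, Real.exp (s * ‖z‖ ^ 2) ∂(stdGaussian (E n)) = Real.sqrt ((1 / (1 - 2 * s)) ^ n) := by
  have h0 : 0 < 1 - 2 * s := by linarith
  rw [integral_stdGaussian]
  simp only [smul_eq_mul, stdDensity_mul_exp]
  rw [integral_const_mul, integral_exp_neg_mul_norm_sq (by linarith), ← Real.sqrt_inv,
    ← Real.sqrt_mul (by positivity), ← inv_pow, ← mul_pow]
  congr 2
  have : Real.pi ≠ 0 := Real.pi_ne_zero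
  have h1 : 1 / 2 - s ≠ 0 := by intro h; apply h0.ne'; linarith
  field_simp

lemma integrable_norm_stdGaussian (n : ℕ) :
    Integrable (fun z : E n => ‖z‖) (stdGaussian (E n)) :=
  IsGaussian.integrable_id.norm

/-- The tail of the norm beyond `3 √(n log T)`. -/
lemma integral_tail_norm_stdGaussian_le {n T : ℕ} (hn : 1 ≤ n) (hT : n < T) :
    ∫ z, {z : E n | 9 * (n * Real.log T) < ‖z‖ ^ 2}.indicator (fun z => ‖z‖) z
      ∂(stdGaussian (E n)) ≤ 8 / (T : ℝ) ^ 3 := by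
  have hT2 : (2 : ℝ) ≤ T := by exact_mod_cast (by omega : 2 ≤ T)
  have hT0 : (0 : ℝ) < T := by linarith
  set L := Real.log T
  -- The exponent splits as `11/24 = 1/8 + 1/3`: the first part absorbs the factor `‖z‖`, the second
  -- converts `9 n log T` into the factor `T^(-3n)`, and `11/24 < 1/2` keeps the exponential
  -- integrable.
  have hpt : ∀ z : E n, {z : E n | 9 * (n * L) < ‖z‖ ^ 2}.indicator (fun z => ‖z‖) z ≤
      2 * Real.exp (-3 * (n * L)) * Real.exp (11 / 24 * ‖z‖ ^ 2) := by
    intro z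
    by_cases hz : 9 * (n * L) < ‖z‖ ^ 2
    · rw [indicator_of_mem (show z ∈ {z : E n | 9 * (n * L) < ‖z‖ ^ 2} from hz)]
      have h1 : ‖z‖ ≤ 2 * Real.exp (1 / 8 * ‖z‖ ^ 2) := by
        have := Real.add_one_le_exp (1 / 8 * ‖z‖ ^ 2)
        nlinarith [sq_nonneg (‖z‖ - 2)]
      have h2 : Real.exp (1 / 8 * ‖z‖ ^ 2) ≤
          Real.exp (-3 * (n * L)) * Real.exp (11 / 24 * ‖z‖ ^ 2) := by
        rw [← Real.exp_add, Real.exp_le_exp]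
        linarith
      linarith
    · rw [indicator_of_notMem (show z ∉ {z : E n | 9 * (n * L) < ‖z‖ ^ 2} from hz)]
      positivity
  have hmono := integral_mono_of_nonneg (μ := stdGaussian (E n))
    (Filter.Eventually.of_forall fun z => indicator_nonneg (fun z _ => norm_nonneg z) z)
    ((integrable_exp_stdGaussian (n := n) (s := 11 / 24) (by norm_num)).const_mul
      (2 * Real.exp (-3 * (n * L)))) (Filter.Eventually.of_forall hpt)
  refine hmono.trans ?_
  rw [integral_const_mul, integral_exp_stdGaussian (by norm_num)]
  have h3 : Real.exp (-3 * (n * L)) = (1 / (T : ℝ) ^ 3) ^ n := by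
    rw [show -3 * (n * L) = n * (-(3 * L)) by ring, Real.exp_nat_mul, Real.exp_neg,
      show 3 * L = ((3 : ℕ) : ℝ) * L by norm_num, Real.exp_nat_mul, Real.exp_log hT0, one_div]
  have h4 : Real.sqrt ((1 / (1 - 2 * (11 / 24 : ℝ))) ^ n) = (Real.sqrt 12) ^ n := by
    rw [show (1 / (1 - 2 * (11 / 24 : ℝ))) = 12 by norm_num,
      ← Real.sqrt_sq (pow_nonneg (Real.sqrt_nonneg 12) n), ← pow_mul, mul_comm n 2, pow_mul,
      Real.sq_sqrt (by norm_num)]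
  have h5 : Real.sqrt 12 ≤ 4 := by
    rw [Real.sqrt_le_left (by norm_num)]; norm_num
  rw [h3, h4, mul_assoc, ← mul_pow]
  have h6 : 1 / (T : ℝ) ^ 3 * Real.sqrt 12 ≤ 4 / (T : ℝ) ^ 3 := by
    rw [div_mul_eq_mul_div, one_mul]
    gcongr
  have h7 : 4 / (T : ℝ) ^ 3 ≤ 1 := by
    rw [div_le_one (by positivity)]
    nlinarith [sq_nonneg ((T : ℝ) - 2), mul_le_mul hT2 hT2 (by norm_num) (by linarith)]
  calc 2 * (1 / (T : ℝ) ^ 3 * Real.sqrt 12) ^ n ≤ 2 * (4 / (T : ℝ) ^ 3) ^ n := by gcongr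
    _ ≤ 2 * (4 / (T : ℝ) ^ 3) := by
      gcongr
      exact pow_le_of_le_one (by positivity) h7 (by omega)
    _ = 8 / (T : ℝ) ^ 3 := by ring

/-- A combination of independent standard Gaussian vectors is a standard Gaussian vector. -/
lemma integral_integral_stdGaussian {n : ℕ} {g : E n → ℝ} (hg : Integrable g (stdGaussian (E n)))
    (hgc : Continuous g) {c₁ c₂ : ℝ} (hc : c₁ ^ 2 + c₂ ^ 2 = 1) :
    ∫ z, ∫ w, g (c₁ • z + c₂ • w) ∂(stdGaussian (E n)) ∂(stdGaussian (E n)) =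
      ∫ z, g z ∂(stdGaussian (E n)) := by
  have hconv : (stdGaussian (E n)).map (c₁ • ·) ∗ (stdGaussian (E n)).map (c₂ • ·) =
      stdGaussian (E n) := by
    have := Measure.isProbabilityMeasure_map (μ := stdGaussian (E n)) (f := (c₁ • ·))
      (by fun_prop)
    have := Measure.isProbabilityMeasure_map (μ := stdGaussian (E n)) (f := (c₂ • ·))
      (by fun_prop)
    refine Measure.ext_of_charFun ?_
    ext t
    rw [charFun_conv, charFun_map_smul, charFun_map_smul, charFun_stdGaussian,
      charFun_stdGaussian, charFun_stdGaussian, ← Complex.exp_add]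
    congr 1
    rw [norm_smul, norm_smul]
    have : ((c₁ ^ 2 + c₂ ^ 2 : ℝ) : ℂ) = 1 := by rw [hc]; simp
    have h1 : ((|c₁| : ℝ) : ℂ) ^ 2 = (c₁ : ℂ) ^ 2 := by
      rw [← Complex.ofReal_pow, sq_abs, Complex.ofReal_pow]
    have h2 : ((|c₂| : ℝ) : ℂ) ^ 2 = (c₂ : ℂ) ^ 2 := by
      rw [← Complex.ofReal_pow, sq_abs, Complex.ofReal_pow]
    simp only [Real.norm_eq_abs, Complex.ofReal_mul, mul_pow, h1, h2]
    push_cast at this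
    linear_combination (-(‖t‖ : ℂ) ^ 2 / 2) * this
  conv_rhs => rw [← hconv]
  have := Measure.isProbabilityMeasure_map (μ := stdGaussian (E n)) (f := (c₁ • ·))
    (by fun_prop)
  have := Measure.isProbabilityMeasure_map (μ := stdGaussian (E n)) (f := (c₂ • ·))
    (by fun_prop)
  rw [integral_conv (by rw [hconv]; exact hg), integral_map (by fun_prop)]
  · refine integral_congr_ae (Filter.Eventually.of_forall fun z => ?_)
    simp only
    rw [integral_map (by fun_prop) (by fun_prop)]
  · refine StronglyMeasurable.aestronglyMeasurable ?_
    refine StronglyMeasurable.integral_prod_right' (f := fun q : E n × E n => g (q.1 + q.2)) ?_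
    exact (hgc.comp continuous_add).stronglyMeasurable

lemma integrable_comp_affine_stdGaussian {n : ℕ} {f : E n → ℝ} {Λ : ℝ≥0}
    (hf : LipschitzWith Λ f) (m : E n) (B : E n →L[ℝ] E n) :
    Integrable (fun z => f (m + B z)) (stdGaussian (E n)) := by
  have h1 : Integrable (fun z : E n => |f m| + Λ * (‖B‖ * ‖z‖)) (stdGaussian (E n)) :=
    (integrable_const _).add (((integrable_norm_stdGaussian n).const_mul _).const_mul _)
  refine h1.mono' (by have := hf.continuous; fun_prop) (Filter.Eventually.of_forall fun z => ?_)
  have h2 := hf.dist_le_mul (m + B z) m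
  rw [Real.dist_eq, dist_eq_norm, add_sub_cancel_left] at h2
  have h3 : (Λ : ℝ) * ‖B z‖ ≤ Λ * (‖B‖ * ‖z‖) := by gcongr; exact B.le_opNorm z
  rw [Real.norm_eq_abs]
  have h4 := abs_add_le (f (m + B z) - f m) (f m)
  rw [sub_add_cancel] at h4
  linarith

/-! ### The core and the kernel in isotropic coordinates -/

section Kernel

variable {n : ℕ} {P : Params} {p : Measure (E n)} {A : E n ≃L[ℝ] E n}

lemma coreDensity_eq (hA : Whitens A p) (hP : 0 < coreVar P n) (x : E n) :
    coreDensity P p x = |LinearMap.det (A : E n →ₗ[ℝ] E n)| * (Real.sqrt (coreVar P n ^ n))⁻¹ *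
      stdDensity n ((Real.sqrt (coreVar P n))⁻¹ • A (x - mean p)) := by
  set d := LinearMap.det (A : E n →ₗ[ℝ] E n)
  set k := coreVar P n
  have hd : d ≠ 0 := by
    have : IsUnit d := LinearEquiv.isUnit_det' A.toLinearEquiv
    exact this.ne_zero
  have hdet : (covMat p).det = (d ^ 2)⁻¹ := hA.det
  have hdetu : IsUnit (covMat p).det := by
    rw [hdet]; exact isUnit_iff_ne_zero.2 (by positivity)
  have hinv : (k • covMat p)⁻¹ = k⁻¹ • (covMat p)⁻¹ := by
    have := Matrix.inv_smul' (A := covMat p) (Units.mk0 k hP.ne') hdetu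
    exact this
  have hnorm : ∀ v : E n, matNorm (k • covMat p)⁻¹ v = (Real.sqrt k)⁻¹ * ‖A v‖ := by
    intro v
    rw [← hA.norm v]
    unfold matNorm
    rw [hinv, Matrix.smul_mulVec, dotProduct_smul, smul_eq_mul, Real.sqrt_mul (by positivity),
      Real.sqrt_inv]
  change gaussianDensity (mean p) (k • covMat p) x = _
  unfold gaussianDensity stdDensity
  rw [hnorm, norm_smul, Real.norm_of_nonneg (by positivity), Matrix.det_smul, Fintype.card_fin,
    hdet, show (2 * Real.pi) ^ n * (k ^ n * (d ^ 2)⁻¹) = (2 * Real.pi) ^ n * (k ^ n) / d ^ 2 by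
      field_simp, Real.sqrt_div (by positivity), Real.sqrt_sq_eq_abs,
    Real.sqrt_mul (by positivity), inv_div]
  have hd' : |d| ≠ 0 := abs_ne_zero.2 hd
  field_simp

lemma integral_mul_coreDensity (hA : Whitens A p) (hP : 0 < coreVar P n) (g : E n → ℝ) :
    ∫ u, g u * coreDensity P p u =
      ∫ z, g (mean p + Real.sqrt (coreVar P n) • A.symm z) ∂(stdGaussian (E n)) := by
  set k := coreVar P n
  set s := Real.sqrt k
  have hs : 0 < s := Real.sqrt_pos.2 hP
  set d := LinearMap.det (A : E n →ₗ[ℝ] E n)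
  have hd : d ≠ 0 := (LinearEquiv.isUnit_det' A.toLinearEquiv).ne_zero
  rw [integral_stdGaussian]
  have h1 : ∀ u, g u * coreDensity P p u =
      (|d| * (Real.sqrt (k ^ n))⁻¹) * ((fun z => stdDensity n z *
        g (mean p + s • A.symm z)) (s⁻¹ • A (u - mean p))) := by
    intro u
    rw [coreDensity_eq hA hP]
    have : mean p + s • A.symm (s⁻¹ • A (u - mean p)) = u := by
      rw [map_smul, smul_smul, mul_inv_cancel₀ hs.ne', one_smul]; simp
    simp only [this]
    ring
  simp only [h1, smul_eq_mul]
  set F : E n → ℝ := fun z => stdDensity n z * g (mean p + s • A.symm z)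
  rw [integral_const_mul]
  have h2 : ∫ u, F (s⁻¹ • A (u - mean p)) = ∫ u, F (s⁻¹ • A u) :=
    integral_sub_right_eq_self (fun u => F (s⁻¹ • A u)) (mean p)
  have h3 : ∫ u, F (s⁻¹ • A u) = |d⁻¹| * ∫ u, F (s⁻¹ • u) := by
    have hmap := Measure.map_linearMap_addHaar_eq_smul_addHaar (volume : Measure (E n)) hd
    have hme : MeasurableEmbedding (A : E n → E n) := A.toHomeomorph.measurableEmbedding
    have h4 : ∫ u, (fun v => F (s⁻¹ • v)) (A u) =
        ∫ v, F (s⁻¹ • v) ∂(Measure.map A volume) :=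
      (hme.integral_map (fun v => F (s⁻¹ • v))).symm
    rw [h4]
    change ∫ v, F (s⁻¹ • v) ∂(Measure.map (A : E n →ₗ[ℝ] E n) volume) = _
    rw [hmap, integral_smul_measure, ENNReal.toReal_ofReal (abs_nonneg _), smul_eq_mul]
  have h5 : ∫ u, F (s⁻¹ • u) = s ^ n * ∫ u, F u := by
    rw [Measure.integral_comp_inv_smul, finrank_euclideanSpace_fin,
      abs_of_nonneg (by positivity), smul_eq_mul]
  rw [h2, h3, h5]
  have h6 : Real.sqrt (k ^ n) = s ^ n := by
    rw [show k = s ^ 2 from (Real.sq_sqrt hP.le).symm, ← pow_mul, mul_comm, pow_mul,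
      Real.sqrt_sq (by positivity)]
  rw [h6, abs_inv]
  have : |d| ≠ 0 := abs_ne_zero.2 hd
  field_simp

/-- The adjoint kernel as an expectation: `f` is averaged over `(1 - λ) C + λ y` with `C` drawn from
the core. Both sides are the same integral up to an affine change of variables, so nothing is
required of `f`. -/
theorem kernelAdjoint_eq (hA : Whitens A p) (hP : 0 < coreVar P n) (hlam : P.lam < 1)
    (f : E n → ℝ) (y : E n) : kernelAdjoint P p f y =
      ∫ z, f ((1 - P.lam) • (mean p + Real.sqrt (coreVar P n) • A.symm z) + P.lam • y)
        ∂(stdGaussian (E n)) := by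
  have h0 : 0 < 1 - P.lam := by linarith
  rw [← integral_mul_coreDensity hA hP (fun u => f ((1 - P.lam) • u + P.lam • y))]
  unfold kernelAdjoint kernel
  set F : E n → ℝ := fun u => f ((1 - P.lam) • u + P.lam • y) * coreDensity P p u
  have h1 : ∀ x, f x * (coreDensity P p ((1 - P.lam)⁻¹ • (x - P.lam • y)) *
      ((1 - P.lam) ^ n)⁻¹) =
      ((1 - P.lam) ^ n)⁻¹ * F ((1 - P.lam)⁻¹ • (x - P.lam • y)) := by
    intro x
    simp only [F]
    rw [smul_smul, mul_inv_cancel₀ h0.ne', one_smul, sub_add_cancel]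
    ring
  simp only [h1]
  rw [integral_const_mul,
    integral_sub_right_eq_self (fun x => F ((1 - P.lam)⁻¹ • x)) (P.lam • y),
    Measure.integral_comp_inv_smul, finrank_euclideanSpace_fin, abs_of_nonneg (by positivity),
    smul_eq_mul, ← mul_assoc, inv_mul_cancel₀ (by positivity), one_mul]

lemma coreDensity_pos (hA : Whitens A p) (hP : 0 < coreVar P n) (x : E n) :
    0 < coreDensity P p x := by
  rw [coreDensity_eq hA hP]
  have hd : LinearMap.det (A : E n →ₗ[ℝ] E n) ≠ 0 :=
    (LinearEquiv.isUnit_det' A.toLinearEquiv).ne_zero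
  have := stdDensity_pos ((Real.sqrt (coreVar P n))⁻¹ • A (x - mean p))
  positivity

lemma kernel_pos (hA : Whitens A p) (hP : 0 < coreVar P n) (hlam : P.lam < 1) (x y : E n) :
    0 < kernel P p x y := by
  have h0 : 0 < 1 - P.lam := by linarith
  have := coreDensity_pos hA hP ((1 - P.lam)⁻¹ • (x - P.lam • y))
  unfold kernel
  positivity

/-- The kernel varies little on the points `y`, `y'` of an ellipsoid. -/
lemma kernel_le_exp_mul_kernel (hA : Whitens A p) (hP : 0 < coreVar P n) (hlam0 : 0 < P.lam)
    (hlam : P.lam < 1) {x y y' : E n} {r r' : ℝ} (hx : ‖A (x - mean p)‖ ≤ r)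
    (hy : ‖A (y - mean p)‖ ≤ r') (hy' : ‖A (y' - mean p)‖ ≤ r') :
    kernel P p x y ≤ Real.exp (2 * (P.lam * r') * (r + P.lam * r') /
      (coreVar P n * (1 - P.lam) ^ 2)) * kernel P p x y' := by
  have h0 : 0 < 1 - P.lam := by linarith
  set k := coreVar P n
  set a := A (x - mean p)
  have key : ∀ w : E n, (Real.sqrt k)⁻¹ • A ((1 - P.lam)⁻¹ • (x - P.lam • w) - mean p) =
      (Real.sqrt k)⁻¹ • (1 - P.lam)⁻¹ • (a - P.lam • A (w - mean p)) := by
    intro w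
    congr 1
    rw [← map_smul, ← map_sub, ← map_smul]
    congr 1
    rw [smul_sub, smul_sub, smul_sub, smul_sub]
    have : mean p = (1 - P.lam)⁻¹ • ((1 - P.lam) • mean p) := by
      rw [smul_smul, inv_mul_cancel₀ h0.ne', one_smul]
    nth_rewrite 1 [this]
    module
  have hns : ∀ v : E n, ‖(Real.sqrt k)⁻¹ • (1 - P.lam)⁻¹ • v‖ ^ 2 =
      ‖v‖ ^ 2 / (k * (1 - P.lam) ^ 2) := by
    intro v
    rw [norm_smul, norm_smul, norm_inv, norm_inv, Real.norm_of_nonneg (Real.sqrt_nonneg _),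
      Real.norm_of_nonneg h0.le, mul_pow, mul_pow, inv_pow, inv_pow, Real.sq_sqrt hP.le]
    field_simp
  set b := P.lam • A (y - mean p)
  set b' := P.lam • A (y' - mean p)
  have hb : ‖b‖ ≤ P.lam * r' := by
    rw [norm_smul, Real.norm_of_nonneg hlam0.le]; gcongr
  have hb' : ‖b'‖ ≤ P.lam * r' := by
    rw [norm_smul, Real.norm_of_nonneg hlam0.le]; gcongr
  have hdiff : ‖a - b'‖ ^ 2 - ‖a - b‖ ^ 2 ≤ 2 * (2 * (P.lam * r') * (r + P.lam * r')) := by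
    have h1 : ‖a - b'‖ ≤ r + P.lam * r' := (norm_sub_le _ _).trans (by linarith)
    have h2 : ‖a - b‖ ≤ r + P.lam * r' := (norm_sub_le _ _).trans (by linarith)
    have h3 : ‖a - b'‖ - ‖a - b‖ ≤ 2 * (P.lam * r') := by
      have h4 := norm_sub_norm_le (a - b') (a - b)
      have h5 : a - b' - (a - b) = b - b' := by abel
      rw [h5] at h4
      have := norm_sub_le b b'
      linarith
    have h6 : 0 ≤ P.lam * r' := (norm_nonneg b).trans hb
    have h7 : 0 ≤ r := (norm_nonneg a).trans hx
    calc ‖a - b'‖ ^ 2 - ‖a - b‖ ^ 2 = (‖a - b'‖ - ‖a - b‖) * (‖a - b'‖ + ‖a - b‖) := by ring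
      _ ≤ (2 * (P.lam * r')) * (‖a - b'‖ + ‖a - b‖) := by gcongr
      _ ≤ (2 * (P.lam * r')) * (2 * (r + P.lam * r')) := by gcongr; linarith
      _ = _ := by ring
  unfold kernel
  rw [coreDensity_eq hA hP, coreDensity_eq hA hP, key, key]
  unfold stdDensity
  rw [hns, hns]
  have hexp : Real.exp (-(‖a - b‖ ^ 2 / (k * (1 - P.lam) ^ 2)) / 2) ≤
      Real.exp (2 * (P.lam * r') * (r + P.lam * r') / (k * (1 - P.lam) ^ 2)) *
        Real.exp (-(‖a - b'‖ ^ 2 / (k * (1 - P.lam) ^ 2)) / 2) := by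
    rw [← Real.exp_add, Real.exp_le_exp]
    have hk : 0 < k * (1 - P.lam) ^ 2 := by positivity
    have h8 : -(‖a - b‖ ^ 2 / (k * (1 - P.lam) ^ 2)) / 2 =
        (-(‖a - b‖ ^ 2) / 2) / (k * (1 - P.lam) ^ 2) := by ring
    have h9 : -(‖a - b'‖ ^ 2 / (k * (1 - P.lam) ^ 2)) / 2 =
        (-(‖a - b'‖ ^ 2) / 2) / (k * (1 - P.lam) ^ 2) := by ring
    rw [h8, h9, ← add_div]
    gcongr
    linarith
  set C := |LinearMap.det (A : E n →ₗ[ℝ] E n)| * (Real.sqrt (k ^ n))⁻¹ *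
    (Real.sqrt ((2 * Real.pi) ^ n))⁻¹ * ((1 - P.lam) ^ n)⁻¹ with hC
  have hC0 : 0 ≤ C := by positivity
  have := mul_le_mul_of_nonneg_left hexp hC0
  rw [hC] at this
  refine le_trans (le_of_eq ?_) (this.trans (le_of_eq ?_)) <;> ring

end Kernel

/-! ### The estimates are bounded -/

/-- The focus region lies in an ellipsoid of the current weights. -/
def State.Near {n : ℕ} (S : State n) (P : Params) : Prop :=
  S.focus ⊆ ellipsoid S.weights (10 * n * P.alpha)

section Near

variable {n T : ℕ} {S : State n}

lemma weights_step (P : Params) (K : Set (E n)) (x : E n) (l : E n → ℝ) :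
    (S.step P K x l).weights = (S.update P K x l).weights := by
  simp only [State.step]
  split_ifs <;> rfl

lemma support_step (P : Params) (K : Set (E n)) (x : E n) (l : E n → ℝ) :
    (S.step P K x l).support = S.focus := by
  simp only [State.step]
  split_ifs <;> rfl

lemma score_step (P : Params) (K : Set (E n)) (x : E n) (l : E n → ℝ) (y : E n) :
    (S.step P K x l).score y = S.score y + S.rate * S.lossEst P K x l y := by
  simp only [State.step]
  split_ifs <;> rfl

/-- Either the focus region and the rate are kept, or the focus region is cut, its volume is
halved, and the rate increases. -/
lemma step_cases (P : Params) (K : Set (E n)) (x : E n) (l : E n → ℝ) :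
    ((S.step P K x l).focus = S.focus ∧ (S.step P K x l).rate = S.rate ∧
      volume S.focus / 2 < volume (S.focus ∩ ellipsoid (S.step P K x l).weights P.alpha)) ∨
    ((S.step P K x l).focus = S.focus ∩ ellipsoid (S.step P K x l).weights P.alpha ∧
      (S.step P K x l).rate = (1 + P.gamma) * S.rate ∧
      volume (S.step P K x l).focus ≤ volume S.focus / 2) := by
  rw [weights_step]
  simp only [State.step]
  split_ifs with h
  · right; exact ⟨rfl, rfl, h⟩
  · left; exact ⟨rfl, rfl, not_le.1 h⟩

/-- If no cut is made, the ellipsoid of radius `α` holds more than half of the focus region and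
`subset_ellipsoid_of_volume_lt` applies; after a cut the region lies in that ellipsoid. -/
lemma State.Regular.near_step (hn : 1 ≤ n) (hT : n < T) (hS : S.Regular) (K : Set (E n))
    (x : E n) (l : E n → ℝ) : (S.step (params n T) K x l).Near (params n T) := by
  obtain ⟨A, hA⟩ := (hS.step hn hT K x l).isLawOn.exists_whitens
  have hn' : (1 : ℝ) ≤ n := by exact_mod_cast hn
  have hα := alpha_pos hn hT
  unfold State.Near
  rcases step_cases (S := S) (params n T) K x l with ⟨h1, -, h2⟩ | ⟨h1, -, -⟩
  · rw [h1]
    exact subset_ellipsoid_of_volume_lt hn hA hS.focus_compact hS.focus_convex hα h2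
  · rw [h1, hA.ellipsoid_eq, hA.ellipsoid_eq]
    rintro y ⟨-, hy⟩
    have hy' : ‖A (y - mean (S.step (params n T) K x l).weights)‖ ≤ (params n T).alpha := hy
    exact hy'.trans (by nlinarith)

/-- The first weights are uniform, so the Chebyshev bound on mass is a bound on volume. -/
lemma State.near_init (hn : 1 ≤ n) (hT : n < T) {K : Set (E n)} (hK : IsBody K) :
    (State.init (params n T) K).Near (params n T) := by
  set S := State.init (params n T) K
  have hS : S.Regular := State.Regular.init hn hT hK
  obtain ⟨A, hA⟩ := hS.isLawOn.exists_whitens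
  have hα := alpha_pos hn hT
  refine subset_ellipsoid_of_volume_lt hn hA hS.focus_compact hS.focus_convex hα ?_
  have h1 := hS.one_half_lt_weights_ellipsoid (div_sq_alpha_lt hn hT le_rfl) hα
  have hpot : ∀ x, S.potential x = 0 := by
    intro x
    have : S.score '' S.support = {0} := by
      have : S.score = fun _ => 0 := rfl
      rw [this, hS.support_nonempty.image_const]
    simp only [State.potential, this, csInf_singleton]
    simp [S, State.init]
  have hmeas : MeasurableSet (S.support ∩ ellipsoid S.weights (params n T).alpha) :=
    hS.support_compact.measurableSet.inter (hA.isClosed_ellipsoid _).measurableSet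
  rw [hS.weights_real hmeas inter_subset_left] at h1
  have hpart : S.partition = volume.real S.support := by
    simp [State.partition, hpot]
  rw [hpart] at h1
  simp only [hpot, neg_zero, Real.exp_zero] at h1
  rw [setIntegral_const, smul_eq_mul, mul_one, lt_div_iff₀ (hpart ▸ hS.partition_pos)] at h1
  have hfin : volume S.support ≠ ∞ := hS.support_compact.measure_lt_top.ne
  change volume S.support / 2 < volume (S.support ∩ _)
  rw [← ENNReal.toReal_lt_toReal (ENNReal.div_ne_top hfin (by norm_num))
    (ne_top_of_le_ne_top hfin (measure_mono inter_subset_left)), ENNReal.toReal_div]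
  change volume.real S.support / (2 : ℝ) < volume.real _
  have : 0 < volume.real S.support := hpart ▸ hS.partition_pos
  linarith

/-- The exponent of `kernel_le_exp_mul_kernel` for a typical action and two points in the ellipsoid
of radius `10 n α`. -/
lemma kernel_exponent_le (hn : 1 ≤ n) (hT : n < T) :
    2 * ((params n T).lam * (10 * n * (params n T).alpha)) *
      ((10 * n * (params n T).alpha * (params n T).lam +
        20 * Real.sqrt (params n T).lam * (params n T).eps) +
          (params n T).lam * (10 * n * (params n T).alpha)) /
      (coreVar (params n T) n * (1 - (params n T).lam) ^ 2) ≤ 1 / 10 := by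
  have hL := log_two_le_log hn hT
  have hn' : (1 : ℝ) ≤ n := by exact_mod_cast hn
  have he := eps_pos (n := n) (T := T)
  have he' := eps_le (n := n) (T := T)
  have hα := alpha_pos hn hT
  have hl := lam_pos hn hT
  have hl' := lam_le hn hT
  have hk := coreVar_pos hn hT
  have hs := sqrt_lam hn hT
  set e := (params n T).eps
  set α := (params n T).alpha
  set lam := (params n T).lam
  set s := Real.sqrt lam
  have hs2 : lam = s ^ 2 := (Real.sq_sqrt hl.le).symm
  have hs0 : 0 < s := Real.sqrt_pos.2 hl
  set X := (n : ℝ) * Real.log T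
  have hX : 0.69 ≤ X := by simp only [X]; nlinarith
  have hX0 : 0 < X := by linarith
  -- One factor `√λ` cancels `α`: this is what the choice of `λ` is for. The other is matched by the
  -- `√λ` in the radius of the typical set, and together they cancel against the core variance.
  have hD : lam * (10 * n * α) = s * (e ^ 2 / (100 * X)) := by
    rw [hs2, sq]
    nth_rewrite 2 [hs]
    simp only [X]
    have hL0 : Real.log T ≠ 0 := by intro h; rw [h] at hL; norm_num at hL
    have hn0 : (n : ℝ) ≠ 0 := by positivity
    field_simp
    norm_num
  have hk2 : e ^ 2 * lam / (2 * X) ≤ coreVar (params n T) n := by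
    have h1 : coreVar (params n T) n = e ^ 2 * lam / ((2 - lam) * X) := by
      change e ^ 2 / ((n : ℝ) * Real.log T) * (lam / (2 - lam)) = _
      simp only [X]
      rw [div_mul_div_comm]
      congr 1
      ring
    rw [h1]
    apply div_le_div_of_nonneg_left (by positivity)
    · apply mul_pos _ hX0
      norm_num at hl'; linarith
    · gcongr; linarith
  have h1l : (1 / 2 : ℝ) ≤ (1 - lam) ^ 2 := by
    norm_num at hl'; nlinarith
  have h1l' : 0 < (1 - lam) ^ 2 := by linarith
  rw [show 10 * n * α * lam = lam * (10 * n * α) by ring, hD, div_le_iff₀ (by positivity)]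
  have hrhs : 1 / 10 * (e ^ 2 * lam / (2 * X) * (1 / 2)) ≤
      1 / 10 * (coreVar (params n T) n * (1 - lam) ^ 2) := by
    gcongr
  refine le_trans ?_ hrhs
  rw [hs2]
  have hq : e ^ 2 / (100 * X) ≤ 1 / 1000 := by
    rw [div_le_div_iff₀ (by positivity) (by norm_num)]
    nlinarith
  have hq0 : 0 < e ^ 2 / (100 * X) := by positivity
  have h2 : e ^ 2 / (100 * X) + 20 * e + e ^ 2 / (100 * X) ≤ 1 := by linarith
  calc 2 * (s * (e ^ 2 / (100 * X))) *
        (s * (e ^ 2 / (100 * X)) + 20 * s * e + s * (e ^ 2 / (100 * X)))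
      = 2 * s ^ 2 * (e ^ 2 / (100 * X)) *
        (e ^ 2 / (100 * X) + 20 * e + e ^ 2 / (100 * X)) := by ring
    _ ≤ 2 * s ^ 2 * (e ^ 2 / (100 * X)) * 1 := by gcongr
    _ = 8 / 10 * (1 / 10 * (e ^ 2 * s ^ 2 / (2 * X) * (1 / 2))) := by field_simp; norm_num
    _ ≤ 1 * (1 / 10 * (e ^ 2 * s ^ 2 / (2 * X) * (1 / 2))) := by gcongr; norm_num
    _ = _ := one_mul _

lemma lam_lt_one (hn : 1 ≤ n) (hT : n < T) : (params n T).lam < 1 := by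
  have := lam_le hn hT
  norm_num at this
  linarith

lemma exp_one_tenth_le : Real.exp (1 / 10) ≤ 12 / 10 := by
  have h := Real.exp_bound_div_one_sub_of_interval (x := 1 / 10) (by norm_num) (by norm_num)
  exact h.trans (by norm_num)

lemma IsLawOn.mul_measureReal_le_integral {p : Measure (E n)} {D : Set (E n)} (hp : IsLawOn p D)
    {f : E n → ℝ} (hf : Continuous f) (hf0 : ∀ y, 0 ≤ f y) {G : Set (E n)} (hG : MeasurableSet G)
    {c : ℝ} (hc : ∀ y ∈ G, c ≤ f y) : p.real G * c ≤ ∫ y, f y ∂p := by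
  have := hp.prob
  have h : ∫ y, G.indicator (fun _ => c) y ∂p = p.real G * c := by
    rw [integral_indicator hG, setIntegral_const, smul_eq_mul]
  rw [← h]
  refine MeasureTheory.integral_mono ((integrable_const _).indicator hG) (hp.integrable hf)
    fun y => ?_
  by_cases hy : y ∈ G
  · simp only [indicator_of_mem hy]; exact hc y hy
  · simp only [indicator_of_notMem hy]; exact hf0 y

lemma continuous_kernel_right (P : Params) (p : Measure (E n)) (x : E n) :
    Continuous (kernel P p x) := by
  unfold kernel coreDensity
  have := continuous_gaussianDensity (mean p)
    ((P.eps ^ 2 / (n * Real.log P.T) * (P.lam / (2 - P.lam))) • covMat p)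
  fun_prop

/-- On an ellipsoid carrying `99/100` of `p` the kernel varies by a factor of at most `12/10`, so
its average is at least `(99/100) / (12/10)` times any of its values there. -/
lemma kernel_le_two_mul_kernelApply {P : Params} {p : Measure (E n)} {D : Set (E n)}
    (hp : IsLawOn p D) (hD : IsCompact D)
    {A : E n ≃L[ℝ] E n} (hA : Whitens A p) (hk : 0 < coreVar P n) (hl0 : 0 < P.lam)
    (hl1 : P.lam < 1) {r r' : ℝ}
    (hτ : 2 * (P.lam * r') * (r + P.lam * r') / (coreVar P n * (1 - P.lam) ^ 2) ≤ 1 / 10)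
    (hG : 99 / 100 < p.real (D ∩ ellipsoid p r')) {x y : E n}
    (hx : ‖A (x - mean p)‖ ≤ r) (hy : ‖A (y - mean p)‖ ≤ r') :
    kernel P p x y ≤ 2 * kernelApply P p p x := by
  have hky : 0 < kernel P p x y := kernel_pos hA hk hl1 x y
  have hcmp : ∀ y' ∈ D ∩ ellipsoid p r', kernel P p x y / (12 / 10) ≤ kernel P p x y' := by
    intro y' hy'
    have hy'e : ‖A (y' - mean p)‖ ≤ r' := by
      have := hy'.2
      rwa [hA.ellipsoid_eq] at this
    have h1 := kernel_le_exp_mul_kernel hA hk hl0 hl1 hx hy hy'e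
    have h2 := kernel_pos hA hk hl1 x y'
    have h4 := (Real.exp_le_exp.2 hτ).trans exp_one_tenth_le
    rw [div_le_iff₀' (by norm_num)]
    exact h1.trans (mul_le_mul_of_nonneg_right h4 h2.le)
  have h5 : p.real (D ∩ ellipsoid p r') * (kernel P p x y / (12 / 10)) ≤ kernelApply P p p x :=
    hp.mul_measureReal_le_integral (continuous_kernel_right P p x) (fun y' => (kernel_pos hA hk hl1 x y').le)
      (hD.measurableSet.inter (hA.isClosed_ellipsoid _).measurableSet) hcmp
  have h6 : 99 / 100 * (kernel P p x y / (12 / 10)) ≤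
      p.real (D ∩ ellipsoid p r') * (kernel P p x y / (12 / 10)) :=
    mul_le_mul_of_nonneg_right hG.le (by positivity)
  linarith

/-- Atypical actions contribute 0. For typical ones the importance ratio is at most 2, because
`Near` places the focus region where the kernel is nearly constant. -/
theorem State.Regular.lossEst_mem (hn : 1 ≤ n) (hT : n < T) (hS : S.Regular)
    (hnear : S.Near (params n T)) {K : Set (E n)} {Λ : ℝ≥0} {l : E n → ℝ} (hl : IsLoss K Λ l)
    (x : E n) {y : E n} (hy : y ∈ S.focus) :
    S.lossEst (params n T) K x l y ∈ Icc (0 : ℝ) 2 := by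
  classical
  unfold State.lossEst
  by_cases hx : x ∈ typical (params n T) K S.weights
  swap
  · rw [if_neg hx, zero_div, zero_mul]; simp
  rw [if_pos hx]
  obtain ⟨A, hA⟩ := hS.isLawOn.exists_whitens
  have hlx := hl.mem x hx.1
  have hxe := hx.2
  have hye := hnear hy
  rw [hA.ellipsoid_eq] at hxe hye
  have hα := alpha_pos hn hT
  have hn' : (1 : ℝ) ≤ n := by exact_mod_cast hn
  have hr : (params n T).alpha ≤ 10 * n * (params n T).alpha := by nlinarith
  have h1 := kernel_le_two_mul_kernelApply hS.isLawOn hS.support_compact hA (coreVar_pos hn hT) (lam_pos hn hT)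
    (lam_lt_one hn hT) (kernel_exponent_le hn hT)
    (hS.one_half_lt_weights_ellipsoid (div_sq_alpha_lt hn hT hr) (hα.trans_le hr)) hxe hye
  have hky := kernel_pos hA (coreVar_pos hn hT) (lam_lt_one hn hT) x y
  have hKA0 : 0 < kernelApply (params n T) S.weights S.weights x := by linarith
  constructor
  · exact mul_nonneg (div_nonneg hlx.1 hKA0.le) hky.le
  · rw [div_mul_eq_mul_div, div_le_iff₀ hKA0]
    have := mul_le_mul_of_nonneg_right hlx.2 hky.le
    linarith

end Near

/-! ### A reverse Hölder inequality for log-concave laws -/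

/-- A layer-cake bound with geometric levels: from `3^j b` to `3^(j+1) b` the square grows by `8 ·
9^j b²`. -/
lemma sq_le_layer_sum {b y : ℝ} (hb : 0 ≤ b) (J : ℕ) :
    min (y ^ 2) (9 ^ J * b ^ 2) ≤ b ^ 2 +
      ∑ j ∈ Finset.range J, 8 * 9 ^ j * b ^ 2 * {u : ℝ | 3 ^ j * b < |u|}.indicator (fun _ => 1) y := by
  induction J with
  | zero => simp
  | succ J ih =>
    rw [Finset.sum_range_succ]
    by_cases h : 3 ^ J * b < |y|
    · rw [indicator_of_mem (show y ∈ {u : ℝ | 3 ^ J * b < |u|} from h)]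
      have h1 : 9 ^ J * b ^ 2 ≤ y ^ 2 := by
        have h2 : (3 ^ J * b) ^ 2 ≤ |y| ^ 2 := by gcongr
        rw [sq_abs, mul_pow, ← pow_mul, mul_comm J 2, pow_mul] at h2
        norm_num at h2
        exact h2
      rw [min_eq_right h1] at ih
      refine (min_le_right _ _).trans ?_
      rw [pow_succ]
      linarith
    · rw [indicator_of_notMem (show y ∉ {u : ℝ | 3 ^ J * b < |u|} from h)]
      have h1 : y ^ 2 ≤ 9 ^ J * b ^ 2 := by
        have h2 : |y| ^ 2 ≤ (3 ^ J * b) ^ 2 := by gcongr; exact not_lt.1 h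
        rw [sq_abs, mul_pow, ← pow_mul, mul_comm J 2, pow_mul] at h2
        norm_num at h2
        exact h2
      rw [min_eq_left h1] at ih
      refine (min_le_left _ _).trans ?_
      linarith

/-- Tails `τ` with `τ(3b) (1 - τ(b)) ≤ τ(b)²` decay fast once they are at most `1/8`. -/
lemma tail_le {τ : ℝ → ℝ} {b : ℝ} (hb : 0 < b) (h0 : ∀ u, 0 ≤ τ u)
    (h : ∀ u, 0 < u → τ (3 * u) * (1 - τ u) ≤ τ u ^ 2) (h1 : τ b ≤ 1 / 8) (j : ℕ) :
    τ (3 ^ (j + 1) * b) ≤ 1 / 56 * (1 / 27) ^ j := by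
  have step : ∀ u, 0 < u → τ u ≤ 1 / 8 → τ (3 * u) ≤ 8 / 7 * τ u ^ 2 := by
    intro u hu hu1
    have := h u hu
    nlinarith [h0 (3 * u)]
  induction j with
  | zero =>
    have := step b hb h1
    simp only [zero_add, pow_one, pow_zero, mul_one]
    nlinarith [h0 b]
  | succ j ih =>
    have hp : ((1 : ℝ) / 27) ^ j ≤ 1 := pow_le_one₀ (by norm_num) (by norm_num)
    have h2 := step (3 ^ (j + 1) * b) (by positivity) (ih.trans (by linarith))
    rw [pow_succ 3 (j + 1), mul_comm _ 3, mul_assoc]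
    refine h2.trans ?_
    have h3 := h0 (3 ^ (j + 1) * b)
    have h4 : τ (3 ^ (j + 1) * b) ≤ 1 / 56 := ih.trans (by linarith)
    have h5 := mul_le_mul h4 ih h3 (by norm_num)
    rw [pow_succ (1 / 27 : ℝ) j]
    nlinarith [pow_pos (show (0 : ℝ) < 1 / 27 by norm_num) j]

/-- Markov's inequality at `b = 8 c ∫ |Y|` makes the `ν`-tail at `b` at most `1/8`. From there
`tail_le` gives decay like `27^(-j)` at `3^(j+1) b`, which beats the weights `9^j` of the layers.
The constant `c` transfers tails between `p` and `ν`. -/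
theorem integral_sq_le_of_tail {α : Type*} [MeasurableSpace α] {p ν : Measure α}
    [IsProbabilityMeasure p] [IsProbabilityMeasure ν] {Y : α → ℝ} (hY : Measurable Y) {c B : ℝ}
    (hB : ∀ᵐ x ∂p, |Y x| ≤ B) (hc : 0 < c)
    (hpν : ∀ A, MeasurableSet A → p.real A ≤ c * ν.real A)
    (hνp : ∀ A, MeasurableSet A → ν.real A ≤ c * p.real A)
    (htail : ∀ u, 0 < u → ν.real {x | 3 * u < |Y x|} * (1 - ν.real {x | u < |Y x|}) ≤
      ν.real {x | u < |Y x|} ^ 2) :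
    ∫ x, Y x ^ 2 ∂p ≤ (1 + 3 * c) * (8 * c * ∫ x, |Y x| ∂p) ^ 2 := by
  have hint : Integrable (fun x => |Y x|) p := by
    refine Integrable.of_bound hY.abs.aestronglyMeasurable B ?_
    filter_upwards [hB] with x hx
    simpa using hx
  have hint2 : Integrable (fun x => Y x ^ 2) p := by
    refine Integrable.of_bound (hY.pow_const 2).aestronglyMeasurable (B ^ 2) ?_
    filter_upwards [hB] with x hx
    rw [Real.norm_eq_abs, abs_pow]
    gcongr
  have hθ0 : 0 ≤ ∫ x, |Y x| ∂p := integral_nonneg fun _ => abs_nonneg _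
  rcases hθ0.eq_or_lt with hθ | hθ
  · have h1 := (integral_eq_zero_iff_of_nonneg (fun x => abs_nonneg (Y x)) hint).1 hθ.symm
    have h2 : ∫ x, Y x ^ 2 ∂p = 0 := by
      rw [integral_eq_zero_iff_of_nonneg (fun x => sq_nonneg (Y x)) hint2]
      filter_upwards [h1] with x hx
      simpa using hx
    rw [h2, ← hθ]
    simp
  set b := 8 * c * ∫ x, |Y x| ∂p
  have hb : 0 < b := by positivity
  have hm : ∀ u, MeasurableSet {x | u < |Y x|} := fun u => measurableSet_lt measurable_const hY.abs
  have h18 : ν.real {x | b < |Y x|} ≤ 1 / 8 := by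
    have h1 : b * p.real {x | b < |Y x|} ≤ ∫ x, |Y x| ∂p := by
      refine le_trans ?_ (mul_meas_ge_le_integral_of_nonneg
        (Filter.Eventually.of_forall fun x => abs_nonneg (Y x)) hint b)
      refine mul_le_mul_of_nonneg_left ?_ hb.le
      exact measureReal_mono fun x hx => (mem_ofPred_eq.mp hx : b < |Y x|).le
    have h2 := hνp _ (hm b)
    have h3 : b * ν.real {x | b < |Y x|} ≤ c * ∫ x, |Y x| ∂p := by nlinarith
    have h4 : c * ∫ x, |Y x| ∂p = b * (1 / 8) := by simp only [b]; ring
    rw [h4] at h3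
    exact le_of_mul_le_mul_left h3 hb
  obtain ⟨J, hJ⟩ := pow_unbounded_of_one_lt (B / b) (by norm_num : (1 : ℝ) < 3)
  have hJ' : B ≤ 3 ^ J * b := by
    rw [div_lt_iff₀ hb] at hJ; exact hJ.le
  have hind : ∀ u, Integrable (fun x => {v : ℝ | u < |v|}.indicator (fun _ => (1 : ℝ)) (Y x)) p := by
    intro u
    have : (fun x => {v : ℝ | u < |v|}.indicator (fun _ => (1 : ℝ)) (Y x)) =
        {x | u < |Y x|}.indicator (fun _ => (1 : ℝ)) := by
      ext x; simp [indicator]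
    rw [this]
    exact (integrable_const _).indicator (hm u)
  have hval : ∀ u, ∫ x, {v : ℝ | u < |v|}.indicator (fun _ => (1 : ℝ)) (Y x) ∂p =
      p.real {x | u < |Y x|} := by
    intro u
    have : (fun x => {v : ℝ | u < |v|}.indicator (fun _ => (1 : ℝ)) (Y x)) =
        {x | u < |Y x|}.indicator (fun _ => (1 : ℝ)) := by
      ext x; simp [indicator]
    rw [this, integral_indicator (hm u), setIntegral_const, smul_eq_mul, mul_one]
  have hsum : ∫ x, Y x ^ 2 ∂p ≤ b ^ 2 +
      ∑ j ∈ Finset.range (J + 1), 8 * 9 ^ j * b ^ 2 * p.real {x | 3 ^ j * b < |Y x|} := by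
    calc ∫ x, Y x ^ 2 ∂p ≤ ∫ x, (b ^ 2 + ∑ j ∈ Finset.range (J + 1), 8 * 9 ^ j * b ^ 2 *
          {u : ℝ | 3 ^ j * b < |u|}.indicator (fun _ => 1) (Y x)) ∂p := by
          refine integral_mono_ae hint2 ?_ ?_
          · exact (integrable_const _).add
              (integrable_finsetSum _ fun j _ => (hind _).const_mul _)
          · filter_upwards [hB] with x hx
            refine le_trans ?_ (sq_le_layer_sum hb.le (J + 1))
            refine le_min le_rfl ?_
            have h1 : |Y x| ≤ 3 ^ (J + 1) * b := by
              refine hx.trans (hJ'.trans ?_)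
              gcongr <;> norm_num
            calc Y x ^ 2 = |Y x| ^ 2 := (sq_abs _).symm
              _ ≤ (3 ^ (J + 1) * b) ^ 2 := by gcongr
              _ = 9 ^ (J + 1) * b ^ 2 := by
                rw [mul_pow, ← pow_mul, mul_comm (J + 1) 2, pow_mul]; norm_num
      _ = _ := by
          rw [integral_add (integrable_const _)
            (integrable_finsetSum _ fun j _ => (hind _).const_mul _), integral_finsetSum _
            fun j _ => (hind _).const_mul _]
          simp only [integral_const_mul, hval]
          simp
  have htl := tail_le hb (fun u => measureReal_nonneg (μ := ν) (s := {x | u < |Y x|})) htail h18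
  refine hsum.trans ?_
  rw [Finset.sum_range_succ']
  have h0 : p.real {x | b < |Y x|} ≤ c * (1 / 8) :=
    (hpν _ (hm _)).trans (by gcongr)
  have hj : ∀ j ∈ Finset.range J,
      8 * 9 ^ (j + 1) * b ^ 2 * p.real {x | 3 ^ (j + 1) * b < |Y x|} ≤
        9 / 7 * c * b ^ 2 * (1 / 3) ^ j := by
    intro j _
    have h1 : p.real {x | 3 ^ (j + 1) * b < |Y x|} ≤ c * (1 / 56 * (1 / 27) ^ j) :=
      (hpν _ (hm _)).trans (by gcongr; exact htl j)
    calc 8 * 9 ^ (j + 1) * b ^ 2 * p.real {x | 3 ^ (j + 1) * b < |Y x|}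
        ≤ 8 * 9 ^ (j + 1) * b ^ 2 * (c * (1 / 56 * (1 / 27) ^ j)) := by gcongr
      _ = 9 / 7 * c * b ^ 2 * (9 ^ j * (1 / 27) ^ j) := by rw [pow_succ]; ring
      _ = _ := by rw [← mul_pow]; norm_num
  have hS := Finset.sum_le_sum hj
  rw [← Finset.mul_sum] at hS
  have hg : ∑ j ∈ Finset.range J, ((1 : ℝ) / 3) ^ j ≤ 3 / 2 := by
    rw [geom_sum_eq (by norm_num)]
    have : (0 : ℝ) ≤ (1 / 3) ^ J := by positivity
    rw [div_le_iff_of_neg (by norm_num)]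
    linarith
  have h5 : 9 / 7 * c * b ^ 2 * ∑ j ∈ Finset.range J, ((1 : ℝ) / 3) ^ j ≤
      9 / 7 * c * b ^ 2 * (3 / 2) := by gcongr
  have h6 : 8 * 9 ^ 0 * b ^ 2 * p.real {x | 3 ^ 0 * b < |Y x|} ≤ b ^ 2 * c := by
    simp only [pow_zero, mul_one, one_mul]
    nlinarith [sq_nonneg b]
  have h7 : 0 < c * b ^ 2 := by positivity
  nlinarith

/-- The midpoint Prékopa–Leindler inequality, for sets and the measure with density `exp(-V)` on a
convex set, `V` convex. -/
lemma withDensity_mul_le {n : ℕ} {D : Set (E n)} (hD : Convex ℝ D) (hDm : MeasurableSet D)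
    {V : E n → ℝ} (hV : ConvexOn ℝ univ V) (hVc : Continuous V) {A B C : Set (E n)}
    (hA : MeasurableSet A) (hB : MeasurableSet B) (hC : MeasurableSet C)
    (h : ∀ x ∈ A, ∀ y ∈ B, (1 / 2 : ℝ) • (x + y) ∈ C) :
    (∫⁻ x in D ∩ A, ENNReal.ofReal (Real.exp (-V x))) *
      (∫⁻ x in D ∩ B, ENNReal.ofReal (Real.exp (-V x))) ≤
    (∫⁻ x in D ∩ C, ENNReal.ofReal (Real.exp (-V x))) ^ 2 := by
  have hm : Measurable fun x => ENNReal.ofReal (Real.exp (-V x)) := by fun_prop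
  rw [← lintegral_indicator (hDm.inter hA), ← lintegral_indicator (hDm.inter hB),
    ← lintegral_indicator (hDm.inter hC)]
  refine midpointPL_euclidean n _ _ _ (hm.indicator (hDm.inter hA)) (hm.indicator (hDm.inter hB))
    (hm.indicator (hDm.inter hC)) fun x y => ?_
  by_cases hx : x ∈ D ∩ A
  swap
  · simp [indicator_of_notMem hx]
  by_cases hy : y ∈ D ∩ B
  swap
  · simp [indicator_of_notMem hy]
  have hmid : (1 / 2 : ℝ) • (x + y) ∈ D ∩ C := by
    refine ⟨?_, h x hx.2 y hy.2⟩
    rw [smul_add]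
    exact hD hx.1 hy.1 (by norm_num) (by norm_num) (by norm_num)
  rw [indicator_of_mem hx, indicator_of_mem hy, indicator_of_mem hmid,
    ← ENNReal.ofReal_mul (Real.exp_pos _).le, ← ENNReal.ofReal_pow (Real.exp_pos _).le]
  apply ENNReal.ofReal_le_ofReal
  rw [← Real.exp_add, ← Real.exp_nat_mul]
  apply Real.exp_le_exp.2
  have := hV.2 (mem_univ x) (mem_univ y) (by norm_num : (0 : ℝ) ≤ 1 / 2)
    (by norm_num : (0 : ℝ) ≤ 1 / 2) (by norm_num)
  rw [← smul_add] at this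
  simp only [smul_eq_mul] at this
  push_cast
  linarith

/-- The cumulative score is within `a` of `V` on the support. -/
def State.Close {n : ℕ} (S : State n) (V : E n → ℝ) (a : ℝ) : Prop :=
  ∀ x ∈ S.support, |S.score x - V x| ≤ a

/-- The log-concave probability measure with density proportional to `exp(-V)` on `D`. -/
def gibbs {n : ℕ} (D : Set (E n)) (V : E n → ℝ) : Measure (E n) :=
  (∫⁻ x in D, ENNReal.ofReal (Real.exp (-V x)))⁻¹ •
    (volume.restrict D).withDensity fun x => ENNReal.ofReal (Real.exp (-V x))

/-! ### Gibbs measures: comparison with the weights, tails and first moments of linear functionals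
-/

section Gibbs

variable {n : ℕ} {S : State n} {V : E n → ℝ}

lemma lintegral_exp_ne_top {D A : Set (E n)} (hD : IsCompact D) (hV : Continuous V) :
    ∫⁻ x in D ∩ A, ENNReal.ofReal (Real.exp (-V x)) ≠ ∞ := by
  have h1 : IntegrableOn (fun x => Real.exp (-V x)) D :=
    (by fun_prop : Continuous fun x => Real.exp (-V x)).continuousOn.integrableOn_compact hD
  exact ((h1.mono_set inter_subset_left).lintegral_lt_top).ne

lemma lintegral_exp_ne_zero {D : Set (E n)} (hD : volume D ≠ 0) (hV : Continuous V) :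
    ∫⁻ x in D, ENNReal.ofReal (Real.exp (-V x)) ≠ 0 := by
  have hm : Measurable fun x => ENNReal.ofReal (Real.exp (-V x)) := by fun_prop
  intro h
  rw [lintegral_eq_zero_iff hm] at h
  have : volume.restrict D = 0 := by
    rw [← ae_eq_bot, ← Filter.empty_mem_iff_bot]
    filter_upwards [h] with x hx
    simp only [Pi.zero_apply, ENNReal.ofReal_eq_zero] at hx
    exact absurd (Real.exp_pos (-V x)) (not_lt.2 hx)
  exact hD (by simpa using this)

lemma gibbs_apply {D A : Set (E n)} (hA : MeasurableSet A) :
    gibbs D V A = (∫⁻ x in D, ENNReal.ofReal (Real.exp (-V x)))⁻¹ *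
      ∫⁻ x in D ∩ A, ENNReal.ofReal (Real.exp (-V x)) := by
  rw [gibbs, Measure.smul_apply, smul_eq_mul, withDensity_apply _ hA,
    Measure.restrict_restrict hA, inter_comm]

lemma isProbabilityMeasure_gibbs {D : Set (E n)} (hD : IsCompact D) (hD0 : volume D ≠ 0)
    (hV : Continuous V) : IsProbabilityMeasure (gibbs D V) := by
  constructor
  have h := lintegral_exp_ne_top (A := univ) hD hV
  rw [gibbs_apply MeasurableSet.univ, inter_univ]
  rw [inter_univ] at h
  exact ENNReal.inv_mul_cancel (lintegral_exp_ne_zero hD0 hV) h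

lemma gibbs_real (hV : Continuous V) {D A : Set (E n)} (hA : MeasurableSet A) :
    (gibbs D V).real A = (∫ x in D ∩ A, Real.exp (-V x)) / ∫ x in D, Real.exp (-V x) := by
  rw [measureReal_def, gibbs_apply hA, ENNReal.toReal_mul, ENNReal.toReal_inv]
  have hm : Measurable fun x => Real.exp (-V x) := by fun_prop
  have h : ∀ B : Set (E n), (∫⁻ x in B, ENNReal.ofReal (Real.exp (-V x))).toReal =
      ∫ x in B, Real.exp (-V x) := fun B =>
    (integral_eq_lintegral_of_nonneg_ae (Filter.Eventually.of_forall fun x => (Real.exp_pos _).le)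
      hm.aestronglyMeasurable).symm
  rw [h, h, div_eq_inv_mul]

lemma State.Regular.weights_real_inter (hS : S.Regular) {A : Set (E n)} (hA : MeasurableSet A) :
    S.weights.real A = (∫ x in S.support ∩ A, Real.exp (-S.potential x)) / S.partition := by
  rw [← hS.weights_real (hS.support_compact.measurableSet.inter hA) inter_subset_left, inter_comm]
  exact (measureReal_congr (inter_ae_eq_left_of_ae_eq_univ
    (ae_eq_univ.2 hS.isLawOn.null))).symm

lemma State.Close.exp_bounds {a : ℝ} (hS : S.Regular) (h : S.Close V a) (hV : Continuous V)
    {A : Set (E n)} (hA : MeasurableSet A) :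
    Real.exp (sInf (S.score '' S.support) - a) * ∫ x in S.support ∩ A, Real.exp (-V x) ≤
      ∫ x in S.support ∩ A, Real.exp (-S.potential x) ∧
    ∫ x in S.support ∩ A, Real.exp (-S.potential x) ≤
      Real.exp (sInf (S.score '' S.support) + a) * ∫ x in S.support ∩ A, Real.exp (-V x) := by
  have hm := hS.support_compact.measurableSet.inter hA
  have h1 : IntegrableOn (fun x => Real.exp (-V x)) (S.support ∩ A) :=
    ((by fun_prop : Continuous fun x => Real.exp (-V x)).continuousOn.integrableOn_compact
      hS.support_compact).mono_set inter_subset_left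
  have h2 := hS.integrableOn_exp.mono_set (inter_subset_left (t := A))
  rw [← integral_const_mul, ← integral_const_mul]
  constructor
  · refine setIntegral_mono_on (h1.const_mul _) h2 hm fun x hx => ?_
    rw [← Real.exp_add]
    have := abs_le.1 (h x hx.1)
    apply Real.exp_le_exp.2
    simp only [State.potential]
    linarith
  · refine setIntegral_mono_on h2 (h1.const_mul _) hm fun x hx => ?_
    rw [← Real.exp_add]
    have := abs_le.1 (h x hx.1)
    apply Real.exp_le_exp.2
    simp only [State.potential]
    linarith

/-- Up to a common shift by the minimum of the score, the unnormalized densities agree within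
`e^{±a}`. The shift cancels in the ratio; numerator and denominator each cost `e^a`. -/
lemma State.Close.weights_real_le {a : ℝ} (hS : S.Regular) (h : S.Close V a) (hV : Continuous V)
    {A : Set (E n)} (hA : MeasurableSet A) :
    S.weights.real A ≤ Real.exp (2 * a) * (gibbs S.support V).real A ∧
      (gibbs S.support V).real A ≤ Real.exp (2 * a) * S.weights.real A := by
  have h1 := h.exp_bounds hS hV hA
  have h2 := h.exp_bounds hS hV MeasurableSet.univ
  rw [inter_univ] at h2
  rw [hS.weights_real_inter hA, gibbs_real hV hA]
  have hZ := hS.partition_pos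
  change _ ≤ S.partition ∧ S.partition ≤ _ at h2
  have hIA : 0 ≤ ∫ x in S.support ∩ A, Real.exp (-V x) :=
    integral_nonneg fun x => (Real.exp_pos _).le
  have hI : 0 < ∫ x in S.support, Real.exp (-V x) := by
    by_contra hcon
    have := mul_nonpos_of_nonneg_of_nonpos
      (Real.exp_pos (sInf (S.score '' S.support) + a)).le (not_lt.1 hcon)
    linarith
  have e1 : Real.exp (sInf (S.score '' S.support) + a) =
      Real.exp (2 * a) * Real.exp (sInf (S.score '' S.support) - a) := by
    rw [← Real.exp_add]; congr 1; ring
  have hw := Real.exp_pos (sInf (S.score '' S.support) - a)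
  have hw2 := Real.exp_pos (2 * a)
  rw [e1] at h1 h2
  set u := Real.exp (sInf (S.score '' S.support) - a)
  set I := ∫ x in S.support, Real.exp (-V x)
  set IA := ∫ x in S.support ∩ A, Real.exp (-V x)
  set J := ∫ x in S.support ∩ A, Real.exp (-S.potential x)
  set c := Real.exp (2 * a)
  have hJ : 0 ≤ J := (mul_nonneg hw.le hIA).trans h1.1
  constructor
  · rw [← mul_div_assoc, div_le_div_iff₀ hZ hI]
    calc J * I ≤ c * u * IA * I := by gcongr; exact h1.2
      _ = c * IA * (u * I) := by ring
      _ ≤ c * IA * S.partition := by gcongr; exact h2.1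
  · rw [← mul_div_assoc, div_le_div_iff₀ hI hZ]
    calc IA * S.partition ≤ IA * (c * u * I) := by gcongr; exact h2.2
      _ = c * (u * IA) * I := by ring
      _ ≤ c * J * I := by gcongr; exact h1.1

/-- Prékopa–Leindler for `{|Y| > 3u}` and `{|Y| ≤ u}`: all midpoints lie in `{|Y| > u}`. -/
lemma gibbs_tail {D : Set (E n)} (hD : IsCompact D) (hDc : Convex ℝ D) (hD0 : volume D ≠ 0)
    (hV : ConvexOn ℝ univ V) (hVc : Continuous V) {Y : E n → ℝ} (hY : Measurable Y)
    (hmid : ∀ x y, Y ((1 / 2 : ℝ) • (x + y)) = (Y x + Y y) / 2) (u : ℝ) :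
    (gibbs D V).real {x | 3 * u < |Y x|} * (1 - (gibbs D V).real {x | u < |Y x|}) ≤
      (gibbs D V).real {x | u < |Y x|} ^ 2 := by
  have := isProbabilityMeasure_gibbs hD hD0 hVc
  have hm : ∀ u, MeasurableSet {x | u < |Y x|} := fun u => measurableSet_lt measurable_const hY.abs
  rw [← probReal_compl_eq_one_sub (hm u)]
  have h := withDensity_mul_le hDc hD.measurableSet hV hVc (hm (3 * u)) (hm u).compl (hm u)
    (fun x hx y hy => by
      simp only [mem_ofPred_eq, mem_compl_iff, not_lt] at hx hy ⊢
      rw [hmid, abs_div, abs_two, lt_div_iff₀ two_pos]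
      have h1 := abs_sub_abs_le_abs_sub (Y x) (-Y y)
      rw [abs_neg, sub_neg_eq_add] at h1
      linarith)
  rw [measureReal_def, measureReal_def, measureReal_def, ← ENNReal.toReal_mul, ← ENNReal.toReal_pow]
  refine ENNReal.toReal_mono (ENNReal.pow_ne_top (measure_ne_top _ _)) ?_
  rw [gibbs_apply (hm _), gibbs_apply (hm _).compl, gibbs_apply (hm _), mul_mul_mul_comm, mul_pow,
    ← sq]
  gcongr

/-- The first moment of a linear functional of unit variance, for a law close to log-concave. -/
theorem State.Close.le_integral_abs (hS : S.Regular) (hcl : S.Close V 1)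
    (hV : ConvexOn ℝ univ V) (hVc : Continuous V) {A : E n ≃L[ℝ] E n} (hA : Whitens A S.weights)
    (w : E n) : ‖w‖ / 300 ≤ ∫ x, |⟪w, A (x - mean S.weights)⟫_ℝ| ∂S.weights := by
  have hp := hS.isLawOn
  have := hp.prob
  have := isProbabilityMeasure_gibbs hS.support_compact hS.volume_support hVc
  have hYc : Continuous fun x => ⟪w, A (x - mean S.weights)⟫_ℝ :=
    continuous_const.inner (by fun_prop)
  obtain ⟨B, hB⟩ := hS.support_compact.exists_bound_of_continuousOn hYc.continuousOn
  have h1 := integral_sq_le_of_tail (p := S.weights) (ν := gibbs S.support V) hYc.measurable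
    (c := Real.exp (2 * 1)) (B := B)
    (by filter_upwards [hp.ae_mem] with x hx using hB x hx) (Real.exp_pos _)
    (fun A hA => (hcl.weights_real_le hS hVc hA).1)
    (fun A hA => (hcl.weights_real_le hS hVc hA).2)
    (fun u _ => gibbs_tail hS.support_compact hS.support_convex hS.volume_support hV hVc
      hYc.measurable (fun x y => by
        have : (1 / 2 : ℝ) • (x + y) - mean S.weights =
            (1 / 2 : ℝ) • ((x - mean S.weights) + (y - mean S.weights)) := by module
        rw [this, map_smul, map_add, inner_smul_right, inner_add_right]
        ring) u)
  rw [hA.moment] at h1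
  set θ := ∫ x, |⟪w, A (x - mean S.weights)⟫_ℝ| ∂S.weights
  have hθ : 0 ≤ θ := integral_nonneg fun _ => abs_nonneg _
  have he : Real.exp (2 * 1) ≤ 7.39 := by
    rw [two_mul, Real.exp_add]
    have := Real.exp_one_lt_d9
    nlinarith [Real.exp_pos 1]
  -- The number 300 absorbs `(1 + 3c)(8c)²` for `c = e²`, the comparison factor when the score is
  -- within 1 of `V`.
  have h2 : ‖w‖ ^ 2 ≤ (300 * θ) ^ 2 := by
    refine h1.trans ?_
    calc (1 + 3 * Real.exp (2 * 1)) * (8 * Real.exp (2 * 1) * θ) ^ 2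
        ≤ (1 + 3 * 7.39) * (8 * 7.39 * θ) ^ 2 := by gcongr
      _ ≤ (300 * θ) ^ 2 := by rw [mul_pow, mul_pow]; nlinarith [sq_nonneg θ]
  have h3 := abs_le_of_sq_le_sq h2 (by positivity)
  rw [abs_of_nonneg (norm_nonneg _)] at h3
  linarith

/-- The positive part of a linear functional of unit variance. -/
lemma State.Close.le_integral_pos (hS : S.Regular) (hcl : S.Close V 1)
    (hV : ConvexOn ℝ univ V) (hVc : Continuous V) {A : E n ≃L[ℝ] E n} (hA : Whitens A S.weights)
    (w : E n) : ‖w‖ / 600 ≤ ∫ x, max ⟪w, A (x - mean S.weights)⟫_ℝ 0 ∂S.weights := by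
  have hp := hS.isLawOn
  have := hp.prob
  have hYc : Continuous fun x => ⟪w, A (x - mean S.weights)⟫_ℝ :=
    continuous_const.inner (by fun_prop)
  have h1 := hcl.le_integral_abs hS hV hVc hA w
  have h2 := Whitens.integral_inner_eq_zero hp A w
  have h3 : ∀ x, max ⟪w, A (x - mean S.weights)⟫_ℝ 0 =
      |⟪w, A (x - mean S.weights)⟫_ℝ| * (1 / 2) + ⟪w, A (x - mean S.weights)⟫_ℝ * (1 / 2) := by
    intro x
    rcases le_total 0 ⟪w, A (x - mean S.weights)⟫_ℝ with h | h
    · rw [max_eq_left h, abs_of_nonneg h]; ring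
    · rw [max_eq_right h, abs_of_nonpos h]; ring
  simp_rw [h3]
  rw [integral_add ((hp.integrable hYc.abs).mul_const _) ((hp.integrable hYc).mul_const _),
    integral_mul_const, integral_mul_const, h2]
  linarith

end Gibbs

/-! ### Gaussians are dominated by nearly log-concave laws -/

/-- Every linear functional of unit variance has a positive part with mean at least `r`. -/
def Spread {n : ℕ} (A : E n ≃L[ℝ] E n) (p : Measure (E n)) (r : ℝ) : Prop :=
  ∀ w : E n, ‖w‖ * r ≤ ∫ x, max ⟪w, A (x - mean p)⟫_ℝ 0 ∂p

lemma integral_sub_const_sub {α : Type*} [MeasurableSpace α] {μ : Measure α}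
    [IsProbabilityMeasure μ] {f h : α → ℝ} (hf : Integrable f μ) (hh : Integrable h μ)
    (h0 : ∫ x, h x ∂μ = 0) (c : ℝ) : ∫ x, (f x - c - h x) ∂μ = ∫ x, f x ∂μ - c := by
  have h1 : Integrable (fun x => f x - c) μ := hf.sub (integrable_const _)
  rw [integral_sub h1 hh, integral_sub hf (integrable_const _), h0]
  simp

section Domination

variable {n : ℕ} {p : Measure (E n)} {D : Set (E n)} {A : E n ≃L[ℝ] E n}

/-- The variance of `p` in direction `u` is at most `(d ‖u‖)²`, which bounds the adjoint of `A⁻¹`,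
hence `A⁻¹` itself. -/
lemma norm_symm_le (hp : IsLawOn p D) (hA : Whitens A p) (hD : Convex ℝ D) {d : ℝ}
    (hd : ∀ x ∈ D, ∀ y ∈ D, ‖x - y‖ ≤ d) (hd0 : 0 ≤ d) (z : E n) : ‖A.symm z‖ ≤ d * ‖z‖ := by
  have := hp.prob
  set u := A.symm z
  set w : E n := (ContinuousLinearMap.adjoint (A.symm : E n →L[ℝ] E n)) u
  have hw : ∀ v, ⟪w, A v⟫_ℝ = ⟪u, v⟫_ℝ := by
    intro v
    simp [w, ContinuousLinearMap.adjoint_inner_left]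
  have h1 : ‖w‖ ^ 2 ≤ (d * ‖u‖) ^ 2 := by
    rw [← hA.moment w]
    simp only [hw]
    have h2 : ∫ x, ⟪u, x - mean p⟫_ℝ ^ 2 ∂p ≤ ∫ _, (d * ‖u‖) ^ 2 ∂p := by
      refine integral_mono_ae (hp.integrable
        ((continuous_const.inner (by fun_prop)).pow 2)) (integrable_const _) ?_
      filter_upwards [hp.ae_mem] with x hx
      rw [← sq_abs]
      gcongr
      refine (abs_real_inner_le_norm _ _).trans ?_
      rw [mul_comm]
      gcongr
      exact hd x hx _ (hp.mean_mem hD)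
    simpa using h2
  have h2 : ‖w‖ ≤ d * ‖u‖ := abs_le_of_sq_le_sq' h1 (by positivity) |>.2
  have h3 : ‖u‖ ^ 2 = ⟪w, z⟫_ℝ := by
    have := hw u
    rw [real_inner_self_eq_norm_sq] at this
    rw [← this]
    simp [u]
  have h4 := real_inner_le_norm w z
  have h5 : ‖u‖ * ‖u‖ ≤ ‖u‖ * (d * ‖z‖) := by
    calc ‖u‖ * ‖u‖ = ‖u‖ ^ 2 := (sq _).symm
      _ ≤ ‖w‖ * ‖z‖ := h3 ▸ h4
      _ ≤ d * ‖u‖ * ‖z‖ := by gcongr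
      _ = _ := by ring
  rcases (norm_nonneg u).eq_or_lt with h | h
  · rw [← h]; positivity
  · exact le_of_mul_le_mul_left h5 h

/-- A convex function dominates its maximum over an ellipsoid on average, if it has its minimum
`0` at the mean. -/
lemma le_integral_of_spread (hp : IsLawOn p D) (hA : Whitens A p) {r : ℝ} (hr : 0 ≤ r)
    (hsp : Spread A p (2 * r)) {φ : E n → ℝ} (hφ : ConvexOn ℝ univ φ) (hφc : Continuous φ)
    (h0 : ∀ x, 0 ≤ φ x) (hm : φ (mean p) = 0) {x : E n} (hx : x ∈ ellipsoid p r) :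
    φ x ≤ ∫ y, φ y ∂p := by
  have := hp.prob
  rw [hA.ellipsoid_eq] at hx
  obtain ⟨g, hg⟩ := exists_subgradient hφ (x := x) (by simp)
  set w : E n := (ContinuousLinearMap.adjoint (A.symm : E n →L[ℝ] E n)) g
  have hw : ∀ v, ⟪w, A v⟫_ℝ = ⟪g, v⟫_ℝ := by
    intro v
    simp [w, ContinuousLinearMap.adjoint_inner_left]
  have hc := real_inner_le_norm w (A (x - mean p))
  have hx' : ‖A (x - mean p)‖ ≤ r := hx
  have hc' : ⟪w, A (x - mean p)⟫_ℝ ≤ ‖w‖ * r := hc.trans (by gcongr)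
  -- Where the functional is positive, this is the subgradient inequality at `x`. Where it is
  -- negative, `φ y ≥ 0` suffices, as the subgradient inequality at the mean gives `φ x ≤ ‖w‖ r`.
  -- The mean of the left side is at least `2 ‖w‖ r - ‖w‖ r + φ x ≥ φ x`.
  have h1 : ∀ y, max ⟪w, A (y - mean p)⟫_ℝ 0 - (‖w‖ * r - φ x) ≤ φ y := by
    intro y
    have h2 := hg y (mem_univ _)
    have h3 := hg (mean p) (mem_univ _)
    rw [hm] at h3
    have e1 : ⟪g, y - x⟫_ℝ = ⟪w, A (y - mean p)⟫_ℝ - ⟪w, A (x - mean p)⟫_ℝ := by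
      rw [hw, hw, ← inner_sub_right]; congr 1; abel
    have e2 : ⟪g, mean p - x⟫_ℝ = - ⟪w, A (x - mean p)⟫_ℝ := by
      rw [hw, ← inner_neg_right]; congr 1; abel
    rw [e1] at h2
    rw [e2] at h3
    have := h0 y
    rcases le_total 0 ⟪w, A (y - mean p)⟫_ℝ with h | h
    · rw [max_eq_left h]; linarith
    · rw [max_eq_right h]; linarith
  have h2 := hsp w
  have hi : Integrable (fun y => max ⟪w, A (y - mean p)⟫_ℝ 0) p :=
    hp.integrable ((continuous_const.inner (by fun_prop)).max continuous_const)
  have h3 := MeasureTheory.integral_mono (hi.sub (integrable_const _)) (hp.integrable hφc) h1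
  rw [integral_sub' hi (integrable_const _)] at h3
  simp only [integral_const, probReal_univ, smul_eq_mul, one_mul] at h3
  have : 0 ≤ ‖w‖ * r := by positivity
  linarith

/-- A small Gaussian with the covariance of a spread-out law is dominated by the law in the convex
order, up to a tail. -/
theorem integral_gaussian_le_of_spread (hp : IsLawOn p D) (hA : Whitens A p) (hD : Convex ℝ D)
    {d : ℝ} (hd : ∀ x ∈ D, ∀ y ∈ D, ‖x - y‖ ≤ d) (hd0 : 0 ≤ d) {T : ℕ} (hn : 1 ≤ n) (hT : n < T)
    {e s : ℝ} (he : 0 < e) (hs0 : 0 < s) (hs : s ≤ e / Real.sqrt (n * Real.log T))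
    (hsp : Spread A p (6 * e)) {f : E n → ℝ} {Λ : ℝ≥0} (hf : ConvexOn ℝ univ f)
    (hfl : LipschitzWith Λ f) :
    ∫ z, f (mean p + s • A.symm z) ∂(stdGaussian (E n)) ≤
      ∫ x, f x ∂p + 16 * Λ * s * d / (T : ℝ) ^ 3 := by
  have := hp.prob
  have hX : 0 < (n : ℝ) * Real.log T := by
    have h1 := log_two_le_log hn hT
    have h2 : (1 : ℝ) ≤ n := by exact_mod_cast hn
    nlinarith
  obtain ⟨g, hg⟩ := exists_subgradient hf (x := mean p) (by simp)
  have hgl : ‖g‖ ≤ Λ := by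
    have h1 := hg (mean p + g) (mem_univ _)
    rw [add_sub_cancel_left, real_inner_self_eq_norm_sq] at h1
    have h2 := hfl.dist_le_mul (mean p + g) (mean p)
    rw [Real.dist_eq, dist_eq_norm, add_sub_cancel_left] at h2
    have h3 := le_abs_self (f (mean p + g) - f (mean p))
    have h4 : ‖g‖ * ‖g‖ ≤ Λ * ‖g‖ := by nlinarith
    rcases (norm_nonneg g).eq_or_lt with h | h
    · rw [← h]; exact Λ.2
    · exact le_of_mul_le_mul_right h4 h
  have hinner : Continuous fun x => ⟪g, x - mean p⟫_ℝ := continuous_const.inner (by fun_prop)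
  -- Subtracting a supporting affine function at the mean is harmless: both laws have this mean, so
  -- its integrals agree.
  set φ : E n → ℝ := fun x => f x - f (mean p) - ⟪g, x - mean p⟫_ℝ
  have hφc : Continuous φ := (hfl.continuous.sub continuous_const).sub hinner
  have hφ0 : ∀ x, 0 ≤ φ x := fun x => by
    have := hg x (mem_univ _)
    simp only [φ]; linarith
  have hφm : φ (mean p) = 0 := by simp [φ]
  have hφ : ConvexOn ℝ univ φ := by
    refine ⟨convex_univ, fun x _ y _ a b ha hb hab => ?_⟩
    have h1 := hf.2 (mem_univ x) (mem_univ y) ha hb hab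
    simp only [smul_eq_mul, φ] at h1 ⊢
    have h2 : a • x + b • y - mean p = a • (x - mean p) + b • (y - mean p) := by
      have : mean p = (a + b) • mean p := by rw [hab, one_smul]
      nth_rewrite 1 [this]
      module
    rw [h2, inner_add_right, inner_smul_right, inner_smul_right]
    have h3 : f (mean p) = (a + b) * f (mean p) := by rw [hab, one_mul]
    nlinarith
  have hM : ∀ x ∈ ellipsoid p (3 * e), φ x ≤ ∫ y, φ y ∂p := fun x hx =>
    le_integral_of_spread hp hA (by positivity)
      (by rw [show 2 * (3 * e) = 6 * e by ring]; exact hsp) hφ hφc hφ0 hφm hx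
  have hφl : ∀ v, φ (mean p + v) ≤ 2 * Λ * ‖v‖ := by
    intro v
    have h2 := hfl.dist_le_mul (mean p + v) (mean p)
    rw [Real.dist_eq, dist_eq_norm, add_sub_cancel_left] at h2
    have h3 := le_abs_self (f (mean p + v) - f (mean p))
    have h4 := (abs_le.1 (abs_real_inner_le_norm g v)).1
    have h5 : ‖g‖ * ‖v‖ ≤ Λ * ‖v‖ := by gcongr
    simp only [φ, add_sub_cancel_left]
    linarith
  set M := ∫ y, φ y ∂p
  have hM0 : 0 ≤ M := integral_nonneg hφ0
  -- Where `‖z‖ ≤ 3 √(n log T)` the point lies in the ellipsoid of radius `3e`, on which `φ` is at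
  -- most its `p`-mean. Beyond that, the Lipschitz bound leaves the Gaussian tail of the norm.
  have hpt : ∀ z : E n, φ (mean p + s • A.symm z) ≤ M + 2 * Λ * s * d *
      {z : E n | 9 * (n * Real.log T) < ‖z‖ ^ 2}.indicator (fun z => ‖z‖) z := by
    intro z
    by_cases hz : 9 * (n * Real.log T) < ‖z‖ ^ 2
    · rw [indicator_of_mem (show z ∈ {z : E n | 9 * (n * Real.log T) < ‖z‖ ^ 2} from hz)]
      have h1 := hφl (s • A.symm z)
      rw [norm_smul, Real.norm_of_nonneg hs0.le] at h1
      have h2 := norm_symm_le hp hA hD hd hd0 z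
      have h3 : 2 * Λ * (s * ‖A.symm z‖) ≤ 2 * Λ * (s * (d * ‖z‖)) := by gcongr
      linarith
    · rw [indicator_of_notMem (show z ∉ {z : E n | 9 * (n * Real.log T) < ‖z‖ ^ 2} from hz)]
      rw [mul_zero, add_zero]
      apply hM
      rw [hA.ellipsoid_eq]
      change ‖A _‖ ≤ _
      rw [add_sub_cancel_left, map_smul, A.apply_symm_apply, norm_smul,
        Real.norm_of_nonneg hs0.le]
      have h1 : ‖z‖ ≤ 3 * Real.sqrt (n * Real.log T) := by
        apply abs_le_of_sq_le_sq' _ (by positivity) |>.2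
        rw [mul_pow, Real.sq_sqrt hX.le]
        have := not_lt.1 hz
        linarith
      have h2 : 0 < Real.sqrt (n * Real.log T) := Real.sqrt_pos.2 hX
      rw [le_div_iff₀ h2] at hs
      calc s * ‖z‖ ≤ s * (3 * Real.sqrt (n * Real.log T)) := by gcongr
        _ = 3 * (s * Real.sqrt (n * Real.log T)) := by ring
        _ ≤ 3 * e := by gcongr
  have hint : Integrable (fun z => f (mean p + s • A.symm z)) (stdGaussian (E n)) :=
    integrable_comp_affine_stdGaussian hfl (mean p) (s • (A.symm : E n →L[ℝ] E n))
  have hlin : ∫ z, ⟪g, s • A.symm z⟫_ℝ ∂(stdGaussian (E n)) = 0 :=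
    integral_strongDual_stdGaussian ((innerSL ℝ g).comp (s • (A.symm : E n →L[ℝ] E n)))
  have hlint : Integrable (fun z => ⟪g, s • A.symm z⟫_ℝ) (stdGaussian (E n)) :=
    IsGaussian.integrable_dual _ ((innerSL ℝ g).comp (s • (A.symm : E n →L[ℝ] E n)))
  have hiφ : Integrable (fun z => φ (mean p + s • A.symm z)) (stdGaussian (E n)) := by
    simp only [φ, add_sub_cancel_left]
    exact (hint.sub (integrable_const _)).sub hlint
  have hG : ∫ z, φ (mean p + s • A.symm z) ∂(stdGaussian (E n)) =
      ∫ z, f (mean p + s • A.symm z) ∂(stdGaussian (E n)) - f (mean p) := by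
    simp only [φ, add_sub_cancel_left]
    exact integral_sub_const_sub hint hlint hlin _
  have hP : M = ∫ x, f x ∂p - f (mean p) :=
    integral_sub_const_sub (hp.integrable hfl.continuous) (hp.integrable hinner)
      (hp.integral_inner_sub_mean _) _
  have hitail : Integrable ({z : E n | 9 * (n * Real.log T) < ‖z‖ ^ 2}.indicator
      (fun z => ‖z‖)) (stdGaussian (E n)) :=
    (integrable_norm_stdGaussian n).indicator
      (measurableSet_lt measurable_const (by fun_prop))
  have h1 := MeasureTheory.integral_mono hiφ
    ((integrable_const M).add (hitail.const_mul (2 * Λ * s * d))) hpt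
  rw [integral_add' (integrable_const M) (hitail.const_mul (2 * Λ * s * d)),
    integral_const_mul] at h1
  have h2 := integral_tail_norm_stdGaussian_le hn hT
  have h3 : 2 * Λ * s * d * ∫ z, {z : E n | 9 * (n * Real.log T) < ‖z‖ ^ 2}.indicator
      (fun z => ‖z‖) z ∂(stdGaussian (E n)) ≤ 2 * Λ * s * d * (8 / (T : ℝ) ^ 3) := by
    gcongr
  simp only [integral_const, probReal_univ, smul_eq_mul, one_mul] at h1
  rw [hG] at h1
  have h4 : 2 * Λ * s * d * (8 / (T : ℝ) ^ 3) = 16 * Λ * s * d / (T : ℝ) ^ 3 := by ring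
  linarith

end Domination

/-! ### The smoothed losses -/

section Smoothed

variable {n : ℕ} {p : Measure (E n)} {D : Set (E n)} {A : E n ≃L[ℝ] E n} {P : Params}
  {f : E n → ℝ} {Λ : ℝ≥0}

lemma integrable_kernelAdjoint (hf : LipschitzWith Λ f) (P : Params) (A : E n ≃L[ℝ] E n)
    (m y : E n) : Integrable (fun z =>
      f ((1 - P.lam) • (m + Real.sqrt (coreVar P n) • A.symm z) + P.lam • y))
        (stdGaussian (E n)) := by
  have h := integrable_comp_affine_stdGaussian hf ((1 - P.lam) • m + P.lam • y)
    (((1 - P.lam) * Real.sqrt (coreVar P n)) • (A.symm : E n →L[ℝ] E n))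
  refine h.congr (Filter.Eventually.of_forall fun z => congrArg f ?_)
  change (1 - P.lam) • m + P.lam • y + ((1 - P.lam) * Real.sqrt (coreVar P n)) • A.symm z = _
  module

lemma kernelAdjoint_nonneg (hA : Whitens A p) (hP : 0 < coreVar P n) (hlam : P.lam < 1)
    (hf0 : ∀ x, 0 ≤ f x) (y : E n) : 0 ≤ kernelAdjoint P p f y := by
  rw [kernelAdjoint_eq hA hP hlam]
  exact integral_nonneg fun z => hf0 _

lemma kernelAdjoint_convex (hA : Whitens A p) (hP : 0 < coreVar P n) (hlam : P.lam < 1)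
    (hf : ConvexOn ℝ univ f) (hfl : LipschitzWith Λ f) :
    ConvexOn ℝ univ (kernelAdjoint P p f) := by
  refine ⟨convex_univ, fun x _ y _ a b ha hb hab => ?_⟩
  simp only [kernelAdjoint_eq hA hP hlam, smul_eq_mul]
  have hi := integrable_kernelAdjoint hfl P A (mean p)
  rw [← integral_const_mul, ← integral_const_mul,
    ← integral_add ((hi x).const_mul a) ((hi y).const_mul b)]
  refine MeasureTheory.integral_mono (hi _) (((hi x).const_mul a).add ((hi y).const_mul b))
    fun z => ?_
  set c := (1 - P.lam) • (mean p + Real.sqrt (coreVar P n) • A.symm z)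
  have h1 := hf.2 (mem_univ (c + P.lam • x)) (mem_univ (c + P.lam • y)) ha hb hab
  have h2 : a • (c + P.lam • x) + b • (c + P.lam • y) = c + P.lam • (a • x + b • y) := by
    have : c = (a + b) • c := by rw [hab, one_smul]
    nth_rewrite 3 [this]
    module
  rw [h2] at h1
  exact h1

lemma kernelAdjoint_lipschitz (hA : Whitens A p) (hP : 0 < coreVar P n) (hlam : P.lam < 1)
    (hlam0 : 0 ≤ P.lam) (hfl : LipschitzWith Λ f) :
    LipschitzWith (P.lam.toNNReal * Λ) (kernelAdjoint P p f) := by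
  refine LipschitzWith.of_le_add_mul _ fun x y => ?_
  rw [kernelAdjoint_eq hA hP hlam, kernelAdjoint_eq hA hP hlam]
  have hi := integrable_kernelAdjoint hfl P A (mean p)
  have h : ∀ z, f ((1 - P.lam) • (mean p + Real.sqrt (coreVar P n) • A.symm z) + P.lam • x) ≤
      f ((1 - P.lam) • (mean p + Real.sqrt (coreVar P n) • A.symm z) + P.lam • y) +
        P.lam * Λ * dist x y := by
    intro z
    set c := (1 - P.lam) • (mean p + Real.sqrt (coreVar P n) • A.symm z)
    have h1 := hfl.dist_le_mul (c + P.lam • x) (c + P.lam • y)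
    rw [dist_add_left, dist_smul₀, Real.norm_of_nonneg hlam0, Real.dist_eq] at h1
    have := le_abs_self (f (c + P.lam • x) - f (c + P.lam • y))
    linarith
  have h2 := MeasureTheory.integral_mono (hi x) ((hi y).add (integrable_const _)) h
  rw [integral_add' (hi y) (integrable_const _)] at h2
  simp only [integral_const, probReal_univ, smul_eq_mul, one_mul] at h2
  rwa [NNReal.coe_mul, Real.coe_toNNReal _ hlam0]

lemma kernelAdjoint_le (hA : Whitens A p) (hP : 0 < coreVar P n) (hlam : P.lam < 1)
    (hlam0 : 0 ≤ P.lam) (hf : ConvexOn ℝ univ f) (hfl : LipschitzWith Λ f) (y : E n) :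
    kernelAdjoint P p f y ≤ (1 - P.lam) *
      (∫ z, f (mean p + Real.sqrt (coreVar P n) • A.symm z) ∂(stdGaussian (E n))) +
        P.lam * f y := by
  rw [kernelAdjoint_eq hA hP hlam, ← integral_const_mul]
  have hi := integrable_comp_affine_stdGaussian hfl (mean p)
    (Real.sqrt (coreVar P n) • (A.symm : E n →L[ℝ] E n))
  have h2 := MeasureTheory.integral_mono (integrable_kernelAdjoint hfl P A (mean p) y)
    ((hi.const_mul (1 - P.lam)).add (integrable_const (P.lam * f y))) fun z => by
      have := hf.2 (mem_univ (mean p + Real.sqrt (coreVar P n) • A.symm z)) (mem_univ y)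
        (by linarith : 0 ≤ 1 - P.lam) hlam0 (by ring)
      exact this
  rw [integral_add' (hi.const_mul _) (integrable_const _)] at h2
  simp only [integral_const, probReal_univ, smul_eq_mul, one_mul] at h2
  exact h2

lemma sqrt_coreVar_eq (n T : ℕ) :
    Real.sqrt (coreVar (params n T) n) = (params n T).eps / Real.sqrt (n * Real.log T) *
      Real.sqrt ((params n T).lam / (2 - (params n T).lam)) := by
  have hX : 0 ≤ (n : ℝ) * Real.log T := by positivity
  have he := eps_pos (n := n) (T := T)
  have h1 : coreVar (params n T) n = ((params n T).eps / Real.sqrt (n * Real.log T)) ^ 2 *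
      ((params n T).lam / (2 - (params n T).lam)) := by
    rw [div_pow, Real.sq_sqrt hX]; rfl
  rw [h1, Real.sqrt_mul (sq_nonneg _), Real.sqrt_sq (by positivity)]

/-- The kernel is a contraction of the Gaussian with covariance `(ε² / (n log T)) Cov(p)` to the
core. -/
lemma integral_kernelAdjoint_gaussian (hn : 1 ≤ n) {T : ℕ} (hT : n < T) (hA : Whitens A p)
    (hfl : LipschitzWith Λ f) :
    ∫ z, kernelAdjoint (params n T) p f (mean p +
        ((params n T).eps / Real.sqrt (n * Real.log T)) • A.symm z) ∂(stdGaussian (E n)) =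
      ∫ z, f (mean p + Real.sqrt (coreVar (params n T) n) • A.symm z) ∂(stdGaussian (E n)) := by
  have hP := coreVar_pos hn hT
  have hl0 := lam_pos hn hT
  have hl1 := lam_lt_one hn hT
  have hs := sqrt_coreVar_eq n T
  have hi := integrable_comp_affine_stdGaussian hfl (mean p)
    (Real.sqrt (coreVar (params n T) n) • (A.symm : E n →L[ℝ] E n))
  set lam := (params n T).lam
  set s := (params n T).eps / Real.sqrt (n * Real.log T)
  set k := Real.sqrt (coreVar (params n T) n)
  have hq : 0 < lam / (2 - lam) := div_pos hl0 (by linarith)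
  have hq2 := Real.sq_sqrt hq.le
  set q := Real.sqrt (lam / (2 - lam))
  have hq0 : 0 < q := Real.sqrt_pos.2 hq
  -- Here `q` is the ratio of the standard deviations of the core and of the wide Gaussian. The
  -- identity `λ² + (1 - λ)² q² = q²` says that mixing the two with weights `1 - λ` and `λ` returns
  -- the core; this fixes the factor `λ / (2 - λ)` in the core variance.
  have hc : (lam / q) ^ 2 + (1 - lam) ^ 2 = 1 := by
    rw [div_pow, hq2]
    have : 2 - lam ≠ 0 := by linarith
    field_simp
    ring
  refine Eq.trans ?_ (integral_integral_stdGaussian hi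
    (by have := hfl.continuous; fun_prop) hc)
  refine integral_congr_ae (Filter.Eventually.of_forall fun z => ?_)
  simp only [kernelAdjoint_eq hA hP hl1]
  refine integral_congr_ae (Filter.Eventually.of_forall fun w => ?_)
  refine congrArg f ?_
  change (1 - lam) • (mean p + k • A.symm w) + lam • (mean p + s • A.symm z) =
    mean p + k • A.symm ((lam / q) • z + (1 - lam) • w)
  have : lam * s = k * (lam / q) := by rw [hs]; field_simp
  rw [map_add, map_smul, map_smul, smul_add k, smul_smul, smul_smul, ← this]
  module

/-- The kernel transfers the regret against `f` to the regret against its smoothing. -/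
theorem lam_mul_sub_le (hn : 1 ≤ n) {T : ℕ} (hT : n < T) (hp : IsLawOn p D) (hA : Whitens A p)
    (hD : Convex ℝ D) (hd : ∀ x ∈ D, ∀ y ∈ D, ‖x - y‖ ≤ T)
    (hsp : Spread A p (6 * (params n T).eps)) (hf : ConvexOn ℝ univ f)
    (hfl : LipschitzWith T f) (y : E n) :
    (params n T).lam * ((∫ x, kernelAdjoint (params n T) p f x ∂p) - f y) ≤
      (∫ x, kernelAdjoint (params n T) p f x ∂p) - kernelAdjoint (params n T) p f y +
        1 / T := by
  have hP := coreVar_pos hn hT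
  have hl0 := lam_pos hn hT
  have hl1 := lam_lt_one hn hT
  have he := eps_pos (n := n) (T := T)
  have hX : 0.69 ≤ (n : ℝ) * Real.log T := by
    have h1 := log_two_le_log hn hT
    have h2 : (1 : ℝ) ≤ n := by exact_mod_cast hn
    nlinarith
  have hX2 : 0 < Real.sqrt (n * Real.log T) := Real.sqrt_pos.2 (by linarith)
  have hs0 : 0 < (params n T).eps / Real.sqrt (n * Real.log T) := by positivity
  -- Domination is applied to the smoothed `f`: its mean under the wide Gaussian is the mean `I` of
  -- `f` under the core, so `I ≤ J + 1/T`. Convexity bounds the smoothing at `y` by `(1 - λ) I + λ f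
  -- y`, and the claim is linear arithmetic.
  have h1 := integral_gaussian_le_of_spread hp hA hD hd (Nat.cast_nonneg T) hn hT he hs0 le_rfl
    hsp (kernelAdjoint_convex hA hP hl1 hf hfl) (kernelAdjoint_lipschitz hA hP hl1 hl0.le hfl)
  rw [integral_kernelAdjoint_gaussian hn hT hA hfl] at h1
  have h2 := kernelAdjoint_le hA hP hl1 hl0.le hf hfl y
  have hT2 : (2 : ℝ) ≤ T := by exact_mod_cast (by omega : 2 ≤ T)
  have h3 : 16 * ((params n T).lam.toNNReal * (T : ℝ≥0) : ℝ≥0) *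
      ((params n T).eps / Real.sqrt (n * Real.log T)) * T / (T : ℝ) ^ 3 ≤ 1 / T := by
    rw [NNReal.coe_mul, Real.coe_toNNReal _ hl0.le, NNReal.coe_natCast]
    have h4 : (params n T).eps / Real.sqrt (n * Real.log T) ≤ 1 := by
      rw [div_le_one hX2]
      have h5 := eps_le (n := n) (T := T)
      apply Real.le_sqrt_of_sq_le
      nlinarith
    have h5 := lam_le hn hT
    norm_num at h5
    rw [div_le_div_iff₀ (by positivity) (by positivity)]
    have h6 : 16 * (params n T).lam * ((params n T).eps / Real.sqrt (n * Real.log T)) ≤ 1 := by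
      nlinarith
    calc 16 * ((params n T).lam * T) * ((params n T).eps / Real.sqrt (n * Real.log T)) * T * T
        = (16 * (params n T).lam * ((params n T).eps / Real.sqrt (n * Real.log T))) * T ^ 3 := by
          ring
      _ ≤ 1 * T ^ 3 := by gcongr
  set I := ∫ z, f (mean p + Real.sqrt (coreVar (params n T) n) • A.symm z) ∂(stdGaussian (E n))
  set J := ∫ x, kernelAdjoint (params n T) p f x ∂p
  have h7 : I ≤ J + 1 / T := h1.trans (by linarith)
  have h8 : (1 - (params n T).lam) * I ≤ (1 - (params n T).lam) * (J + 1 / T) := by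
    gcongr
  have h9 : 0 ≤ (params n T).lam * (1 / (T : ℝ)) := by positivity
  linarith

/-- The smoothed loss is at most `2`. -/
theorem kernelAdjoint_le_two (hn : 1 ≤ n) {T : ℕ} (hT : n < T) (hp : IsLawOn p D)
    (hA : Whitens A p) (hD : Convex ℝ D) (hd : ∀ x ∈ D, ∀ y ∈ D, ‖x - y‖ ≤ T)
    (hsp : Spread A p (6 * (params n T).eps)) (hf : ConvexOn ℝ univ f)
    (hfl : LipschitzWith T f) (hf1 : ∀ x ∈ D, f x ≤ 1) {y : E n} (hy : f y ≤ 1) :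
    kernelAdjoint (params n T) p f y ≤ 2 := by
  have := hp.prob
  have hP := coreVar_pos hn hT
  have hl0 := lam_pos hn hT
  have hl1 := lam_lt_one hn hT
  have he := eps_pos (n := n) (T := T)
  have hX : 0.69 ≤ (n : ℝ) * Real.log T := by
    have h1 := log_two_le_log hn hT
    have h2 : (1 : ℝ) ≤ n := by exact_mod_cast hn
    nlinarith
  have hX2 : 0 < Real.sqrt (n * Real.log T) := Real.sqrt_pos.2 (by linarith)
  have hk := Real.sqrt_pos.2 hP
  have hks := sqrt_coreVar_eq n T
  have hk1 : Real.sqrt (coreVar (params n T) n) ≤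
      (params n T).eps / Real.sqrt (n * Real.log T) := by
    rw [hks]
    refine mul_le_of_le_one_right (by positivity) ?_
    refine Real.sqrt_le_iff.2 ⟨zero_le_one, ?_⟩
    rw [one_pow, div_le_one (by linarith)]
    linarith
  have hk2 : (params n T).eps / Real.sqrt (n * Real.log T) ≤ 1 / 16 := by
    rw [div_le_iff₀ hX2]
    have h5 := eps_le (n := n) (T := T)
    have : 16 * (params n T).eps ≤ Real.sqrt (n * Real.log T) := by
      apply Real.le_sqrt_of_sq_le
      nlinarith
    linarith
  have h1 := integral_gaussian_le_of_spread hp hA hD hd (Nat.cast_nonneg T) hn hT he hk hk1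
    hsp hf hfl
  have h2 := kernelAdjoint_le hA hP hl1 hl0.le hf hfl y
  have hT2 : (2 : ℝ) ≤ T := by exact_mod_cast (by omega : 2 ≤ T)
  have h3 : 16 * ((T : ℝ≥0) : ℝ) * Real.sqrt (coreVar (params n T) n) * T / (T : ℝ) ^ 3 ≤ 1 := by
    rw [NNReal.coe_natCast, div_le_one (by positivity)]
    calc 16 * (T : ℝ) * Real.sqrt (coreVar (params n T) n) * T
        ≤ 16 * (T : ℝ) * (1 / 16) * T := by gcongr; exact hk1.trans hk2
      _ = T ^ 2 := by ring
      _ ≤ T ^ 3 := pow_le_pow_right₀ (by linarith) (by norm_num)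
  have h4 : ∫ x, f x ∂p ≤ 1 := by
    have := integral_mono_ae (hp.integrable hfl.continuous) (integrable_const (1 : ℝ))
      (by filter_upwards [hp.ae_mem] with x hx using hf1 x hx)
    simpa using this
  set I := ∫ z, f (mean p + Real.sqrt (coreVar (params n T) n) • A.symm z) ∂(stdGaussian (E n))
  nlinarith

end Smoothed

lemma State.Close.spread {n : ℕ} {S : State n} {V : E n → ℝ} (hcl : S.Close V 1)
    (hS : S.Regular) (hV : ConvexOn ℝ univ V) (hVc : Continuous V) {A : E n ≃L[ℝ] E n}
    (hA : Whitens A S.weights) {e : ℝ} (he : e ≤ 1 / 600) : Spread A S.weights e := by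
  intro w
  refine le_trans ?_ (hcl.le_integral_pos hS hV hVc hA w)
  have := mul_le_mul_of_nonneg_left he (norm_nonneg w)
  linarith

/-! ### Points far from the mean have a large potential -/

section Far

variable {n : ℕ} {S : State n} {V : E n → ℝ}

/-- Contraction towards a point of the support changes the mass of a set by a bounded factor. -/
lemma State.Close.weights_contract_ge {a : ℝ} (hS : S.Regular) (hcl : S.Close V a)
    (hV : ConvexOn ℝ univ V) {x : E n} (hx : x ∈ S.support) {s : ℝ} (hs0 : 0 ≤ s) (hs1 : s < 1)
    {G H : Set (E n)} (hG : MeasurableSet G) (hGS : G ⊆ S.support) (hH : MeasurableSet H)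
    (hHS : H ⊆ S.support) (hGH : ∀ z ∈ G, (1 - s) • z + s • x ∈ H) :
    (1 - s) ^ n * Real.exp (-(s * S.potential x) - 2 * a) * S.weights.real G ≤
      S.weights.real H := by
  have hZ := hS.partition_pos
  rw [hS.weights_real hG hGS, hS.weights_real hH hHS, ← mul_div_assoc]
  refine div_le_div_of_nonneg_right ?_ hZ.le
  set f : E n → ℝ := H.indicator fun z => Real.exp (-S.potential z)
  have hfi : Integrable f := (integrable_indicator_iff hH).2 (hS.integrableOn_exp.mono_set hHS)
  have h1s : (1 - s) ≠ 0 := by linarith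
  have hcv : ∫ z, f z = (1 - s) ^ n * ∫ z, f ((1 - s) • z + s • x) := by
    have h1 := Measure.integral_comp_smul volume (fun z => f (z + s • x)) (1 - s)
    rw [integral_add_right_eq_self f (s • x), finrank_euclideanSpace_fin, smul_eq_mul,
      abs_of_nonneg (inv_nonneg.2 (pow_nonneg (by linarith) n))] at h1
    rw [h1, mul_inv_cancel_left₀ (pow_ne_zero _ h1s)]
  have hfi2 : Integrable fun z => f ((1 - s) • z + s • x) :=
    (hfi.comp_add_right (s • x)).comp_smul h1s
  rw [← integral_indicator hH]
  change _ ≤ ∫ z, f z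
  rw [hcv, mul_assoc, ← integral_const_mul, ← integral_indicator hG]
  refine mul_le_mul_of_nonneg_left ?_ (pow_nonneg (by linarith) n)
  refine integral_mono ?_ hfi2 fun z => ?_
  · exact (integrable_indicator_iff hG).2 ((hS.integrableOn_exp.mono_set hGS).const_mul _)
  by_cases hz : z ∈ G
  swap
  · rw [indicator_of_notMem hz]
    exact indicator_nonneg (fun _ _ => (Real.exp_pos _).le) _
  have hzS := hGS hz
  simp only [f]
  rw [indicator_of_mem hz, indicator_of_mem (hGH z hz), ← Real.exp_add]
  apply Real.exp_le_exp.2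
  -- Closeness is used at three points with weights `1 - s`, `s` and `1`, whence the loss of `2a`.
  have h1 := abs_le.1 (hcl z hzS)
  have h2 := abs_le.1 (hcl x hx)
  have h3 := abs_le.1 (hcl _ (hHS (hGH z hz)))
  have h4 := hV.2 (mem_univ z) (mem_univ x) (by linarith : 0 ≤ 1 - s) hs0 (by ring)
  have h5 := hS.potential_nonneg hzS
  simp only [State.potential, smul_eq_mul] at h4 h5 ⊢
  nlinarith

/-- If `B = Q(x)` were small, contracting the slab `|Y| ≤ 2` slightly towards `x` would carry it
into `|Y| ≥ 10`, where `Y` is the unit-variance functional in the direction of `x`, at the price of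
only a constant factor in mass. Chebyshev allows a mass of just `1/100` there. -/
theorem State.Close.le_potential {n T : ℕ} (hn : 1 ≤ n) (hT : n < T) {S : State n}
    {V : E n → ℝ} (hS : S.Regular) (hcl : S.Close V (3 / 2)) (hV : ConvexOn ℝ univ V)
    {A : E n ≃L[ℝ] E n} (hA : Whitens A S.weights) {x : E n} (hx : x ∈ S.support)
    (hfar : (params n T).alpha ≤ ‖A (x - mean S.weights)‖) :
    (params n T).alpha / 25 ≤ S.potential x := by
  have hp := hS.isLawOn
  have := hp.prob
  have hα := alpha_pos hn hT
  have hα' := alpha_ge hn hT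
  have hn' : (1 : ℝ) ≤ n := by exact_mod_cast hn
  by_contra! hB
  set α := (params n T).alpha
  set m := mean S.weights
  have hB0 := hS.potential_nonneg hx
  set B := S.potential x
  set R := ‖A (x - m)‖
  have hR : 0 < R := hα.trans_le hfar
  set w : E n := R⁻¹ • A (x - m)
  have hw : ‖w‖ = 1 := by
    simp only [w]
    rw [norm_smul, norm_inv, norm_norm]
    exact inv_mul_cancel₀ hR.ne'
  have hwx : ⟪w, A (x - m)⟫_ℝ = R := by
    simp only [w]
    rw [real_inner_smul_left, real_inner_self_eq_norm_sq, sq]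
    exact inv_mul_cancel_left₀ hR.ne' R
  have hYc : Continuous fun z => ⟪w, A (z - m)⟫_ℝ := continuous_const.inner (by fun_prop)
  -- With this `s` both `n s` and `s B` are at most `1/2`, so the contraction factor is at least
  -- `(1/2) e^(-7/2) ≥ 1/72`. On the other hand `s R > 12`, as `R ≥ α > 24 (n + B)`. The
  -- contradiction is `(1/72)(3/4) = 1/96 > 1/100`.
  set s : ℝ := 1 / (2 * (n + B))
  have hs0 : 0 < s := by positivity
  have hs : s * (n + B) = 1 / 2 := by simp only [s]; field_simp
  have hsn : n * s ≤ 1 / 2 := by nlinarith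
  have hsB : s * B ≤ 1 / 2 := by nlinarith
  have hs1 : s ≤ 1 / 2 := by nlinarith
  have hsR : 12 < s * R := by
    have h1 : 24 * (n + B) < R := by linarith
    have h2 : s * (24 * (n + B)) < s * R := mul_lt_mul_of_pos_left h1 hs0
    nlinarith
  set G := S.support ∩ {z | |⟪w, A (z - m)⟫_ℝ| ≤ 2}
  set H := S.support ∩ {z | 10 ≤ |⟪w, A (z - m)⟫_ℝ|}
  have hSm := hS.support_compact.measurableSet
  have hG : MeasurableSet G := hSm.inter (measurableSet_le (by fun_prop) measurable_const)
  have hH : MeasurableSet H := hSm.inter (measurableSet_le measurable_const (by fun_prop))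
  have h1 := hcl.weights_contract_ge hS hV hx hs0.le (by linarith) hG inter_subset_left hH
    inter_subset_left (fun z hz => by
      refine ⟨hS.support_convex hz.1 hx (by linarith) hs0.le (by ring), ?_⟩
      have e : (1 - s) • z + s • x - m = (1 - s) • (z - m) + s • (x - m) := by module
      have h2 := abs_le.1 (show |⟪w, A (z - m)⟫_ℝ| ≤ 2 from hz.2)
      change 10 ≤ |⟪w, A ((1 - s) • z + s • x - m)⟫_ℝ|
      rw [e, map_add, map_smul, map_smul, inner_add_right, real_inner_smul_right,
        real_inner_smul_right, hwx]
      refine le_trans ?_ (le_abs_self _)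
      nlinarith)
  have h2 : S.weights.real H ≤ 1 / 100 := by
    have := hA.measure_le_abs_inner_le hp w (t := 10) (by norm_num)
    rw [hw] at this
    refine (measureReal_mono inter_subset_right).trans (this.trans (by norm_num))
  have h3 : 3 / 4 ≤ S.weights.real G := by
    have h4 := hA.measure_le_abs_inner_le hp w (t := 2) (by norm_num)
    rw [hw] at h4
    have h5 : S.weights.real Gᶜ ≤ S.weights.real {z | 2 ≤ |⟪w, A (z - m)⟫_ℝ|} := by
      have hsub : Gᶜ ⊆ S.supportᶜ ∪ {z | 2 ≤ |⟪w, A (z - m)⟫_ℝ|} := by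
        intro z hz
        by_cases hzS : z ∈ S.support
        · right
          by_contra hc
          exact hz ⟨hzS, (not_le.1 (show ¬ 2 ≤ |⟪w, A (z - m)⟫_ℝ| from hc)).le⟩
        · left; exact hzS
      refine (measureReal_mono hsub).trans ((measureReal_union_le _ _).trans ?_)
      rw [measureReal_def, hp.null]
      simp
    have h6 := measureReal_add_measureReal_compl (μ := S.weights) hG
    simp only [probReal_univ] at h6
    linarith
  have h4 : (1 / 2 : ℝ) ≤ (1 - s) ^ n := by
    have := one_add_mul_le_pow (show -2 ≤ -s by linarith) n
    rw [← sub_eq_add_neg] at this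
    linarith
  have h5 : (1 / 36 : ℝ) ≤ Real.exp (-(s * B) - 2 * (3 / 2)) := by
    have h6 : Real.exp (-(7 / 2)) ≤ Real.exp (-(s * B) - 2 * (3 / 2)) :=
      Real.exp_le_exp.2 (by linarith)
    refine le_trans ?_ h6
    rw [Real.exp_neg, one_div]
    apply inv_anti₀ (Real.exp_pos _)
    have h7 : Real.exp (7 / 2) ^ 2 = Real.exp 1 ^ 7 := by
      rw [← Real.exp_nat_mul, ← Real.exp_nat_mul]; norm_num
    have h8 : Real.exp 1 ^ 7 ≤ 36 ^ 2 := by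
      calc Real.exp 1 ^ 7 ≤ 2.7182818286 ^ 7 := by
            gcongr; exact Real.exp_one_lt_d9.le
        _ ≤ 36 ^ 2 := by norm_num
    rw [← h7] at h8
    exact abs_le_of_sq_le_sq' h8 (by norm_num) |>.2
  have h6 : (1 / 2 : ℝ) * (1 / 36) * (3 / 4) ≤
      (1 - s) ^ n * Real.exp (-(s * B) - 2 * (3 / 2)) * S.weights.real G := by gcongr
  have h7 := h6.trans (h1.trans h2)
  norm_num at h7

end Far

/-! ### One step of exponential weights -/

section Step

variable {n : ℕ} {S : State n}

/-- The minimum of the score over the support. -/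
def State.minScore (S : State n) : ℝ := sInf (S.score '' S.support)

lemma State.Regular.minScore_le (hS : S.Regular) {x : E n} (hx : x ∈ S.support) :
    S.minScore ≤ S.score x := by
  have := hS.potential_nonneg hx
  simp only [State.potential] at this
  simp only [State.minScore]
  linarith

lemma partition_mul_exp (S : State n) :
    S.partition * Real.exp (-S.minScore) = ∫ z in S.support, Real.exp (-S.score z) := by
  unfold State.partition
  rw [← integral_mul_const]
  congr 1
  ext z
  rw [← Real.exp_add]
  congr 1
  simp only [State.potential, State.minScore]
  ring

/-- The product `Z e^(-min)` is the integral of `exp(-score)`, free of the normalizing shift, and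
therefore updates multiplicatively. -/
lemma State.Regular.partition_step (hS : S.Regular) {P : Params} {K : Set (E n)} {x : E n}
    {l : E n → ℝ} :
    (S.step P K x l).partition * Real.exp (-(S.step P K x l).minScore) =
      S.partition * Real.exp (-S.minScore) *
        ∫ z in S.focus, Real.exp (-(S.rate * S.lossEst P K x l z)) ∂S.weights := by
  have hZ := hS.partition_pos
  have hcancel : ∀ b c : ℝ, S.partition * b * (c / S.partition) = b * c := by
    intro b c
    field_simp
  rw [partition_mul_exp, support_step, hS.setIntegral_weights _ hS.focus_compact.measurableSet
    hS.focus_subset, hcancel, ← integral_const_mul]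
  congr 1
  ext z
  rw [score_step, ← Real.exp_add, ← Real.exp_add]
  congr 1
  simp only [State.potential, State.minScore]
  ring

lemma State.Regular.partition_le (hS : S.Regular) : S.partition ≤ volume.real S.support := by
  have h : volume.real S.support = ∫ _ in S.support, (1 : ℝ) := by simp
  rw [h]
  refine setIntegral_mono_on hS.integrableOn_exp ?_ hS.support_compact.measurableSet fun z hz => ?_
  · exact (integrable_const_iff.2 (Or.inr
      ⟨by simpa using hS.support_compact.measure_lt_top⟩))
  · exact Real.exp_le_one_iff.2 (neg_nonpos.2 (hS.potential_nonneg hz))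

lemma State.Regular.minScore_le_step (hS : S.Regular) {P : Params} {K : Set (E n)} {x : E n}
    {l : E n → ℝ} (h0 : ∀ y ∈ S.focus, 0 ≤ S.lossEst P K x l y) :
    S.minScore ≤ (S.step P K x l).minScore := by
  unfold State.minScore
  rw [support_step]
  refine le_csInf (hS.focus_nonempty.image _) ?_
  rintro _ ⟨y, hy, rfl⟩
  rw [score_step]
  have h1 := hS.minScore_le (hS.focus_subset hy)
  have h2 := mul_nonneg hS.rate_pos.le (h0 y hy)
  simp only [State.minScore] at h1
  linarith

/-- The partition function decreases by a bounded factor. -/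
lemma State.Regular.partition_step_ge (hS : S.Regular) {P : Params} {K : Set (E n)} {x : E n}
    {l : E n → ℝ}
    (h : ∀ y ∈ S.focus, S.lossEst P K x l y ∈ Icc (0 : ℝ) 2) :
    Real.exp (-(2 * S.rate)) * S.weights.real S.focus * S.partition ≤
      (S.step P K x l).partition := by
  have hp := hS.isLawOn
  have := hp.prob
  have hm := hS.minScore_le_step fun y hy => (h y hy).1
  have h1 := hS.partition_step (P := P) (K := K) (x := x) (l := l)
  have hc := continuous_lossEst S P K x l
  have h2 : Real.exp (-(2 * S.rate)) * S.weights.real S.focus ≤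
      ∫ z in S.focus, Real.exp (-(S.rate * S.lossEst P K x l z)) ∂S.weights := by
    have e : Real.exp (-(2 * S.rate)) * S.weights.real S.focus =
        ∫ _ in S.focus, Real.exp (-(2 * S.rate)) ∂S.weights := by
      rw [setIntegral_const, smul_eq_mul, mul_comm]
    rw [e]
    refine setIntegral_mono_on (integrable_const _) ?_ hS.focus_compact.measurableSet
      fun z hz => ?_
    · exact (hp.integrable (by fun_prop)).integrableOn
    · apply Real.exp_le_exp.2
      have := mul_le_mul_of_nonneg_left (h z hz).2 hS.rate_pos.le
      linarith
  have hZ := hS.partition_pos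
  set I := ∫ z in S.focus, Real.exp (-(S.rate * S.lossEst P K x l z)) ∂S.weights
  have h3 : (S.step P K x l).partition = S.partition *
      Real.exp ((S.step P K x l).minScore - S.minScore) * I := by
    have h4 : (S.step P K x l).partition = (S.step P K x l).partition *
        Real.exp (-(S.step P K x l).minScore) * Real.exp ((S.step P K x l).minScore) := by
      rw [mul_assoc, ← Real.exp_add]; simp
    rw [h4, h1, sub_eq_add_neg, Real.exp_add]
    ring
  rw [h3]
  have h5 : 1 ≤ Real.exp ((S.step P K x l).minScore - S.minScore) :=
    Real.one_le_exp (by linarith)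
  have h6 : 0 ≤ Real.exp (-(2 * S.rate)) * S.weights.real S.focus := by positivity
  calc Real.exp (-(2 * S.rate)) * S.weights.real S.focus * S.partition
      ≤ I * S.partition := by gcongr
    _ = S.partition * 1 * I := by ring
    _ ≤ _ := by
      have : 0 ≤ I := h6.trans h2
      gcongr

/-- `log Z + Q(x)`, the potential function in the analysis of exponential weights. -/
def State.level (S : State n) (x : E n) : ℝ := Real.log S.partition + S.potential x

lemma exp_neg_le_quadratic {u : ℝ} (hu : 0 ≤ u) : Real.exp (-u) ≤ 1 - u + u ^ 2 / 2 := by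
  have h1 := Real.quadratic_le_exp_of_nonneg hu
  rw [Real.exp_neg]
  have h2 : 0 < 1 + u + u ^ 2 / 2 := by positivity
  refine (inv_anti₀ h2 h1).trans ?_
  rw [inv_le_iff_one_le_mul₀ h2]
  nlinarith [pow_nonneg hu 4]

/-- The usual second-order bound on the exponential, with one addition: mass outside the focus
region suffers infinite loss and contributes all of itself to `1 - J`. Divided by a rate of at most
`1/2`, it pays for twice the dropped mass. -/
theorem State.Regular.exponential_weights_step (hS : S.Regular) {P : Params} {K : Set (E n)}
    {x : E n} {l : E n → ℝ} (hS' : (S.step P K x l).Regular)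
    (h : ∀ y ∈ S.focus, S.lossEst P K x l y ∈ Icc (0 : ℝ) 2) (hr : S.rate ≤ 1 / 2) {y : E n} :
    (∫ z in S.focus, S.lossEst P K x l z ∂S.weights) +
        2 * S.weights.real (S.support \ S.focus) - S.lossEst P K x l y ≤
      (S.level y - (S.step P K x l).level y) / S.rate + 2 * S.rate := by
  have hp := hS.isLawOn
  have := hp.prob
  have hη := hS.rate_pos
  have hc := continuous_lossEst S P K x l
  have hFm := hS.focus_compact.measurableSet
  set η := S.rate
  set I := ∫ z in S.focus, S.lossEst P K x l z ∂S.weights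
  set J := ∫ z in S.focus, Real.exp (-(η * S.lossEst P K x l z)) ∂S.weights
  have hw : S.weights.real (S.support \ S.focus) = 1 - S.weights.real S.focus := by
    have h1 := measureReal_sdiff (μ := S.weights) hS.focus_subset hFm
    rw [h1]
    congr 1
    have h2 := measureReal_add_measureReal_compl (μ := S.weights)
      hS.support_compact.measurableSet
    rw [probReal_univ, measureReal_def S.weights S.supportᶜ, hp.null] at h2
    simpa using h2
  have hle : IntegrableOn (S.lossEst P K x l) S.focus S.weights :=
    (hp.integrable hc).integrableOn
  have hJ : J ≤ S.weights.real S.focus - η * I + 2 * η ^ 2 := by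
    have h1 : J ≤ ∫ z in S.focus, (1 - η * S.lossEst P K x l z + 2 * η ^ 2) ∂S.weights := by
      refine setIntegral_mono_on (hp.integrable (by fun_prop)).integrableOn
        (hp.integrable (by fun_prop)).integrableOn hFm fun z hz => ?_
      have h2 := h z hz
      refine (exp_neg_le_quadratic (mul_nonneg hη.le h2.1)).trans ?_
      have h3 : (η * S.lossEst P K x l z) ^ 2 ≤ (η * 2) ^ 2 := by
        gcongr
        · exact mul_nonneg hη.le h2.1
        · exact h2.2
      linarith
    refine h1.trans ?_
    have hi1 : IntegrableOn (fun z => 1 - η * S.lossEst P K x l z) S.focus S.weights :=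
      (integrable_const _).sub (hle.const_mul η)
    rw [integral_add hi1 (integrable_const _), integral_sub (integrable_const _)
      (hle.const_mul η), integral_const_mul, setIntegral_const, setIntegral_const, smul_eq_mul,
      smul_eq_mul, mul_one]
    have : S.weights.real S.focus ≤ 1 := measureReal_le_one
    have : S.weights.real S.focus * (2 * η ^ 2) ≤ 1 * (2 * η ^ 2) := by gcongr
    simp only [I]
    linarith
  have hZ := hS.partition_pos
  have hZ' := hS'.partition_pos
  have h1 := hS.partition_step (P := P) (K := K) (x := x) (l := l)
  have hJ0 : 0 < J := by
    by_contra hcon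
    have h2 : S.partition * Real.exp (-S.minScore) * J ≤ 0 :=
      mul_nonpos_of_nonneg_of_nonpos (by positivity) (not_lt.1 hcon)
    have h3 := mul_pos hZ' (Real.exp_pos (-(S.step P K x l).minScore))
    linarith
  have h2 := congrArg Real.log h1
  rw [Real.log_mul hZ'.ne' (Real.exp_pos _).ne', Real.log_mul (by positivity) hJ0.ne',
    Real.log_mul hZ.ne' (Real.exp_pos _).ne', Real.log_exp, Real.log_exp] at h2
  have h3 := Real.log_le_sub_one_of_pos hJ0
  have h4 : S.level y - (S.step P K x l).level y = - Real.log J - η * S.lossEst P K x l y := by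
    simp only [State.level, State.potential]
    rw [score_step]
    simp only [State.minScore] at h2
    linarith
  rw [h4, hw, ← sub_le_iff_le_add, le_div_iff₀ hη]
  have hd : S.weights.real S.focus ≤ 1 := measureReal_le_one
  nlinarith

/-- The partition function is at least the volume of a small copy of the support. -/
lemma State.Close.partition_ge {V : E n → ℝ} {a : ℝ} (hS : S.Regular) (hcl : S.Close V a)
    {Λ : ℝ≥0} (hV : LipschitzWith Λ V) {d : ℝ} (hd : ∀ x ∈ S.support, ∀ y ∈ S.support, ‖x - y‖ ≤ d)
    {ρ : ℝ} (hρ0 : 0 < ρ) (hρ1 : ρ ≤ 1) :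
    ρ ^ n * Real.exp (-(2 * a + Λ * (ρ * d))) * volume.real S.support ≤ S.partition := by
  obtain ⟨z₀, hz₀, hpot⟩ := hS.exists_potential_eq_zero
  have hm := hS.support_compact.measurableSet
  set f : E n → ℝ := S.support.indicator fun z => Real.exp (-S.potential z)
  have hfi : Integrable f := (integrable_indicator_iff hm).2 hS.integrableOn_exp
  have hcv : ∫ z, f z = ρ ^ n * ∫ z, f (ρ • z + (1 - ρ) • z₀) := by
    have h1 := Measure.integral_comp_smul volume (fun z => f (z + (1 - ρ) • z₀)) ρ
    rw [integral_add_right_eq_self f ((1 - ρ) • z₀), finrank_euclideanSpace_fin, smul_eq_mul,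
      abs_of_nonneg (inv_nonneg.2 (pow_nonneg hρ0.le n))] at h1
    rw [h1, mul_inv_cancel_left₀ (pow_ne_zero _ hρ0.ne')]
  have hfi2 : Integrable fun z => f (ρ • z + (1 - ρ) • z₀) :=
    (hfi.comp_add_right ((1 - ρ) • z₀)).comp_smul hρ0.ne'
  have hpart : S.partition = ∫ z, f z := by
    rw [integral_indicator hm]; rfl
  have hvol : ∫ z, S.support.indicator (fun _ => Real.exp (-(2 * a + Λ * (ρ * d)))) z =
      volume.real S.support * Real.exp (-(2 * a + Λ * (ρ * d))) := by
    rw [integral_indicator hm, setIntegral_const, smul_eq_mul]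
  rw [hpart, hcv, mul_assoc, mul_comm (Real.exp _), ← hvol]
  refine mul_le_mul_of_nonneg_left ?_ (pow_nonneg hρ0.le n)
  refine integral_mono ?_ hfi2 fun z => ?_
  · exact (integrable_indicator_iff hm).2 (integrableOn_const
      hS.support_compact.measure_lt_top.ne)
  by_cases hz : z ∈ S.support
  swap
  · rw [indicator_of_notMem hz]
    exact indicator_nonneg (fun _ _ => (Real.exp_pos _).le) _
  have hw : ρ • z + (1 - ρ) • z₀ ∈ S.support :=
    hS.support_convex hz hz₀ hρ0.le (by linarith) (by ring)
  simp only [f]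
  rw [indicator_of_mem hz, indicator_of_mem hw]
  apply Real.exp_le_exp.2
  have h2 := abs_le.1 (hcl _ hz₀)
  have h3 := abs_le.1 (hcl _ hw)
  have h4 := (le_abs_self _).trans (hV.dist_le_mul (ρ • z + (1 - ρ) • z₀) z₀)
  have h5 : dist (ρ • z + (1 - ρ) • z₀) z₀ ≤ ρ * d := by
    rw [dist_eq_norm, show ρ • z + (1 - ρ) • z₀ - z₀ = ρ • (z - z₀) by module, norm_smul,
      Real.norm_of_nonneg hρ0.le]
    exact mul_le_mul_of_nonneg_left (hd z hz z₀ hz₀) hρ0.le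
  have h6 : (Λ : ℝ) * dist (ρ • z + (1 - ρ) • z₀) z₀ ≤ Λ * (ρ * d) := by gcongr
  simp only [State.potential] at hpot ⊢
  linarith

/-- The weights are concentrated on the new focus region. -/
lemma State.Regular.weights_focus_step {T : ℕ} (hn : 1 ≤ n) (hT : n < T) (hS : S.Regular)
    (K : Set (E n)) (x : E n) (l : E n → ℝ) :
    99 / 100 ≤ (S.step (params n T) K x l).weights.real (S.step (params n T) K x l).focus := by
  have hS' := hS.step hn hT K x l
  have := hS'.isLawOn.prob
  rcases step_cases (S := S) (params n T) K x l with ⟨h1, -, -⟩ | ⟨h1, -, -⟩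
  · rw [h1, ← support_step (S := S) (params n T) K x l]
    have h2 := measureReal_add_measureReal_compl (μ := (S.step (params n T) K x l).weights)
      hS'.support_compact.measurableSet
    rw [probReal_univ, measureReal_def _ (_)ᶜ, hS'.isLawOn.null] at h2
    simp only [ENNReal.toReal_zero, add_zero] at h2
    rw [h2]
    norm_num
  · rw [h1]
    nth_rewrite 1 [← support_step (S := S) (params n T) K x l]
    exact (hS'.one_half_lt_weights_ellipsoid (div_sq_alpha_lt hn hT le_rfl)
      (alpha_pos hn hT)).le

end Step

/-! ### Truncated losses -/

/-- The extension equals the loss in the interior of `K` and is nonnegative everywhere. The frontier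
of a convex set is null, so the Gaussian average does not see it. -/
lemma kernelAdjoint_trunc_le {n : ℕ} {p : Measure (E n)} {A : E n ≃L[ℝ] E n} {P : Params}
    {K : Set (E n)} {Λ : ℝ≥0} {l : E n → ℝ} (hK : IsBody K) (hl : IsLoss K Λ l)
    (hA : Whitens A p) (hP : 0 < coreVar P n) (hlam : P.lam < 1) (G : Set (E n)) (hG : G ⊆ K)
    (y : E n) : 0 ≤ kernelAdjoint P p (G.indicator l) y ∧
      kernelAdjoint P p (G.indicator l) y ≤ kernelAdjoint P p (lossExt K l) y := by
  have h0 : ∀ x, 0 ≤ G.indicator l x :=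
    indicator_nonneg fun x hx => (hl.mem x (hG hx)).1
  refine ⟨kernelAdjoint_nonneg hA hP hlam h0 y, ?_⟩
  rw [kernelAdjoint_eq hA hP hlam, kernelAdjoint_eq hA hP hlam]
  refine integral_mono_of_nonneg (Filter.Eventually.of_forall fun z => h0 _)
    (integrable_kernelAdjoint (lossExt_lipschitz hK hl) P A (mean p) y) ?_
  have hr : (1 - P.lam) * Real.sqrt (coreVar P n) ≠ 0 :=
    mul_ne_zero (by linarith) (Real.sqrt_pos.2 hP).ne'
  have hnull : volume (frontier K) = 0 := hK.convex.addHaar_frontier volume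
  have h1 : volume ((fun z : E n => ((1 - P.lam) * Real.sqrt (coreVar P n)) • z) ⁻¹'
      ((A.symm : E n → E n) ⁻¹' ((fun u => u + ((1 - P.lam) • mean p + P.lam • y)) ⁻¹'
        frontier K))) = 0 := by
    rw [Measure.addHaar_preimage_smul _ hr, Measure.addHaar_preimage_continuousLinearEquiv,
      measure_preimage_add_right, hnull]
    simp
  have hac : stdGaussian (E n) ≪ volume := by
    rw [← withDensity_stdDensity]
    exact withDensity_absolutelyContinuous _ _
  filter_upwards [compl_mem_ae_iff.2 (hac h1)] with z hz
  set u := (1 - P.lam) • (mean p + Real.sqrt (coreVar P n) • A.symm z) + P.lam • y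
  have hu : u ∉ frontier K := by
    intro hu
    apply hz
    simp only [mem_preimage, map_smul]
    convert hu using 1
    simp only [u]
    module
  by_cases huG : u ∈ G
  · rw [indicator_of_mem huG]
    have hui : u ∈ interior K := by
      by_contra hc
      exact hu ⟨subset_closure (hG huG), hc⟩
    exact (lossExt_eq_of_mem_interior hK hl hui).ge
  · rw [indicator_of_notMem huG]
    exact lossExt_nonneg hl u

/-! ### The run of the algorithm -/

/-- The standing assumptions on the body and on the losses. -/
structure IsGame (n T : ℕ) (K : Set (E n)) (R : Transcript n) : Prop where
  pos : 1 ≤ n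
  lt : n < T
  body : IsBody K
  diam : ∀ x ∈ K, ∀ y ∈ K, ‖x - y‖ ≤ T
  loss : ∀ t, IsLoss K (T : ℝ≥0) (R.loss t)

namespace IsGame

variable {n T : ℕ} {K : Set (E n)} {R : Transcript n}

lemma state_succ {P : Params} {t : ℕ} (ht : 1 ≤ t) : state P K R (t + 1) =
    (state P K R t).step P K (R.action t) (R.loss t) := by
  obtain ⟨t, rfl⟩ := Nat.exists_eq_add_of_le' ht
  rfl

lemma regular (g : IsGame n T K R) (t : ℕ) : (state (params n T) K R t).Regular := by
  induction t with
  | zero => exact State.Regular.init g.pos g.lt g.body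
  | succ t ih =>
    rcases Nat.eq_zero_or_pos t with rfl | ht
    · exact ih
    · rw [state_succ ht]
      exact ih.step g.pos g.lt _ _ _

lemma near (g : IsGame n T K R) (t : ℕ) : (state (params n T) K R t).Near (params n T) := by
  match t with
  | 0 => exact State.near_init g.pos g.lt g.body
  | 1 => exact State.near_init g.pos g.lt g.body
  | t + 2 =>
    rw [state_succ (by omega)]
    exact (g.regular (t + 1)).near_step g.pos g.lt _ _ _

lemma lossEst_mem (g : IsGame n T K R) (t : ℕ) {y : E n} (hy : y ∈ focus (params n T) K R t) :
    lossEst (params n T) K R t y ∈ Icc (0 : ℝ) 2 :=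
  (g.regular t).lossEst_mem g.pos g.lt (g.near t) (g.loss t) _ hy

lemma support_succ {P : Params} {t : ℕ} (ht : 1 ≤ t) :
    (state P K R (t + 1)).support = focus P K R t := by
  rw [state_succ ht, support_step]; rfl

lemma focus_succ_subset {P : Params} (t : ℕ) : focus P K R (t + 1) ⊆ focus P K R t := by
  rcases Nat.eq_zero_or_pos t with rfl | ht
  · exact subset_rfl
  · unfold focus
    rw [state_succ ht]
    rcases step_cases (S := state P K R t) P K (R.action t) (R.loss t) with ⟨h, -, -⟩ | ⟨h, -, -⟩
    · exact h.le
    · rw [h]; exact inter_subset_left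

lemma focus_antitone {P : Params} : Antitone (focus P K R) :=
  antitone_nat_of_succ_le focus_succ_subset

lemma focus_subset {P : Params} (t : ℕ) : focus P K R t ⊆ K :=
  focus_antitone (Nat.zero_le t)

lemma support_subset {P : Params} (t : ℕ) : (state P K R t).support ⊆ K := by
  match t with
  | 0 => exact subset_rfl
  | 1 => exact subset_rfl
  | t + 2 => rw [support_succ (by omega)]; exact focus_subset _

lemma score_succ {P : Params} (t : ℕ) (y : E n) : (state P K R (t + 1)).score y =
    ∑ s ∈ Finset.Icc 1 t, rate P K R s * lossEst P K R s y := by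
  induction t with
  | zero => simp [state, State.init]
  | succ t ih =>
    rw [Finset.sum_Icc_succ_top (by omega), ← ih, state_succ (by omega), score_step]
    rfl

lemma rate_pos (g : IsGame n T K R) (t : ℕ) : 0 < rate (params n T) K R t :=
  (g.regular t).rate_pos

lemma exists_whitens (g : IsGame n T K R) (t : ℕ) :
    ∃ A, Whitens A (weights (params n T) K R t) := (g.regular t).isLawOn.exists_whitens

lemma smoothedLoss_nonneg (g : IsGame n T K R) (t : ℕ) (y : E n) :
    0 ≤ smoothedLoss (params n T) K R t y := by
  obtain ⟨A, hA⟩ := g.exists_whitens t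
  exact kernelAdjoint_nonneg hA (coreVar_pos g.pos g.lt) (lam_lt_one g.pos g.lt)
    (lossExt_nonneg (g.loss t)) y

lemma smoothedLoss_convex (g : IsGame n T K R) (t : ℕ) :
    ConvexOn ℝ univ (smoothedLoss (params n T) K R t) := by
  obtain ⟨A, hA⟩ := g.exists_whitens t
  exact kernelAdjoint_convex hA (coreVar_pos g.pos g.lt) (lam_lt_one g.pos g.lt)
    (lossExt_convex g.body (g.loss t)) (lossExt_lipschitz g.body (g.loss t))

lemma smoothedLoss_lipschitz (g : IsGame n T K R) (t : ℕ) :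
    LipschitzWith ((params n T).lam.toNNReal * T) (smoothedLoss (params n T) K R t) := by
  obtain ⟨A, hA⟩ := g.exists_whitens t
  exact kernelAdjoint_lipschitz hA (coreVar_pos g.pos g.lt) (lam_lt_one g.pos g.lt)
    (lam_pos g.pos g.lt).le (lossExt_lipschitz g.body (g.loss t))

lemma convexOn_sum_mul {c : ℕ → ℝ} {f : ℕ → E n → ℝ} (s : Finset ℕ) (hc : ∀ i ∈ s, 0 ≤ c i)
    (hf : ∀ i ∈ s, ConvexOn ℝ univ (f i)) :
    ConvexOn ℝ univ fun y => ∑ i ∈ s, c i * f i y := by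
  refine ⟨convex_univ, fun x _ y _ a b ha hb hab => ?_⟩
  simp only [smul_eq_mul, Finset.mul_sum]
  rw [← Finset.sum_add_distrib]
  refine Finset.sum_le_sum fun i hi => ?_
  have := mul_le_mul_of_nonneg_left ((hf i hi).2 (mem_univ x) (mem_univ y) ha hb hab) (hc i hi)
  simp only [smul_eq_mul] at this
  linarith

lemma lipschitz_sum_mul {c : ℕ → ℝ} {f : ℕ → E n → ℝ} {s : Finset ℕ} {Λ : ℝ≥0} {C : ℝ}
    (hc : ∀ i ∈ s, 0 ≤ c i) (hf : ∀ i ∈ s, LipschitzWith Λ (f i)) (hC : ∑ i ∈ s, c i ≤ C) :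
    LipschitzWith (C.toNNReal * Λ) fun y => ∑ i ∈ s, c i * f i y := by
  have hC0 : 0 ≤ C := (Finset.sum_nonneg hc).trans hC
  refine LipschitzWith.of_le_add_mul _ fun x y => ?_
  rw [NNReal.coe_mul, Real.coe_toNNReal _ hC0]
  have h1 : ∑ i ∈ s, c i * f i x ≤ ∑ i ∈ s, (c i * f i y + c i * (Λ * dist x y)) := by
    refine Finset.sum_le_sum fun i hi => ?_
    have h2 := (le_abs_self _).trans ((hf i hi).dist_le_mul x y)
    have := mul_le_mul_of_nonneg_left h2 (hc i hi)
    linarith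
  rw [Finset.sum_add_distrib, ← Finset.sum_mul] at h1
  have h3 : (∑ i ∈ s, c i) * (Λ * dist x y) ≤ C * (Λ * dist x y) := by gcongr
  linarith

lemma cumLoss_convex (g : IsGame n T K R) (t : ℕ) :
    ConvexOn ℝ univ (cumLoss (params n T) K R t) := by
  have := convexOn_sum_mul (c := fun _ => 1) (Finset.Icc 1 t) (fun _ _ => zero_le_one)
    fun s _ => g.smoothedLoss_convex s
  simp only [one_mul] at this
  exact this

lemma cumLoss_lipschitz (g : IsGame n T K R) (t : ℕ) :
    LipschitzWith ((t : ℝ).toNNReal * ((params n T).lam.toNNReal * T))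
      (cumLoss (params n T) K R t) := by
  have := lipschitz_sum_mul (c := fun _ => 1) (s := Finset.Icc 1 t) (C := t)
    (fun _ _ => zero_le_one) (fun s _ => g.smoothedLoss_lipschitz s) (by simp)
  simp only [one_mul] at this
  exact this

lemma cumLoss_continuous (g : IsGame n T K R) (t : ℕ) :
    Continuous (cumLoss (params n T) K R t) := (g.cumLoss_lipschitz t).continuous

lemma cumLoss_succ {P : Params} (t : ℕ) (y : E n) :
    cumLoss P K R (t + 1) y = cumLoss P K R t y + smoothedLoss P K R (t + 1) y :=
  Finset.sum_Icc_succ_top (by omega) _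

lemma cumLoss_mono (g : IsGame n T K R) (y : E n) :
    Monotone fun t => cumLoss (params n T) K R t y :=
  monotone_nat_of_le_succ fun t => by
    rw [cumLoss_succ]; linarith [g.smoothedLoss_nonneg (t + 1) y]

end IsGame

/-- `∑_{s ≤ t} η_s K[p_s]^* ℓ_s^ext`. -/
def weightedLoss {n : ℕ} (P : Params) (K : Set (E n)) (R : Transcript n) (t : ℕ) (y : E n) : ℝ :=
  ∑ s ∈ Finset.Icc 1 t, rate P K R s * smoothedLoss P K R s y

namespace IsGame

variable {n T : ℕ} {K : Set (E n)} {R : Transcript n}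

lemma weightedLoss_convex (g : IsGame n T K R) (t : ℕ) :
    ConvexOn ℝ univ (weightedLoss (params n T) K R t) :=
  convexOn_sum_mul _ (fun s _ => (g.rate_pos s).le) fun s _ => g.smoothedLoss_convex s

lemma weightedLoss_lipschitz (g : IsGame n T K R) {t : ℕ} {C : ℝ}
    (hC : ∑ s ∈ Finset.Icc 1 t, rate (params n T) K R s ≤ C) :
    LipschitzWith (C.toNNReal * ((params n T).lam.toNNReal * T))
      (weightedLoss (params n T) K R t) :=
  lipschitz_sum_mul (fun s _ => (g.rate_pos s).le) (fun s _ => g.smoothedLoss_lipschitz s) hC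

lemma weightedLoss_continuous (g : IsGame n T K R) (t : ℕ) :
    Continuous (weightedLoss (params n T) K R t) :=
  (g.weightedLoss_lipschitz le_rfl).continuous

lemma good_zero : Good (params n T) K R 0 := by
  simp [Good, Delta1, Delta2, Delta3, Delta4, cumEst, cumLoss]

/-- The support of the state after round `t` is the focus region of round `t`. -/
lemma support_succ' {P : Params} (t : ℕ) : (state P K R (t + 1)).support = focus P K R t := by
  rcases Nat.eq_zero_or_pos t with rfl | ht
  · rfl
  · exact support_succ ht

lemma close (t : ℕ) (hg : Good (params n T) K R t) :
    (state (params n T) K R (t + 1)).Close (weightedLoss (params n T) K R t) 1 := by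
  intro y hy
  rw [support_succ'] at hy
  have := hg.2.2.1 y hy
  rw [Delta3] at this
  rw [score_succ, weightedLoss, ← Finset.sum_sub_distrib]
  simpa only [mul_sub] using this

lemma spread (g : IsGame n T K R) {t : ℕ} (hg : Good (params n T) K R t)
    {A : E n ≃L[ℝ] E n} (hA : Whitens A (weights (params n T) K R (t + 1))) :
    Spread A (weights (params n T) K R (t + 1)) (6 * (params n T).eps) :=
  (close t hg).spread (g.regular _) (g.weightedLoss_convex t) (g.weightedLoss_continuous t) hA
    (by have := eps_le (n := n) (T := T); linarith)

lemma smoothedLoss_le_two (g : IsGame n T K R) {t : ℕ} (hg : Good (params n T) K R t) {y : E n}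
    (hy : y ∈ K) : smoothedLoss (params n T) K R (t + 1) y ≤ 2 := by
  obtain ⟨A, hA⟩ := g.exists_whitens (t + 1)
  have hr := g.regular (t + 1)
  have h1 : ∀ x ∈ K, lossExt K (R.loss (t + 1)) x ≤ 1 := fun x hx =>
    (lossExt_le g.body (g.loss _) hx).trans ((g.loss _).mem x hx).2
  exact kernelAdjoint_le_two g.pos g.lt hr.isLawOn hA hr.support_convex
    (fun x hx y hy => g.diam x (support_subset _ hx) y (support_subset _ hy)) (g.spread hg hA)
    (lossExt_convex g.body (g.loss _)) (lossExt_lipschitz g.body (g.loss _))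
    (fun x hx => h1 x (support_subset _ hx)) (h1 y hy)

/-- One round beyond the last good one: the new term is the rate times a difference of two numbers
in `[0, 2]`, hence at most `1/2`. -/
lemma close_succ (g : IsGame n T K R) {t : ℕ} (hg : Good (params n T) K R t)
    (hr : rate (params n T) K R (t + 1) ≤ 1 / 4) :
    (state (params n T) K R (t + 2)).Close (weightedLoss (params n T) K R (t + 1)) (3 / 2) := by
  intro y hy
  rw [support_succ'] at hy
  have h1 := close t hg y (by rw [support_succ']; exact focus_succ_subset t hy)
  rw [score_succ] at h1 ⊢
  unfold weightedLoss at h1 ⊢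
  rw [Finset.sum_Icc_succ_top (by omega), Finset.sum_Icc_succ_top (by omega)]
  have h2 := g.lossEst_mem (t + 1) hy
  have h3 := g.smoothedLoss_nonneg (t + 1) y
  have h4 := g.smoothedLoss_le_two hg (focus_subset _ hy)
  have h5 := g.rate_pos (t + 1)
  rw [abs_le] at h1 ⊢
  have h6 : |rate (params n T) K R (t + 1) * (lossEst (params n T) K R (t + 1) y -
      smoothedLoss (params n T) K R (t + 1) y)| ≤ 1 / 4 * 2 := by
    rw [abs_mul, abs_of_pos h5]
    have : |lossEst (params n T) K R (t + 1) y - smoothedLoss (params n T) K R (t + 1) y| ≤ 2 :=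
      abs_le.2 ⟨by linarith [h2.1], by linarith [h2.2]⟩
    gcongr
  rw [abs_le, mul_sub] at h6
  constructor <;> linarith [h1.1, h1.2, h6.1, h6.2]

/-- The mean of the smoothed loss under the weights. -/
lemma lam_mul_sub_le (g : IsGame n T K R) {t : ℕ} (hg : Good (params n T) K R t) {y : E n}
    (hy : y ∈ K) :
    (params n T).lam * ((∫ x, smoothedLoss (params n T) K R (t + 1) x
        ∂(weights (params n T) K R (t + 1))) - R.loss (t + 1) y) ≤
      (∫ x, smoothedLoss (params n T) K R (t + 1) x ∂(weights (params n T) K R (t + 1))) -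
        smoothedLoss (params n T) K R (t + 1) y + 1 / T := by
  obtain ⟨A, hA⟩ := g.exists_whitens (t + 1)
  have hr := g.regular (t + 1)
  have h1 := KernelBandit.lam_mul_sub_le g.pos g.lt hr.isLawOn hA hr.support_convex
    (fun x hx y hy => g.diam x (support_subset _ hx) y (support_subset _ hy)) (g.spread hg hA)
    (lossExt_convex g.body (g.loss (t + 1))) (lossExt_lipschitz g.body (g.loss (t + 1))) y
  refine le_trans ?_ h1
  have h2 := lossExt_le g.body (g.loss (t + 1)) hy
  refine mul_le_mul_of_nonneg_left ?_ (lam_pos g.pos g.lt).le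
  exact sub_le_sub_left h2 _

end IsGame

/-! ### From the regret to the estimated regret -/

section Sums

variable {n : ℕ} (P : Params) (K : Set (E n)) (R : Transcript n)

/-- `⟨p_t, K[p_t]^* ℓ_t^ext⟩`. -/
def meanLoss (t : ℕ) : ℝ := ∫ y, smoothedLoss P K R t y ∂(weights P K R t)

/-- The mean over `F_t` of the estimate `ℓ̃_t` under `p_t`. -/
def meanEst (t : ℕ) : ℝ := ∫ y in focus P K R t, lossEst P K R t y ∂(weights P K R t)

/-- The mass `p_t(F_{t-1} \ F_t)` that is dropped in round `t`. -/
def dropMass (t : ℕ) : ℝ :=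
  (weights P K R t).real ((state P K R t).support \ (state P K R t).focus)

end Sums

namespace IsGame

variable {n T : ℕ} {K : Set (E n)} {R : Transcript n}

lemma meanEst_nonneg (g : IsGame n T K R) (t : ℕ) : 0 ≤ meanEst (params n T) K R t := by
  refine setIntegral_nonneg (g.regular t).focus_compact.measurableSet fun y hy => ?_
  exact (g.lossEst_mem t hy).1

lemma dropMass_nonneg (P : Params) (t : ℕ) : 0 ≤ dropMass P K R t := measureReal_nonneg

/-- The estimates say nothing about the dropped set, so the smoothed loss there is replaced by its
upper bound 2. -/
lemma meanLoss_le_add (g : IsGame n T K R) {t : ℕ} (hg : Good (params n T) K R t) :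
    meanLoss (params n T) K R (t + 1) ≤
      (∫ y in focus (params n T) K R (t + 1), smoothedLoss (params n T) K R (t + 1) y
        ∂(weights (params n T) K R (t + 1))) + 2 * dropMass (params n T) K R (t + 1) := by
  have hr := g.regular (t + 1)
  have hp : IsLawOn (weights (params n T) K R (t + 1)) (state (params n T) K R (t + 1)).support :=
    hr.isLawOn
  have := hp.prob
  have hc := (g.smoothedLoss_lipschitz (t + 1)).continuous
  have hi : Integrable (smoothedLoss (params n T) K R (t + 1)) (weights (params n T) K R (t + 1)) :=
    hp.integrable hc
  have hSm := hr.support_compact.measurableSet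
  have hFm := hr.focus_compact.measurableSet
  have h1 : meanLoss (params n T) K R (t + 1) =
      ∫ y in (state (params n T) K R (t + 1)).support, smoothedLoss (params n T) K R (t + 1) y
        ∂(weights (params n T) K R (t + 1)) := by
    unfold meanLoss
    rw [Measure.restrict_eq_self_of_ae_mem hp.ae_mem]
  have h2 := integral_inter_add_sdiff hFm (hi.integrableOn (s :=
    (state (params n T) K R (t + 1)).support))
  rw [inter_eq_right.2 hr.focus_subset] at h2
  rw [h1, ← h2]
  refine add_le_add_right ?_ _
  have h3 : ∫ y in (state (params n T) K R (t + 1)).support \ (state (params n T) K R (t + 1)).focus,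
      smoothedLoss (params n T) K R (t + 1) y ∂(weights (params n T) K R (t + 1)) ≤
      ∫ y in (state (params n T) K R (t + 1)).support \ (state (params n T) K R (t + 1)).focus,
        (2 : ℝ) ∂(weights (params n T) K R (t + 1)) := by
    refine setIntegral_mono_on hi.integrableOn (integrable_const _) (hSm.diff hFm) fun y hy => ?_
    exact g.smoothedLoss_le_two hg (support_subset _ hy.1)
  rw [setIntegral_const, smul_eq_mul, mul_comm] at h3
  exact h3

lemma eta1_pos (g : IsGame n T K R) : 0 < (params n T).eta1 := g.rate_pos 0

lemma sum_meanLoss_le (g : IsGame n T K R) {M : ℕ} (hg : ∀ t ≤ M, Good (params n T) K R t) :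
    ∑ t ∈ Finset.Icc 1 M, meanLoss (params n T) K R t ≤
      ∑ t ∈ Finset.Icc 1 M, (meanEst (params n T) K R t + 2 * dropMass (params n T) K R t) +
        1 / (params n T).eta1 := by
  have hη := g.eta1_pos
  have h4 := (hg M le_rfl).2.2.2
  rw [Delta4, mul_comm, ← le_div_iff₀ hη] at h4
  have h5 := (abs_le.1 h4).1
  have h6 : ∑ s ∈ Finset.Icc 1 M, ∫ y in focus (params n T) K R s,
      (lossEst (params n T) K R s y - smoothedLoss (params n T) K R s y)
        ∂(weights (params n T) K R s) = ∑ s ∈ Finset.Icc 1 M, (meanEst (params n T) K R s -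
        ∫ y in focus (params n T) K R s, smoothedLoss (params n T) K R s y
          ∂(weights (params n T) K R s)) := by
    refine Finset.sum_congr rfl fun s _ => ?_
    have hp := (g.regular s).isLawOn
    have hc1 : Continuous (lossEst (params n T) K R s) := continuous_lossEst _ _ _ _ _
    have hc2 := (g.smoothedLoss_lipschitz s).continuous
    exact integral_sub (hp.integrable hc1).integrableOn (hp.integrable hc2).integrableOn
  rw [h6, Finset.sum_sub_distrib] at h5
  have h7 : ∑ t ∈ Finset.Icc 1 M, meanLoss (params n T) K R t ≤ ∑ t ∈ Finset.Icc 1 M,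
      ((∫ y in focus (params n T) K R t, smoothedLoss (params n T) K R t y
        ∂(weights (params n T) K R t)) + 2 * dropMass (params n T) K R t) := by
    refine Finset.sum_le_sum fun t ht => ?_
    obtain ⟨h1, h2⟩ := Finset.mem_Icc.1 ht
    obtain ⟨t, rfl⟩ := Nat.exists_eq_add_of_le' h1
    exact g.meanLoss_le_add (hg t (by omega))
  rw [Finset.sum_add_distrib] at h7 ⊢
  linarith

lemma sum_loss_le (g : IsGame n T K R) {M : ℕ} (hg : Good (params n T) K R M) :
    ∑ t ∈ Finset.Icc 1 M, R.loss t (R.action t) ≤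
      ∑ t ∈ Finset.Icc 1 M, meanLoss (params n T) K R t + 1 / (params n T).eta1 := by
  have hη := g.eta1_pos
  have h1 := hg.1
  rw [Delta1, mul_comm, ← le_div_iff₀ hη] at h1
  have h2 := (abs_le.1 h1).1
  rw [Finset.sum_sub_distrib] at h2
  have h3 : ∑ s ∈ Finset.Icc 1 M, ∫ y, kernelAdjoint (params n T) (weights (params n T) K R s)
      (truncLoss (params n T) K R s) y ∂(weights (params n T) K R s) ≤
      ∑ t ∈ Finset.Icc 1 M, meanLoss (params n T) K R t := by
    refine Finset.sum_le_sum fun s _ => ?_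
    obtain ⟨A, hA⟩ := g.exists_whitens s
    have hp := (g.regular s).isLawOn
    have h4 := kernelAdjoint_trunc_le g.body (g.loss s) hA (coreVar_pos g.pos g.lt)
      (lam_lt_one g.pos g.lt) (typicalAt (params n T) K R s) inter_subset_left
    exact integral_mono_of_nonneg (Filter.Eventually.of_forall fun y => (h4 y).1)
      (hp.integrable (g.smoothedLoss_lipschitz s).continuous)
      (Filter.Eventually.of_forall fun y => (h4 y).2)
  linarith

/-- The regret is controlled by the regret against the smoothed losses. -/
lemma regret_le (g : IsGame n T K R) {M : ℕ} (hM : M ≤ T)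
    (hg : ∀ t ≤ M, Good (params n T) K R t) {y : E n} (hy : y ∈ K) :
    ∑ t ∈ Finset.Icc 1 M, (R.loss t (R.action t) - R.loss t y) ≤
      (∑ t ∈ Finset.Icc 1 M, meanLoss (params n T) K R t - cumLoss (params n T) K R M y + 1) /
        (params n T).lam + 1 / (params n T).eta1 := by
  have hl := lam_pos g.pos g.lt
  have h1 := g.sum_loss_le (hg M le_rfl)
  rw [Finset.sum_sub_distrib]
  have h2 : (params n T).lam * (∑ t ∈ Finset.Icc 1 M, meanLoss (params n T) K R t -
      ∑ t ∈ Finset.Icc 1 M, R.loss t y) ≤ ∑ t ∈ Finset.Icc 1 M, meanLoss (params n T) K R t -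
        cumLoss (params n T) K R M y + 1 := by
    have h3 : ∑ t ∈ Finset.Icc 1 M, (params n T).lam * (meanLoss (params n T) K R t -
        R.loss t y) ≤ ∑ t ∈ Finset.Icc 1 M, (meanLoss (params n T) K R t -
          smoothedLoss (params n T) K R t y + 1 / T) := by
      refine Finset.sum_le_sum fun t ht => ?_
      obtain ⟨ht1, ht2⟩ := Finset.mem_Icc.1 ht
      obtain ⟨t, rfl⟩ := Nat.exists_eq_add_of_le' ht1
      exact g.lam_mul_sub_le (hg t (by omega)) hy
    rw [← Finset.mul_sum, Finset.sum_sub_distrib, Finset.sum_add_distrib,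
      Finset.sum_sub_distrib] at h3
    have h4 : ∑ t ∈ Finset.Icc 1 M, (1 : ℝ) / T ≤ 1 := by
      have hT : (0 : ℝ) < T := by exact_mod_cast (by have := g.lt; omega : 0 < T)
      have hM' : (M : ℝ) ≤ T := by exact_mod_cast hM
      simp only [Finset.sum_const, Nat.card_Icc, nsmul_eq_mul, Nat.add_sub_cancel]
      rw [mul_one_div, div_le_one hT]
      exact hM'
    unfold cumLoss
    linarith
  rw [mul_comm, ← le_div_iff₀ hl] at h2
  linarith

/-! ### Exponential weights with increasing rates -/

lemma cumEst_succ {P : Params} (t : ℕ) (y : E n) :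
    cumEst P K R (t + 1) y = cumEst P K R t y + lossEst P K R (t + 1) y :=
  Finset.sum_Icc_succ_top (by omega) _

lemma sum_meanEst_le (g : IsGame n T K R) {M : ℕ}
    (hr : ∀ t, 1 ≤ t → t ≤ M → rate (params n T) K R t ≤ 1 / 2) (x : E n) :
    ∑ t ∈ Finset.Icc 1 M, (meanEst (params n T) K R t + 2 * dropMass (params n T) K R t) -
        cumEst (params n T) K R M x ≤
      ∑ t ∈ Finset.Icc 1 M, ((state (params n T) K R t).level x -
          (state (params n T) K R (t + 1)).level x) * (rate (params n T) K R t)⁻¹ +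
        ∑ t ∈ Finset.Icc 1 M, 2 * rate (params n T) K R t := by
  unfold cumEst
  rw [← Finset.sum_sub_distrib, ← Finset.sum_add_distrib]
  refine Finset.sum_le_sum fun t ht => ?_
  obtain ⟨h1, h2⟩ := Finset.mem_Icc.1 ht
  have hR' := g.regular (t + 1)
  rw [state_succ h1] at hR' ⊢
  have := (g.regular t).exponential_weights_step (y := x) hR'
    (fun y hy => g.lossEst_mem t hy) (hr t h1 h2)
  rw [div_eq_mul_inv] at this
  exact this

end IsGame

/-- Summation by parts for a nonnegative sequence against a nonincreasing one. -/
lemma sum_sub_mul_le {b c : ℕ → ℝ} {M : ℕ} (hb : ∀ t, 1 ≤ t → t ≤ M → 0 ≤ b (t + 1))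
    (hc : ∀ t, 1 ≤ t → t ≤ M → c (t + 1) ≤ c t) :
    ∑ t ∈ Finset.Icc 1 M, (b t - b (t + 1)) * c t + b (M + 1) * c (M + 1) ≤ b 1 * c 1 := by
  induction M with
  | zero => simp
  | succ M ih =>
    have h := ih (fun t h1 h2 => hb t h1 (by omega)) fun t h1 h2 => hc t h1 (by omega)
    rw [Finset.sum_Icc_succ_top (by omega)]
    have := mul_le_mul_of_nonneg_left (hc (M + 1) (by omega) le_rfl) (hb (M + 1) (by omega) le_rfl)
    linarith

/-- Keeps the gain of one strict decrease of `c`, which is what makes the regret negative at a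
restart. -/
lemma sum_sub_mul_le_of_mem {b c : ℕ → ℝ} {M s : ℕ} (hb : ∀ t, 1 ≤ t → t ≤ M → 0 ≤ b (t + 1))
    (hc : ∀ t, 1 ≤ t → t ≤ M → c (t + 1) ≤ c t) (hs1 : 1 ≤ s) (hs : s ≤ M) :
    ∑ t ∈ Finset.Icc 1 M, (b t - b (t + 1)) * c t + b (M + 1) * c (M + 1) ≤
      b 1 * c 1 - b (s + 1) * (c s - c (s + 1)) := by
  induction M with
  | zero => omega
  | succ M ih =>
    rw [Finset.sum_Icc_succ_top (by omega)]
    rcases Nat.lt_or_ge M s with h | h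
    · obtain rfl : s = M + 1 := by omega
      have := sum_sub_mul_le (M := M) (fun t h1 h2 => hb t h1 (by omega))
        fun t h1 h2 => hc t h1 (by omega)
      linarith
    · have := ih (fun t h1 h2 => hb t h1 (by omega)) (fun t h1 h2 => hc t h1 (by omega)) h
      have := mul_le_mul_of_nonneg_left (hc (M + 1) (by omega) le_rfl)
        (hb (M + 1) (by omega) le_rfl)
      linarith

/-! ### The learning rates -/

section Rates

variable {n T : ℕ}

lemma inv_eta1 (n T : ℕ) : ((params n T).eta1)⁻¹ =
    20 * Real.exp 1 ^ 2 * Real.sqrt (n * T * Real.log T) := by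
  simp [params]

lemma inv_eta1_sq (n T : ℕ) : ((params n T).eta1)⁻¹ ^ 2 =
    400 * Real.exp 1 ^ 4 * (n * T * Real.log T) := by
  rw [inv_eta1, mul_pow, Real.sq_sqrt (by positivity)]
  ring

lemma le_mul_log (hn : 1 ≤ n) (hT : n < T) : (0.69 : ℝ) ≤ n * Real.log T := by
  have h1 := log_two_le_log hn hT
  have h2 : (1 : ℝ) ≤ n := by exact_mod_cast hn
  nlinarith

lemma twentyThousand_mul_le (hn : 1 ≤ n) (hT : n < T) :
    20000 * (T * (n * Real.log T)) ≤ ((params n T).eta1)⁻¹ ^ 2 := by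
  have h1 := Real.exp_one_gt_d9
  have h2 : (50 : ℝ) ≤ Real.exp 1 ^ 4 := by
    calc (50 : ℝ) ≤ 2.7182818283 ^ 4 := by norm_num
      _ ≤ Real.exp 1 ^ 4 := by gcongr
  have h3 := le_mul_log hn hT
  have h4 : 0 ≤ (T : ℝ) * (n * Real.log T) := by positivity
  rw [inv_eta1_sq, show (n : ℝ) * T * Real.log T = T * (n * Real.log T) by ring]
  nlinarith

lemma hundred_le_inv_eta1 (hn : 1 ≤ n) (hT : n < T) : 100 ≤ ((params n T).eta1)⁻¹ := by
  have h1 := twentyThousand_mul_le hn hT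
  have h2 := le_mul_log hn hT
  have hT2 : (2 : ℝ) ≤ T := by exact_mod_cast (by omega : 2 ≤ T)
  have h3 : 0 ≤ ((params n T).eta1)⁻¹ := by
    rw [inv_eta1]; positivity
  have h4 : (100 : ℝ) ^ 2 ≤ ((params n T).eta1)⁻¹ ^ 2 := by nlinarith
  exact abs_le_of_sq_le_sq' h4 h3 |>.2

lemma gamma_eq (n T : ℕ) : (params n T).gamma = Real.log 2 / (5 * (n * Real.log T)) := by
  simp only [params, Real.logb]
  rw [one_div, mul_div_assoc', inv_div, mul_assoc]

lemma gamma_le (hn : 1 ≤ n) (hT : n < T) : (params n T).gamma ≤ 1 / 4 := by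
  have h1 := le_mul_log hn hT
  have h2 := Real.log_two_lt_d9
  rw [gamma_eq, div_le_iff₀ (by linarith)]
  linarith

/-- The constant that bounds the deficit of the potential. -/
def slack (n T : ℕ) : ℝ := 6 * (n * Real.log T) + 4

lemma slack_pos (hn : 1 ≤ n) (hT : n < T) : 0 < slack n T := by
  have h1 := le_mul_log hn hT
  unfold slack
  linarith

/-- The parameter `α` is so large that one far point pays for everything. -/
lemma slack_le_alpha_mul_gamma (hn : 1 ≤ n) (hT : n < T) :
    100 * (slack n T + 20) ≤ (params n T).alpha * (params n T).gamma := by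
  have h1 := le_mul_log hn hT
  have h2 := Real.log_two_gt_d9
  have h3 := alpha_ge' (n := n) (T := T)
  have hg := gamma_pos hn hT
  rw [← mul_pow] at h3
  rw [gamma_eq] at hg ⊢
  unfold slack
  set X := (n : ℝ) * Real.log T
  have h4 : 3 * 10 ^ 12 * X ^ 2 * (Real.log 2 / (5 * X)) ≤
      (params n T).alpha * (Real.log 2 / (5 * X)) := by gcongr
  have h5 : 3 * 10 ^ 12 * X ^ 2 * (Real.log 2 / (5 * X)) = 6 * 10 ^ 11 * Real.log 2 * X := by
    field_simp
    norm_num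
  rw [h5] at h4
  nlinarith

end Rates

/-! ### Growth of the rates and shrinkage of the focus regions -/

namespace IsGame

variable {n T : ℕ} {K : Set (E n)} {R : Transcript n}

lemma volume_pos (g : IsGame n T K R) (t : ℕ) : 0 < volume.real (focus (params n T) K R t) := by
  have h := (g.regular t).volume_focus
  exact ENNReal.toReal_pos h (g.regular t).focus_compact.measure_lt_top.ne

lemma step_dichotomy (g : IsGame n T K R) {t : ℕ} (ht : 1 ≤ t) :
    (focus (params n T) K R (t + 1) = focus (params n T) K R t ∧
      rate (params n T) K R (t + 1) = rate (params n T) K R t) ∨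
    (focus (params n T) K R (t + 1) = focus (params n T) K R t ∩
        ellipsoid (weights (params n T) K R (t + 1)) (params n T).alpha ∧
      rate (params n T) K R (t + 1) = (1 + (params n T).gamma) * rate (params n T) K R t ∧
      volume.real (focus (params n T) K R (t + 1)) ≤
        volume.real (focus (params n T) K R t) / 2) := by
  have hfin : volume (state (params n T) K R t).focus ≠ ∞ :=
    (g.regular t).focus_compact.measure_lt_top.ne
  unfold focus rate weights
  rw [state_succ ht]
  rcases step_cases (S := state (params n T) K R t) (params n T) K (R.action t) (R.loss t) with
    ⟨h1, h2, -⟩ | ⟨h1, h2, h3⟩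
  · exact Or.inl ⟨h1, h2⟩
  · refine Or.inr ⟨h1, h2, ?_⟩
    have h4 := ENNReal.toReal_mono (ENNReal.div_ne_top hfin (by norm_num)) h3
    rw [ENNReal.toReal_div] at h4
    exact h4

lemma rate_le_succ (g : IsGame n T K R) (t : ℕ) :
    rate (params n T) K R t ≤ rate (params n T) K R (t + 1) := by
  have hγ := gamma_pos g.pos g.lt
  have hr := g.rate_pos t
  rcases Nat.eq_zero_or_pos t with rfl | ht
  · exact le_rfl
  · rcases g.step_dichotomy ht with ⟨-, h⟩ | ⟨-, h, -⟩ <;> rw [h]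
    nlinarith

lemma rate_succ_le (g : IsGame n T K R) (t : ℕ) :
    rate (params n T) K R (t + 1) ≤ (1 + (params n T).gamma) * rate (params n T) K R t := by
  have hγ := gamma_pos g.pos g.lt
  have hr := g.rate_pos t
  have h0 : rate (params n T) K R t ≤ (1 + (params n T).gamma) * rate (params n T) K R t := by
    nlinarith
  rcases Nat.eq_zero_or_pos t with rfl | ht
  · exact h0
  · rcases g.step_dichotomy ht with ⟨-, h⟩ | ⟨-, h, -⟩ <;> rw [h]
    exact h0

/-- `c` counts the cuts made so far; it ties the growth of the rate to the loss of volume. -/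
lemma exists_count (g : IsGame n T K R) (t : ℕ) : ∃ c : ℕ,
    rate (params n T) K R t = (params n T).eta1 * (1 + (params n T).gamma) ^ c ∧
      volume.real (focus (params n T) K R t) ≤ (1 / 2) ^ c * volume.real K := by
  induction t with
  | zero => exact ⟨0, by simp [rate, state, State.init], by simp [focus, state, State.init]⟩
  | succ t ih =>
    obtain ⟨c, h1, h2⟩ := ih
    rcases Nat.eq_zero_or_pos t with rfl | ht
    · exact ⟨c, h1, h2⟩
    · rcases g.step_dichotomy ht with ⟨h3, h4⟩ | ⟨-, h4, h5⟩
      · exact ⟨c, h4.trans h1, h3 ▸ h2⟩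
      · refine ⟨c + 1, ?_, h5.trans ?_⟩
        · rw [h4, h1]; ring
        · rw [pow_succ]; linarith

/-! ### The position of the minimum -/

/-- The cumulative loss is much larger off `F_{t+1}` than at a point of `F_{t+1}`. -/
def _root_.KernelBandit.Inside {n : ℕ} (P : Params) (K : Set (E n)) (R : Transcript n) (t : ℕ) :
    Prop :=
  ∃ z ∈ focus P K R (t + 1), ∀ y ∈ K \ focus P K R (t + 1),
    cumLoss P K R t z + 2 * P.eta1⁻¹ ≤ cumLoss P K R t y

/-- The cumulative loss is much larger on `F_{t+1}` than at the minimum of the cumulative estimate,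
which is not in `F_{t+1}`. -/
def _root_.KernelBandit.Outside {n : ℕ} (P : Params) (K : Set (E n)) (R : Transcript n) (t : ℕ) :
    Prop :=
  ∃ z ∈ focus P K R t \ focus P K R (t + 1),
    (∀ y ∈ focus P K R t, cumEst P K R t z ≤ cumEst P K R t y) ∧
    ∀ y ∈ focus P K R (t + 1), cumLoss P K R t z + 2 * P.eta1⁻¹ ≤ cumLoss P K R t y

lemma cumEst_continuous (P : Params) (t : ℕ) : Continuous (cumEst P K R t) := by
  unfold cumEst
  exact continuous_finsetSum _ fun s _ => continuous_lossEst _ _ _ _ _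

lemma abs_cumEst_sub_le (g : IsGame n T K R) {t : ℕ} (hg : Good (params n T) K R t) {y : E n}
    (hy : y ∈ focus (params n T) K R t) :
    |cumEst (params n T) K R t y - cumLoss (params n T) K R t y| ≤ ((params n T).eta1)⁻¹ := by
  have h := hg.2.1 y hy
  have hη := g.eta1_pos
  rw [Delta2, mul_comm, ← le_div_iff₀ hη, one_div] at h
  exact h

/-- Let `z` minimize the cumulative estimate. Without a restart the cumulative loss on the relevant
part of the frontier exceeds its value at `z` by more than `2/η₁`; by `le_of_lt_on_frontier` its low
points lie all inside or all outside the new focus region, depending on where `z` is. -/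
lemma inside_or_outside (g : IsGame n T K R) {t : ℕ} (hg : Good (params n T) K R t)
    (hnr : ¬ Restart (params n T) K R t) :
    Inside (params n T) K R t ∨ Outside (params n T) K R t := by
  have hη := g.eta1_pos
  have hr := g.regular t
  have hr' := g.regular (t + 1)
  obtain ⟨z, hz, hmin⟩ := hr.focus_compact.exists_isMinOn hr.focus_nonempty
    (cumEst_continuous (params n T) t).continuousOn
  have hmin' : ∀ y ∈ focus (params n T) K R t,
      cumEst (params n T) K R t z ≤ cumEst (params n T) K R t y := fun y hy => hmin hy
  have hinf : sInf (cumEst (params n T) K R t '' focus (params n T) K R t) =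
      cumEst (params n T) K R t z := by
    refine IsLeast.csInf_eq ⟨mem_image_of_mem _ hz, ?_⟩
    rintro _ ⟨y, hy, rfl⟩
    exact hmin' y hy
  -- The restart threshold `β = 4` gives a gap `4/η₁` for the estimates; replacing them by the true
  -- cumulative losses at `b` and at `z` costs `1/η₁` each.
  have hb : ∀ b ∈ frontier (focus (params n T) K R (t + 1)) ∩ interior K,
      cumLoss (params n T) K R t z + 2 * ((params n T).eta1)⁻¹ < cumLoss (params n T) K R t b := by
    intro b hb
    have h1 : 4 * ((params n T).eta1)⁻¹ <
        cumEst (params n T) K R t b - cumEst (params n T) K R t z := by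
      by_contra hc
      refine hnr ⟨b, hb, ?_⟩
      rw [hinf]
      have h2 := mul_le_mul_of_nonneg_left (not_lt.1 hc) hη.le
      refine h2.trans (le_of_eq ?_)
      change _ = (4 : ℝ)
      field_simp
    have hbF : b ∈ focus (params n T) K R t :=
      focus_succ_subset t (hr'.focus_closed.frontier_subset hb.1)
    have h3 := abs_le.1 (g.abs_cumEst_sub_le hg hbF)
    have h4 := abs_le.1 (g.abs_cumEst_sub_le hg hz)
    linarith [h3.1, h3.2, h4.1, h4.2]
  have key := fun (w : E n) (hw : w ∈ focus (params n T) K R (t + 1))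
      (hw2 : cumLoss (params n T) K R t w <
        cumLoss (params n T) K R t z + 2 * ((params n T).eta1)⁻¹) =>
    le_of_lt_on_frontier g.body.convex hr'.focus_closed hr'.focus_convex
      (focus_subset (P := params n T) (t + 1)) hr'.interior_focus_nonempty
      ((g.cumLoss_convex t).subset (subset_univ _) g.body.convex) (g.cumLoss_continuous t) hb
      hw hw2
  have hpos : 0 < 2 * ((params n T).eta1)⁻¹ := by positivity
  by_cases hzF : z ∈ focus (params n T) K R (t + 1)
  · exact Or.inl ⟨z, hzF, key z hzF (by linarith)⟩
  · refine Or.inr ⟨z, ⟨hz, hzF⟩, hmin', fun y hy => ?_⟩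
    by_contra hc
    have := key y hy (not_le.1 hc) z ⟨focus_subset t hz, hzF⟩
    linarith

/-- If the minimum is inside the focus region then the focus region is not small. -/
lemma volume_ge_of_inside (g : IsGame n T K R) {t : ℕ} (ht : t ≤ T)
    (hin : Inside (params n T) K R t) :
    (1 / (T : ℝ) ^ 3) ^ n * volume.real K ≤ volume.real (focus (params n T) K R (t + 1)) := by
  obtain ⟨z, hz, hz2⟩ := hin
  have hT2 : (2 : ℝ) ≤ T := by exact_mod_cast (by have := g.pos; have := g.lt; omega : 2 ≤ T)
  have ht' : (t : ℝ) ≤ T := by exact_mod_cast ht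
  have hl0 := lam_pos g.pos g.lt
  have hl1 := lam_lt_one g.pos g.lt
  have hη := hundred_le_inv_eta1 g.pos g.lt
  have hzK := focus_subset (P := params n T) _ hz
  -- The cumulative loss has Lipschitz constant at most `T²` and `K` has diameter at most `T`, so on
  -- the copy of `K` shrunk by `T^(-3)` around `z` it varies by at most 1, less than `2/η₁`.
  set ρ : ℝ := 1 / (T : ℝ) ^ 3
  have hρ0 : 0 < ρ := by positivity
  have hρ1 : ρ ≤ 1 := by
    rw [div_le_one (by positivity)]
    exact one_le_pow₀ (by linarith)
  have hsub : AffineMap.homothety z ρ '' K ⊆ focus (params n T) K R (t + 1) := by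
    rintro _ ⟨k, hk, rfl⟩
    have e : AffineMap.homothety z ρ k = ρ • k + (1 - ρ) • z := by
      simp only [AffineMap.homothety_apply, vsub_eq_sub, vadd_eq_add]
      module
    rw [e]
    by_contra hc
    have hwK : ρ • k + (1 - ρ) • z ∈ K :=
      g.body.convex hk hzK hρ0.le (by linarith) (by ring)
    have h1 := hz2 _ ⟨hwK, hc⟩
    have h2 := (le_abs_self _).trans
      ((g.cumLoss_lipschitz t).dist_le_mul (ρ • k + (1 - ρ) • z) z)
    have h3 : dist (ρ • k + (1 - ρ) • z) z ≤ ρ * T := by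
      rw [dist_eq_norm, show ρ • k + (1 - ρ) • z - z = ρ • (k - z) by module, norm_smul,
        Real.norm_of_nonneg hρ0.le]
      exact mul_le_mul_of_nonneg_left (g.diam k hk z hzK) hρ0.le
    have h4 : (((t : ℝ).toNNReal * ((params n T).lam.toNNReal * T) : ℝ≥0) : ℝ) *
        dist (ρ • k + (1 - ρ) • z) z ≤ 1 := by
      rw [NNReal.coe_mul, NNReal.coe_mul, Real.coe_toNNReal _ (Nat.cast_nonneg t),
        Real.coe_toNNReal _ hl0.le, NNReal.coe_natCast]
      calc (t : ℝ) * ((params n T).lam * T) * dist (ρ • k + (1 - ρ) • z) z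
          ≤ T * (1 * T) * (ρ * T) := by gcongr
        _ = 1 := by simp only [ρ]; field_simp
    linarith
  have h1 : volume.real (AffineMap.homothety z ρ '' K) = ρ ^ n * volume.real K := by
    rw [measureReal_def, Measure.addHaar_image_homothety, finrank_euclideanSpace_fin,
      ENNReal.toReal_mul, ENNReal.toReal_ofReal (abs_nonneg _),
      abs_of_nonneg (pow_nonneg hρ0.le n)]
    rfl
  rw [← h1]
  exact measureReal_mono hsub (g.regular (t + 1)).focus_compact.measure_lt_top.ne

end IsGame

/-! ### The rounds before the minimum leaves the focus region -/

/-- The estimates are accurate, and the minimum is in the focus region, before round `m`. -/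
structure Tame (n T : ℕ) (K : Set (E n)) (R : Transcript n) (m : ℕ) : Prop where
  le : m ≤ T
  good : ∀ t < m, Good (params n T) K R t
  inside : ∀ t, 1 ≤ t → t < m → Inside (params n T) K R t

namespace IsGame

variable {n T : ℕ} {K : Set (E n)} {R : Transcript n}

lemma volume_ge (g : IsGame n T K R) {m : ℕ} (h : Tame n T K R m) {t : ℕ} (ht : t ≤ m) :
    (1 / (T : ℝ) ^ 3) ^ n * volume.real K ≤ volume.real (focus (params n T) K R t) := by
  have hT1 : (1 : ℝ) ≤ T := by exact_mod_cast (by have := g.lt; omega : 1 ≤ T)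
  have h1 : (1 / (T : ℝ) ^ 3) ^ n * volume.real K ≤ volume.real K := by
    refine mul_le_of_le_one_left measureReal_nonneg (pow_le_one₀ (by positivity) ?_)
    rw [div_le_one (by positivity)]
    exact one_le_pow₀ hT1
  match t with
  | 0 => exact h1
  | 1 => exact h1
  | t + 2 =>
    have := h.le
    exact g.volume_ge_of_inside (by omega) (h.inside (t + 1) (by omega) (by omega))

/-- Every cut halves the volume, which stays above `T^(-3n) Vol(K)`. Hence there are at most `3 n
log₂ T` cuts, and `(1 + γ)^c ≤ e^(3/5) ≤ 2`. -/
lemma rate_le_two_mul (g : IsGame n T K R) {m : ℕ} (h : Tame n T K R m) {t : ℕ} (ht : t ≤ m) :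
    rate (params n T) K R t ≤ 2 * (params n T).eta1 := by
  obtain ⟨c, h1, h2⟩ := g.exists_count t
  have hη := g.eta1_pos
  have hK := g.volume_pos 0
  have hT0 : (0 : ℝ) < T := by exact_mod_cast (by have := g.lt; omega : 0 < T)
  have hγ := gamma_pos g.pos g.lt
  have hX := le_mul_log g.pos g.lt
  have h3 : (1 / (T : ℝ) ^ 3) ^ n ≤ (1 / 2) ^ c := by
    have h4 := (g.volume_ge h ht).trans h2
    exact le_of_mul_le_mul_right h4 hK
  have h4 : (2 : ℝ) ^ c ≤ (T : ℝ) ^ (3 * n) := by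
    rw [div_pow, div_pow, one_pow, one_pow, ← pow_mul,
      one_div_le_one_div (by positivity) (by positivity)] at h3
    exact h3
  have h5 : c * Real.log 2 ≤ 3 * (n * Real.log T) := by
    have h6 := Real.log_le_log (by positivity) h4
    rw [Real.log_pow, Real.log_pow] at h6
    push_cast at h6
    linarith
  have h6 : (1 + (params n T).gamma) ^ c ≤ 2 := by
    have h7 : (1 + (params n T).gamma) ^ c ≤ Real.exp ((params n T).gamma * c) := by
      have : 1 + (params n T).gamma ≤ Real.exp (params n T).gamma := by
        have := Real.add_one_le_exp (params n T).gamma; linarith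
      calc (1 + (params n T).gamma) ^ c ≤ Real.exp (params n T).gamma ^ c := by gcongr
        _ = _ := by rw [← Real.exp_nat_mul, mul_comm]
    have h8 : (params n T).gamma * c ≤ 3 / 5 := by
      rw [gamma_eq, div_mul_eq_mul_div, div_le_iff₀ (by linarith)]
      linarith
    refine h7.trans ((Real.exp_le_exp.2 h8).trans ?_)
    have h9 : Real.exp (3 / 5) ^ 5 ≤ 2 ^ 5 := by
      rw [← Real.exp_nat_mul]
      norm_num
      have e3 : Real.exp 3 = Real.exp 1 ^ 3 := by rw [← Real.exp_nat_mul]; norm_num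
      rw [e3]
      calc Real.exp 1 ^ 3 ≤ 2.7182818286 ^ 3 := by
            gcongr; exact Real.exp_one_lt_d9.le
        _ ≤ 32 := by norm_num
    exact le_of_pow_le_pow_left₀ (by norm_num) (by norm_num) h9
  rw [h1]
  nlinarith

lemma rate_succ_le' (g : IsGame n T K R) {m : ℕ} (h : Tame n T K R m) {t : ℕ} (ht : t ≤ m) :
    rate (params n T) K R (t + 1) ≤ 5 / 2 * (params n T).eta1 := by
  have h1 := g.rate_succ_le t
  have h2 := g.rate_le_two_mul h ht
  have h3 := gamma_le g.pos g.lt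
  have h4 := g.rate_pos t
  nlinarith

lemma eta1_le (g : IsGame n T K R) : (params n T).eta1 ≤ 1 / 100 := by
  have h := hundred_le_inv_eta1 g.pos g.lt
  have hη := g.eta1_pos
  rw [le_inv_comm₀ (by norm_num) hη] at h
  linarith

lemma sum_rate_le (g : IsGame n T K R) {m : ℕ} (h : Tame n T K R m) {M : ℕ} (hM : M ≤ m) :
    ∑ t ∈ Finset.Icc 1 M, rate (params n T) K R t ≤ 2 * (params n T).eta1 * T := by
  have h1 : ∑ t ∈ Finset.Icc 1 M, rate (params n T) K R t ≤
      ∑ t ∈ Finset.Icc 1 M, 2 * (params n T).eta1 :=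
    Finset.sum_le_sum fun t ht =>
      g.rate_le_two_mul h ((Finset.mem_Icc.1 ht).2.trans hM)
  have hMT : (M : ℝ) ≤ T := by exact_mod_cast hM.trans h.le
  have hη := g.eta1_pos
  refine h1.trans ?_
  simp only [Finset.sum_const, Nat.card_Icc, nsmul_eq_mul, Nat.add_sub_cancel]
  nlinarith

lemma four_mul_eta1_mul_le (g : IsGame n T K R) :
    4 * (params n T).eta1 * T ≤ ((params n T).eta1)⁻¹ := by
  have h1 := twentyThousand_mul_le g.pos g.lt
  have h2 := le_mul_log g.pos g.lt
  have hη := g.eta1_pos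
  have hT0 : (0 : ℝ) ≤ T := Nat.cast_nonneg T
  have h3 : 4 * (T : ℝ) ≤ ((params n T).eta1)⁻¹ ^ 2 := by nlinarith
  have h4 := mul_le_mul_of_nonneg_left h3 hη.le
  have h5 : (params n T).eta1 * ((params n T).eta1)⁻¹ ^ 2 = ((params n T).eta1)⁻¹ := by
    field_simp
  linarith

/-- The potential functions along tame rounds are close to `1`. -/
lemma close_of_tame (g : IsGame n T K R) {m : ℕ} (h : Tame n T K R m) {t : ℕ} (ht : t ≤ m) :
    (state (params n T) K R (t + 1)).Close (weightedLoss (params n T) K R t) (3 / 2) := by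
  match t with
  | 0 =>
    intro y hy
    have := close 0 (good_zero (R := R) (K := K) (n := n) (T := T)) y hy
    linarith
  | t + 1 =>
    refine g.close_succ (h.good t (by omega)) ?_
    have := g.rate_le_two_mul h ht
    have := g.eta1_le
    linarith

/-- One factor `T^(-3n)` is the volume of the focus region relative to `K`; a second comes from
shrinking the support until the weighted loss varies by at most 1. Closeness costs another `e^(-3)`.
Together they make up `slack`. -/
lemma log_partition_ge (g : IsGame n T K R) {m : ℕ} (h : Tame n T K R m) {t : ℕ} (ht : t ≤ m) :
    Real.log (volume.real K) ≤
      Real.log (state (params n T) K R (t + 1)).partition + slack n T := by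
  have hT1 : (1 : ℝ) ≤ T := by exact_mod_cast (by have := g.lt; omega : 1 ≤ T)
  have hl0 := lam_pos g.pos g.lt
  have hl1 := lam_lt_one g.pos g.lt
  have hη := g.eta1_pos
  have hη2 := g.eta1_le
  have hK : 0 < volume.real K := g.volume_pos 0
  set ρ : ℝ := 1 / (T : ℝ) ^ 3
  have hρ0 : 0 < ρ := by positivity
  have hρ1 : ρ ≤ 1 := by
    rw [div_le_one (by positivity)]
    exact one_le_pow₀ hT1
  have h1 := (g.close_of_tame h ht).partition_ge (g.regular (t + 1))
    (g.weightedLoss_lipschitz (g.sum_rate_le h ht)) (d := T)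
    (fun x hx y hy => g.diam x (support_subset _ hx) y (support_subset _ hy)) hρ0 hρ1
  rw [support_succ'] at h1
  have h2 : (((2 * (params n T).eta1 * T).toNNReal * ((params n T).lam.toNNReal * T) : ℝ≥0) : ℝ) *
      (ρ * T) ≤ 1 := by
    rw [NNReal.coe_mul, NNReal.coe_mul, Real.coe_toNNReal _ (by positivity),
      Real.coe_toNNReal _ hl0.le, NNReal.coe_natCast]
    calc 2 * (params n T).eta1 * T * ((params n T).lam * T) * (ρ * T)
        ≤ 1 * T * (1 * T) * (ρ * T) := by gcongr; linarith
      _ = 1 := by simp only [ρ]; field_simp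
  have h3 : ρ ^ n * Real.exp (-4) * (ρ ^ n * volume.real K) ≤
      (state (params n T) K R (t + 1)).partition := by
    refine le_trans ?_ h1
    have h4 := g.volume_ge h ht
    gcongr
    linarith
  have h4 := Real.log_le_log (by positivity) h3
  have h5 : Real.log (ρ ^ n) = -(3 * (n * Real.log T)) := by
    simp only [ρ]
    rw [Real.log_pow, one_div, Real.log_inv, Real.log_pow]
    push_cast
    ring
  rw [Real.log_mul (by positivity) (by positivity), Real.log_mul (by positivity) (by positivity),
    Real.log_mul (by positivity) hK.ne', h5, Real.log_exp] at h4
  unfold slack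
  linarith

/-- The level of a point of the support, normalized to be nonnegative. -/
def _root_.KernelBandit.excess {n : ℕ} (T : ℕ) (K : Set (E n)) (R : Transcript n) (x : E n)
    (t : ℕ) : ℝ :=
  (state (params n T) K R t).level x - Real.log (volume.real K) + slack n T

lemma excess_one (g : IsGame n T K R) (x : E n) : excess T K R x 1 = slack n T := by
  have hpot : ∀ y, (state (params n T) K R 1).potential y = 0 := by
    intro y
    have h1 : (state (params n T) K R 1).score '' (state (params n T) K R 1).support = {0} := by
      have : (state (params n T) K R 1).score = fun _ => 0 := rfl
      rw [this, (g.regular 1).support_nonempty.image_const]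
    simp only [State.potential, h1, csInf_singleton]
    simp [state, State.init]
  have hpart : (state (params n T) K R 1).partition = volume.real K := by
    unfold State.partition
    simp only [hpot]
    simp [state, State.init]
  simp [excess, State.level, hpart, hpot]

lemma potential_le_excess (g : IsGame n T K R) {m : ℕ} (h : Tame n T K R m) {t : ℕ} (ht : t ≤ m)
    (x : E n) : (state (params n T) K R (t + 1)).potential x ≤ excess T K R x (t + 1) := by
  have := g.log_partition_ge h ht
  simp only [excess, State.level]
  linarith

lemma excess_nonneg (g : IsGame n T K R) {m : ℕ} (h : Tame n T K R m) {t : ℕ} (ht : t ≤ m)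
    {x : E n} (hx : x ∈ focus (params n T) K R t) : 0 ≤ excess T K R x (t + 1) := by
  refine le_trans ?_ (g.potential_le_excess h ht x)
  apply (g.regular (t + 1)).potential_nonneg
  rwa [support_succ']

lemma sum_meanEst_le_excess (g : IsGame n T K R) {m : ℕ} (h : Tame n T K R m) {M : ℕ}
    (hM : M ≤ m) (x : E n) :
    ∑ t ∈ Finset.Icc 1 M, (meanEst (params n T) K R t + 2 * dropMass (params n T) K R t) -
        cumEst (params n T) K R M x ≤
      ∑ t ∈ Finset.Icc 1 M, (excess T K R x t - excess T K R x (t + 1)) *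
        (rate (params n T) K R t)⁻¹ + ((params n T).eta1)⁻¹ := by
  have hη := g.eta1_le
  have h1 := g.sum_meanEst_le (M := M) (fun t _ ht => by
    have := g.rate_le_two_mul h (ht.trans hM); linarith) x
  have h2 := g.sum_rate_le h hM
  have h3 := g.four_mul_eta1_mul_le
  have h4 : ∀ t, excess T K R x t - excess T K R x (t + 1) =
      (state (params n T) K R t).level x - (state (params n T) K R (t + 1)).level x := by
    intro t; simp only [excess]; ring
  simp only [h4]
  rw [← Finset.mul_sum] at h1
  linarith

lemma rate_inv_succ_le (g : IsGame n T K R) (t : ℕ) :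
    (rate (params n T) K R (t + 1))⁻¹ ≤ (rate (params n T) K R t)⁻¹ :=
  inv_anti₀ (g.rate_pos t) (g.rate_le_succ t)

/-- The regret of exponential weights. -/
lemma exponential_weights_le (g : IsGame n T K R) {m : ℕ} (h : Tame n T K R m) {M : ℕ}
    (hM : M ≤ m) {x : E n} (hx : x ∈ focus (params n T) K R M) :
    ∑ t ∈ Finset.Icc 1 M, (meanEst (params n T) K R t + 2 * dropMass (params n T) K R t) ≤
      cumEst (params n T) K R M x + (slack n T + 1) * ((params n T).eta1)⁻¹ -
        excess T K R x (M + 1) * (rate (params n T) K R (M + 1))⁻¹ := by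
  have h1 := g.sum_meanEst_le_excess h hM x
  have h2 := sum_sub_mul_le (b := excess T K R x) (c := fun t => (rate (params n T) K R t)⁻¹)
    (M := M) (fun t _ ht => g.excess_nonneg h (ht.trans hM) (focus_antitone ht hx))
    (fun t _ _ => g.rate_inv_succ_le t)
  rw [g.excess_one] at h2
  have h3 : rate (params n T) K R 1 = (params n T).eta1 := rfl
  simp only [h3] at h2
  linarith

lemma exponential_weights_le_of_mem (g : IsGame n T K R) {m : ℕ} (h : Tame n T K R m) {M : ℕ}
    (hM : M ≤ m) {x : E n} (hx : x ∈ focus (params n T) K R M) {s : ℕ} (hs : 1 ≤ s)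
    (hsM : s ≤ M) :
    ∑ t ∈ Finset.Icc 1 M, (meanEst (params n T) K R t + 2 * dropMass (params n T) K R t) ≤
      cumEst (params n T) K R M x + (slack n T + 1) * ((params n T).eta1)⁻¹ -
        excess T K R x (s + 1) * ((rate (params n T) K R s)⁻¹ -
          (rate (params n T) K R (s + 1))⁻¹) := by
  have h1 := g.sum_meanEst_le_excess h hM x
  have h2 := sum_sub_mul_le_of_mem (b := excess T K R x)
    (c := fun t => (rate (params n T) K R t)⁻¹)
    (M := M) (fun t _ ht => g.excess_nonneg h (ht.trans hM) (focus_antitone ht hx))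
    (fun t _ _ => g.rate_inv_succ_le t) hs hsM
  rw [g.excess_one] at h2
  have h3 : rate (params n T) K R 1 = (params n T).eta1 := rfl
  simp only [h3] at h2
  have h4 := mul_nonneg (g.excess_nonneg h hM hx) (inv_nonneg.2 (g.rate_pos (M + 1)).le)
  linarith

/-- A cut through a point makes the excess of the point large. -/
lemma excess_ge_of_far (g : IsGame n T K R) {m : ℕ} (h : Tame n T K R m) {t : ℕ} (ht : t ≤ m)
    {A : E n ≃L[ℝ] E n} (hA : Whitens A (weights (params n T) K R (t + 1))) {x : E n}
    (hx : x ∈ focus (params n T) K R t)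
    (hfar : (params n T).alpha ≤ ‖A (x - mean (weights (params n T) K R (t + 1)))‖) :
    (params n T).alpha / 25 ≤ (state (params n T) K R (t + 1)).potential x :=
  (g.close_of_tame h ht).le_potential g.pos g.lt (g.regular (t + 1)) (g.weightedLoss_convex t) hA
    (by rwa [support_succ']) hfar

/-- Competitors outside the focus region need no separate treatment: by `Inside`, some point of the
region does at least as well. -/
lemma exists_focus_le (g : IsGame n T K R) {m : ℕ} (h : Tame n T K R m) {t : ℕ} (ht : t < m)
    {y : E n} (hy : y ∈ K) :
    ∃ z ∈ focus (params n T) K R (t + 1),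
      cumLoss (params n T) K R t z ≤ cumLoss (params n T) K R t y := by
  rcases Nat.eq_zero_or_pos t with rfl | ht0
  · exact ⟨y, hy, le_rfl⟩
  by_cases hyF : y ∈ focus (params n T) K R (t + 1)
  · exact ⟨y, hyF, le_rfl⟩
  obtain ⟨z, hz, hz2⟩ := h.inside t ht0 ht
  have := hz2 y ⟨hy, hyF⟩
  have hη := inv_pos.2 g.eta1_pos
  exact ⟨z, hz, by linarith⟩

/-- The estimated regret in the absence of a restart. -/
lemma sum_meanLoss_sub_le (g : IsGame n T K R) {M : ℕ} (h : Tame n T K R (M + 1)) {y : E n}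
    (hy : y ∈ K) :
    ∑ t ∈ Finset.Icc 1 M, meanLoss (params n T) K R t - cumLoss (params n T) K R M y ≤
      (slack n T + 3) * ((params n T).eta1)⁻¹ := by
  obtain ⟨z, hz, hzy⟩ := g.exists_focus_le h (Nat.lt_succ_self M) hy
  have hzM := focus_succ_subset M hz
  have h1 := g.sum_meanLoss_le (M := M) fun t ht => h.good t (by omega)
  have h2 := g.exponential_weights_le h (Nat.le_succ M) hzM
  have h3 := (abs_le.1 (g.abs_cumEst_sub_le (h.good M (Nat.lt_succ_self M)) hzM)).2
  have h4 := mul_nonneg (g.excess_nonneg h (Nat.le_succ M) hzM)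
    (inv_nonneg.2 (g.rate_pos (M + 1)).le)
  rw [one_div] at h1
  linarith

/-! ### A restart certifies negative regret -/

/-- The frontier of an intersection lies in the union of the frontiers. Tracing back through the
cuts, a frontier point interior to `K` is on the boundary of one of the ellipsoids. -/
lemma exists_cut_of_mem_frontier (g : IsGame n T K R) {x : E n} (hxK : x ∈ interior K) (t : ℕ)
    (hx : x ∈ frontier (focus (params n T) K R (t + 1))) :
    ∃ s, 1 ≤ s ∧ s ≤ t ∧
      rate (params n T) K R (s + 1) = (1 + (params n T).gamma) * rate (params n T) K R s ∧
      ∃ A, Whitens A (weights (params n T) K R (s + 1)) ∧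
        (params n T).alpha ≤ ‖A (x - mean (weights (params n T) K R (s + 1)))‖ := by
  induction t with
  | zero => exact absurd hxK hx.2
  | succ t ih =>
    rcases g.step_dichotomy (t := t + 1) (by omega) with ⟨h1, -⟩ | ⟨h1, h2, -⟩
    · rw [h1] at hx
      obtain ⟨s, hs, hst, h⟩ := ih hx
      exact ⟨s, hs, by omega, h⟩
    · rw [h1] at hx
      rcases frontier_inter_subset _ _ hx with hx | hx
      · obtain ⟨s, hs, hst, h⟩ := ih hx.1
        exact ⟨s, hs, by omega, h⟩
      · obtain ⟨A, hA⟩ := g.exists_whitens (t + 2)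
        refine ⟨t + 1, by omega, le_rfl, h2, A, hA, ?_⟩
        have hx2 := hx.2
        rw [hA.ellipsoid_eq] at hx2
        have := frontier_le_subset_eq
          (f := fun x => ‖A (x - mean (weights (params n T) K R (t + 2)))‖)
          (g := fun _ => (params n T).alpha) (by fun_prop) continuous_const hx2
        exact (mem_ofPred_eq.mp this).ge

/-- The restart witness `x` lies on the boundary of an earlier cut. Its potential was at least `α /
25` when the rate grew by `1 + γ`, which improves the regret against `x` by at least `(slack +
20)/η₁`. The restart condition makes `x` as good as any point of the focus region up to `4/η₁`. -/
theorem sum_meanLoss_sub_le_of_restart (g : IsGame n T K R) {M : ℕ} (h : Tame n T K R (M + 1))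
    (hr : Restart (params n T) K R (M + 1)) {y : E n} (hy : y ∈ K) :
    ∑ t ∈ Finset.Icc 1 M, meanLoss (params n T) K R t - cumLoss (params n T) K R M y ≤
      -3 * ((params n T).eta1)⁻¹ := by
  obtain ⟨x, ⟨hxF, hxK⟩, hxr⟩ := hr
  have hη := g.eta1_pos
  have hηi := hundred_le_inv_eta1 g.pos g.lt
  have hx2 : x ∈ focus (params n T) K R (M + 2) :=
    (g.regular (M + 2)).focus_closed.frontier_subset hxF
  have hx1 : x ∈ focus (params n T) K R (M + 1) := focus_succ_subset _ hx2
  obtain ⟨s, hs1, hsM, hsr, A, hA, hfar⟩ := g.exists_cut_of_mem_frontier hxK (M + 1) hxF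
  have h1 := (g.excess_ge_of_far h hsM hA (focus_antitone hsM hx1) hfar).trans
    (g.potential_le_excess h hsM x)
  -- The sum runs through round `M + 1`, where `Good` may fail. No accuracy is needed there: the
  -- extra terms on the left are nonnegative, and the extra estimate at `z` is at most 2.
  have h2 := g.exponential_weights_le_of_mem h le_rfl hx1 hs1 hsM
  have hγ := gamma_pos g.pos g.lt
  have hγ' := gamma_le g.pos g.lt
  have hα := alpha_pos g.pos g.lt
  have h3 : (params n T).gamma / (5 / 2) * ((params n T).eta1)⁻¹ ≤
      (rate (params n T) K R s)⁻¹ - (rate (params n T) K R (s + 1))⁻¹ := by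
    have h4 := g.rate_le_two_mul h hsM
    have h5 := g.rate_pos s
    have h6 := inv_anti₀ h5 h4
    rw [mul_inv] at h6
    have h7 : (rate (params n T) K R s)⁻¹ - (rate (params n T) K R (s + 1))⁻¹ =
        (params n T).gamma / (1 + (params n T).gamma) * (rate (params n T) K R s)⁻¹ := by
      rw [hsr]
      field_simp
      ring
    rw [h7]
    have h8 : (params n T).gamma / (5 / 4) ≤ (params n T).gamma / (1 + (params n T).gamma) := by
      gcongr
      linarith
    calc (params n T).gamma / (5 / 2) * ((params n T).eta1)⁻¹ =
        (params n T).gamma / (5 / 4) * (2⁻¹ * ((params n T).eta1)⁻¹) := by ring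
      _ ≤ _ := by gcongr
  have h4 : (params n T).alpha / 25 * ((params n T).gamma / (5 / 2) * ((params n T).eta1)⁻¹) ≤
      excess T K R x (s + 1) * ((rate (params n T) K R s)⁻¹ -
          (rate (params n T) K R (s + 1))⁻¹) := by
    gcongr
    linarith [(by positivity : 0 ≤ (params n T).alpha / 25)]
  have h5 := slack_le_alpha_mul_gamma g.pos g.lt
  have h6 : (slack n T + 20) * ((params n T).eta1)⁻¹ ≤
      (params n T).alpha / 25 * ((params n T).gamma / (5 / 2) * ((params n T).eta1)⁻¹) := by
    calc (slack n T + 20) * ((params n T).eta1)⁻¹ ≤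
        ((params n T).alpha * (params n T).gamma / 100) * ((params n T).eta1)⁻¹ := by
          gcongr; linarith
      _ ≤ ((params n T).alpha * (params n T).gamma * (2 / 125)) * ((params n T).eta1)⁻¹ := by
          have : 0 < (params n T).alpha * (params n T).gamma := by positivity
          gcongr
          linarith
      _ = _ := by ring
  obtain ⟨z, hz, hzy⟩ := g.exists_focus_le h (Nat.lt_succ_self M) hy
  have h7 : cumEst (params n T) K R (M + 1) x ≤
      cumEst (params n T) K R (M + 1) z + 4 * ((params n T).eta1)⁻¹ := by
    have hbdd : BddBelow (cumEst (params n T) K R (M + 1) '' focus (params n T) K R (M + 1)) :=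
      ((g.regular (M + 1)).focus_compact.image (cumEst_continuous _ _)).bddBelow
    have h8 := csInf_le hbdd (mem_image_of_mem _ hz)
    rw [mul_comm, ← le_div_iff₀ hη] at hxr
    change _ ≤ (4 : ℝ) / _ at hxr
    rw [div_eq_mul_inv] at hxr
    linarith
  rw [cumEst_succ (y := z)] at h7
  have h8 := (g.lossEst_mem (M + 1) hz).2
  have h9 := (abs_le.1 (g.abs_cumEst_sub_le (h.good M (Nat.lt_succ_self M))
    (focus_succ_subset M hz))).2
  have h10 := g.sum_meanLoss_le (M := M) fun t ht => h.good t (by omega)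
  have h11 : ∑ t ∈ Finset.Icc 1 M, (meanEst (params n T) K R t + 2 * dropMass (params n T) K R t) ≤
      ∑ t ∈ Finset.Icc 1 (M + 1),
        (meanEst (params n T) K R t + 2 * dropMass (params n T) K R t) := by
    rw [Finset.sum_Icc_succ_top (by omega)]
    have := g.meanEst_nonneg (M + 1)
    have := dropMass_nonneg (K := K) (R := R) (params n T) (M + 1)
    linarith
  rw [one_div] at h10
  linarith

end IsGame

/-! ### The rounds after the minimum has left the focus region -/

/-- If `α ≤ 100 η₁ T` then the horizon is huge. -/
lemma mul_log_le_inv_eta1 {n T : ℕ} (hn : 1 ≤ n) (hT : n < T)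
    (h : (params n T).alpha ≤ 100 * (params n T).eta1 * T) :
    10 ^ 6 * (n * Real.log T) ≤ ((params n T).eta1)⁻¹ ∧ 10 ^ 6 ≤ ((params n T).eta1)⁻¹ := by
  have h1 := twentyThousand_mul_le hn hT
  have h2 := alpha_ge' (n := n) (T := T)
  have hX := le_mul_log hn hT
  have hi := hundred_le_inv_eta1 hn hT
  rw [← mul_pow] at h2
  have hη : 0 < (params n T).eta1 := by
    rw [← inv_pos]; linarith
  set i := ((params n T).eta1)⁻¹
  set X := (n : ℝ) * Real.log T
  have hi0 : 0 < i := by linarith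
  -- The hypothesis and the size of `α` give `T ≥ 3·10¹⁰ X²/η₁`. Inserted into `1/η₁² ≥ 20000 T X`,
  -- this yields `1/η₁ ≥ 6·10¹⁴ X³`.
  have h3 : 3 * 10 ^ 10 * X ^ 2 * i ≤ T := by
    have h4 : i * (params n T).alpha ≤ i * (100 * (params n T).eta1 * T) := by gcongr
    have h5 : i * (100 * (params n T).eta1 * T) = 100 * T := by
      simp only [i]
      field_simp
    have h6 : i * (3 * 10 ^ 12 * X ^ 2) ≤ i * (params n T).alpha := by gcongr
    linarith
  have h4 : 20000 * (3 * 10 ^ 10 * X ^ 2 * i * X) ≤ i ^ 2 :=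
    le_trans (by gcongr) h1
  have h5 : 6 * 10 ^ 14 * X ^ 3 ≤ i := by
    have : 6 * 10 ^ 14 * X ^ 3 * i ≤ i * i := by linarith
    exact le_of_mul_le_mul_right this hi0
  have h6 : 0.47 ≤ X ^ 2 := by nlinarith
  have h7 : 0.47 * X ≤ X ^ 3 := by nlinarith
  constructor <;> linarith

namespace IsGame

variable {n T : ℕ} {K : Set (E n)} {R : Transcript n}

lemma cumLoss_le_add (g : IsGame n T K R) {u t : ℕ} (hut : u ≤ t)
    (hg : ∀ s < t, Good (params n T) K R s) {y : E n} (hy : y ∈ K) :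
    cumLoss (params n T) K R t y ≤ cumLoss (params n T) K R u y + 2 * ((t : ℝ) - u) := by
  induction t, hut using Nat.le_induction with
  | base => simp
  | succ t hut ih =>
    have h1 := ih fun s hs => hg s (by omega)
    have h2 := g.smoothedLoss_le_two (hg t (Nat.lt_succ_self t)) hy
    rw [cumLoss_succ]
    push_cast
    linarith

lemma meanLoss_le_two (g : IsGame n T K R) {t : ℕ} (hg : Good (params n T) K R t) :
    meanLoss (params n T) K R (t + 1) ≤ 2 := by
  have hp : IsLawOn (weights (params n T) K R (t + 1)) (state (params n T) K R (t + 1)).support :=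
    (g.regular (t + 1)).isLawOn
  have := hp.prob
  have h := integral_mono_ae (hp.integrable (g.smoothedLoss_lipschitz (t + 1)).continuous)
    (integrable_const (2 : ℝ)) (by
      filter_upwards [hp.ae_mem] with y hy
      exact g.smoothedLoss_le_two hg (support_subset _ hy))
  simp only [integral_const, probReal_univ, smul_eq_mul, one_mul] at h
  exact h

lemma sum_meanLoss_sub_le_add (g : IsGame n T K R) {u M : ℕ} (huM : u ≤ M)
    (hg : ∀ s < M, Good (params n T) K R s) (y : E n) :
    ∑ t ∈ Finset.Icc 1 M, meanLoss (params n T) K R t - cumLoss (params n T) K R M y ≤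
      ∑ t ∈ Finset.Icc 1 u, meanLoss (params n T) K R t - cumLoss (params n T) K R u y +
        2 * ((M : ℝ) - u) := by
  induction M, huM using Nat.le_induction with
  | base => simp
  | succ M huM ih =>
    have h1 := ih fun s hs => hg s (by omega)
    have h2 := g.meanLoss_le_two (hg M (Nat.lt_succ_self M))
    have h3 := g.smoothedLoss_nonneg (M + 1) y
    rw [cumLoss_succ, Finset.sum_Icc_succ_top (by omega)]
    push_cast
    linarith

/-- When the minimum leaves the focus region, the regret is very negative. -/
lemma sum_meanLoss_sub_le_of_outside (g : IsGame n T K R) {u : ℕ} (h : Tame n T K R (u + 1))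
    (hg : Good (params n T) K R (u + 1)) (ho : Outside (params n T) K R (u + 1)) :
    (params n T).alpha ≤ 100 * (params n T).eta1 * T ∧ ∀ y ∈ K,
      ∑ t ∈ Finset.Icc 1 (u + 1), meanLoss (params n T) K R t -
        cumLoss (params n T) K R (u + 1) y ≤
          (slack n T + 4) * ((params n T).eta1)⁻¹ -
            (params n T).alpha / 100 * ((params n T).eta1)⁻¹ := by
  obtain ⟨z, ⟨hz, hz'⟩, hmin, -⟩ := ho
  have hη := g.eta1_pos
  have hηi := hundred_le_inv_eta1 g.pos g.lt
  have hα := alpha_pos g.pos g.lt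
  obtain ⟨A, hA⟩ := g.exists_whitens (u + 2)
  have hfar : (params n T).alpha ≤ ‖A (z - mean (weights (params n T) K R (u + 2)))‖ := by
    rcases g.step_dichotomy (t := u + 1) (by omega) with ⟨h1, -⟩ | ⟨h1, -, -⟩
    · rw [h1] at hz'
      exact absurd hz hz'
    · rw [h1, hA.ellipsoid_eq] at hz'
      by_contra hc
      exact hz' ⟨hz, (not_le.1 hc).le⟩
  have hpot := g.excess_ge_of_far h le_rfl hA hz hfar
  have hex := hpot.trans (g.potential_le_excess h le_rfl z)
  constructor
  · have h1 : (state (params n T) K R (u + 2)).potential z ≤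
        ∑ s ∈ Finset.Icc 1 (u + 1), rate (params n T) K R s * 2 := by
      unfold State.potential
      have h2 : (state (params n T) K R (u + 2)).score z ≤
          ∑ s ∈ Finset.Icc 1 (u + 1), rate (params n T) K R s * 2 := by
        rw [score_succ]
        refine Finset.sum_le_sum fun s hs => ?_
        have := (g.lossEst_mem s (focus_antitone (Finset.mem_Icc.1 hs).2 hz)).2
        exact mul_le_mul_of_nonneg_left this (g.rate_pos s).le
      have h3 : 0 ≤ sInf ((state (params n T) K R (u + 2)).score ''
          (state (params n T) K R (u + 2)).support) := by
        apply Real.sInf_nonneg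
        rintro _ ⟨y, hy, rfl⟩
        rw [support_succ'] at hy
        rw [score_succ]
        refine Finset.sum_nonneg fun s hs => ?_
        exact mul_nonneg (g.rate_pos s).le
          (g.lossEst_mem s (focus_antitone (Finset.mem_Icc.1 hs).2 hy)).1
      linarith
    rw [← Finset.sum_mul] at h1
    have h2 := g.sum_rate_le h le_rfl
    linarith
  · intro y hy
    obtain ⟨w, hw, hwy⟩ := g.exists_focus_le h (Nat.lt_succ_self u) hy
    have h1 := g.sum_meanLoss_le (M := u + 1) fun t ht => by
      rcases Nat.lt_or_ge t (u + 1) with h2 | h2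
      · exact h.good t h2
      · obtain rfl : t = u + 1 := by omega
        exact hg
    have h2 := g.exponential_weights_le h le_rfl hz
    have h3 := (abs_le.1 (g.abs_cumEst_sub_le hg hw)).2
    have h4 := hmin w hw
    have h5 := g.smoothedLoss_le_two (h.good u (Nat.lt_succ_self u)) (focus_subset _ hw)
    have h6 := g.smoothedLoss_nonneg (u + 1) y
    rw [cumLoss_succ] at h3 ⊢
    -- The final term of the summation by parts, at a rate of at most `5/2 η₁`.
    have h7 : (params n T).alpha / 100 * ((params n T).eta1)⁻¹ ≤
        excess T K R z (u + 2) * (rate (params n T) K R (u + 2))⁻¹ := by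
      have h8 := g.rate_succ_le' h le_rfl
      have h9 := inv_anti₀ (g.rate_pos (u + 2)) h8
      rw [mul_inv] at h9
      calc (params n T).alpha / 100 * ((params n T).eta1)⁻¹
          ≤ (params n T).alpha / 25 * ((5 / 2)⁻¹ * ((params n T).eta1)⁻¹) := by
            have : 0 < (params n T).alpha * ((params n T).eta1)⁻¹ := by positivity
            linarith
        _ ≤ _ := by
            gcongr
            linarith [(by positivity : 0 ≤ (params n T).alpha / 25)]
    rw [one_div] at h1
    linarith

/-- After the minimum has left the focus region, the focus region is cut in every round until a
restart. -/
lemma focus_succ_ne (g : IsGame n T K R) {u t : ℕ} (hut : u < t)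
    (hg : ∀ s ≤ t, Good (params n T) K R s) (hnr : ¬ Restart (params n T) K R t)
    (ho : Outside (params n T) K R u) (htu : (t : ℝ) - u ≤ ((params n T).eta1)⁻¹) :
    focus (params n T) K R (t + 1) ≠ focus (params n T) K R t := by
  intro heq
  have hη := inv_pos.2 g.eta1_pos
  obtain ⟨z, ⟨hz, hz'⟩, -, hz2⟩ := ho
  rcases g.inside_or_outside (hg t le_rfl) hnr with ⟨w, hw, hw2⟩ | ⟨w, ⟨hw, hw'⟩, -⟩
  -- At time `u` the point `z` was better than `w` by `2/η₁`; at time `t` it is worse by the same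
  -- amount. Its cumulative loss would have grown by `4/η₁`, at no more than 2 per round.
  · have hsub : focus (params n T) K R (t + 1) ⊆ focus (params n T) K R (u + 1) :=
      focus_antitone (by omega)
    have h1 := hw2 z ⟨focus_subset _ hz, fun hc => hz' (hsub hc)⟩
    have h2 := g.cumLoss_le_add hut.le (fun s hs => hg s hs.le) (focus_subset _ hz)
    have h3 := hz2 w (hsub hw)
    have h4 : cumLoss (params n T) K R u w ≤ cumLoss (params n T) K R t w :=
      g.cumLoss_mono w hut.le
    linarith
  · exact hw' (heq ▸ hw)

/-- The number of rounds between the time when the minimum leaves the focus region and the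
restart. -/
def _root_.KernelBandit.chainLength (n T : ℕ) : ℕ := ⌈3 * slack n T⌉₊ + 2

lemma chainLength_le (hn : 1 ≤ n) (hT : n < T) : (chainLength n T : ℝ) ≤ 40 * (n * Real.log T) := by
  have h1 := le_mul_log hn hT
  have h2 := Nat.ceil_lt_add_one (by have := slack_pos hn hT; linarith : 0 ≤ 3 * slack n T)
  unfold chainLength
  push_cast
  unfold slack at h2 ⊢
  linarith

lemma one_add_gamma_pow_le (hn : 1 ≤ n) (hT : n < T) {j : ℕ} (hj : j ≤ chainLength n T) :
    (1 + (params n T).gamma) ^ j ≤ 256 := by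
  have hγ := gamma_pos hn hT
  have hX := le_mul_log hn hT
  have h1 := chainLength_le hn hT
  have hj' : (j : ℝ) ≤ chainLength n T := by exact_mod_cast hj
  have h2 : (1 + (params n T).gamma) ^ j ≤ Real.exp ((params n T).gamma * j) := by
    have : 1 + (params n T).gamma ≤ Real.exp (params n T).gamma := by
      have := Real.add_one_le_exp (params n T).gamma; linarith
    calc (1 + (params n T).gamma) ^ j ≤ Real.exp (params n T).gamma ^ j := by gcongr
      _ = _ := by rw [← Real.exp_nat_mul, mul_comm]
  refine h2.trans ?_
  have h3 : (params n T).gamma * j ≤ 8 * Real.log 2 := by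
    have h4 : (params n T).gamma * j ≤ (params n T).gamma * (40 * (n * Real.log T)) := by
      gcongr; linarith
    refine h4.trans (le_of_eq ?_)
    rw [gamma_eq]
    have : (n : ℝ) * Real.log T ≠ 0 := by linarith
    rw [div_mul_eq_mul_div, div_eq_iff (by positivity)]
    ring
  refine (Real.exp_le_exp.2 h3).trans (le_of_eq ?_)
  rw [show (8 : ℝ) * Real.log 2 = ((8 : ℕ) : ℝ) * Real.log 2 by norm_num, Real.exp_nat_mul,
    Real.exp_log (by norm_num)]
  norm_num

/-- Every round after `u` cuts. The rate grows by `1 + γ`, the partition function loses at most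
`e^(-2η)` and a further `99/100`, in total no worse than `4/5`, and the volume is halved. -/
lemma chain_bounds (g : IsGame n T K R) {u N : ℕ} (hu : 1 ≤ u) (h : Tame n T K R u)
    (hg : ∀ s < N, Good (params n T) K R s)
    (hnr : ∀ s, 1 ≤ s → s < N → ¬ Restart (params n T) K R s)
    (ho : Outside (params n T) K R u)
    (hbig : 10 ^ 6 * (n * Real.log T) ≤ ((params n T).eta1)⁻¹ ∧ 10 ^ 6 ≤ ((params n T).eta1)⁻¹)
    (j : ℕ) (hj : j ≤ chainLength n T) (hjN : u + 1 + j ≤ N) :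
    rate (params n T) K R (u + 1 + j) ≤
        5 / 2 * (params n T).eta1 * (1 + (params n T).gamma) ^ j ∧
      (4 / 5) ^ j * (state (params n T) K R (u + 1)).partition ≤
        (state (params n T) K R (u + 1 + j)).partition ∧
      volume.real (focus (params n T) K R (u + 1 + j)) ≤ (1 / 2) ^ j * volume.real K := by
  have hη := g.eta1_pos
  have hγ := gamma_pos g.pos g.lt
  have hX := le_mul_log g.pos g.lt
  have hη6 : (params n T).eta1 ≤ 1 / 10 ^ 6 := by
    have := hbig.2
    rw [le_inv_comm₀ (by norm_num) hη] at this
    rwa [one_div]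
  induction j with
  | zero =>
    refine ⟨?_, by simp, ?_⟩
    · simpa using g.rate_succ_le' h le_rfl
    · simpa using measureReal_mono (focus_subset (P := params n T) (K := K) (R := R) (u + 1))
        g.body.compact.measure_lt_top.ne
  | succ j ih =>
    obtain ⟨h1, h2, h3⟩ := ih (by omega) (by omega)
    have hne := g.focus_succ_ne (u := u) (t := u + 1 + j) (by omega)
      (fun s hs => hg s (by omega)) (hnr _ (by omega) (by omega)) ho (by
        have h4 := chainLength_le g.pos g.lt
        have h5 : ((j + 1 : ℕ) : ℝ) ≤ chainLength n T := by exact_mod_cast hj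
        push_cast at h5 ⊢
        linarith [hbig.1])
    rcases g.step_dichotomy (t := u + 1 + j) (by omega) with ⟨h4, -⟩ | ⟨-, h4, h5⟩
    · exact absurd h4 hne
    refine ⟨?_, ?_, ?_⟩
    · change rate (params n T) K R (u + 1 + j + 1) ≤ _
      rw [h4, pow_succ]
      nlinarith
    · have h6 := (g.regular (u + 1 + j)).partition_step_ge (P := params n T) (K := K)
        (x := R.action (u + 1 + j)) (l := R.loss (u + 1 + j))
        (fun y hy => g.lossEst_mem (u + 1 + j) hy)
      rw [← state_succ (by omega)] at h6
      have h7 : 99 / 100 ≤ (state (params n T) K R (u + 1 + j)).weights.real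
          (state (params n T) K R (u + 1 + j)).focus := by
        have h8 := (g.regular (u + j)).weights_focus_step g.pos g.lt K (R.action (u + j))
          (R.loss (u + j))
        rw [← state_succ (by omega)] at h8
        rwa [show u + 1 + j = u + j + 1 by omega]
      have h8 : (9 / 10 : ℝ) ≤ Real.exp (-(2 * (state (params n T) K R (u + 1 + j)).rate)) := by
        have h9 := one_add_gamma_pow_le g.pos g.lt (j := j) (by omega)
        have h10 : rate (params n T) K R (u + 1 + j) ≤ 5 / 2 * (1 / 10 ^ 6) * 256 :=
          h1.trans (by gcongr)
        have h11 := Real.add_one_le_exp (-(2 * (state (params n T) K R (u + 1 + j)).rate))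
        change (state (params n T) K R (u + 1 + j)).rate ≤ _ at h10
        norm_num at h10
        linarith
      have hZ := (g.regular (u + 1 + j)).partition_pos
      refine le_trans ?_ h6
      calc (4 / 5) ^ (j + 1) * (state (params n T) K R (u + 1)).partition
          = 4 / 5 * ((4 / 5) ^ j * (state (params n T) K R (u + 1)).partition) := by ring
        _ ≤ 4 / 5 * (state (params n T) K R (u + 1 + j)).partition := by gcongr
        _ ≤ 9 / 10 * (99 / 100) * (state (params n T) K R (u + 1 + j)).partition := by
          gcongr
          norm_num
        _ ≤ _ := by gcongr
    · change volume.real (focus (params n T) K R (u + 1 + j + 1)) ≤ _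
      refine h5.trans ?_
      rw [pow_succ]
      linarith

/-- The partition function never exceeds the volume of the support, which lags one round behind the
focus region. After `k` rounds this reads `(4/5)^k e^(-slack) ≤ 2^(-(k-1))`. Since `log (8/5) ≥
2/5`, this fails for `k = ⌈3 slack⌉ + 2`. -/
lemma lt_add_chainLength (g : IsGame n T K R) {u N : ℕ} (hu : 1 ≤ u) (h : Tame n T K R u)
    (hg : ∀ s < N, Good (params n T) K R s)
    (hnr : ∀ s, 1 ≤ s → s < N → ¬ Restart (params n T) K R s)
    (ho : Outside (params n T) K R u)
    (hbig : 10 ^ 6 * (n * Real.log T) ≤ ((params n T).eta1)⁻¹ ∧ 10 ^ 6 ≤ ((params n T).eta1)⁻¹) :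
    N < u + 1 + chainLength n T := by
  by_contra! hN
  have hK : 0 < volume.real K := g.volume_pos 0
  have hk : chainLength n T = ⌈3 * slack n T⌉₊ + 1 + 1 := rfl
  have h1 := (g.chain_bounds hu h hg hnr ho hbig _ le_rfl hN).2.1
  have h2 := (g.chain_bounds hu h hg hnr ho hbig (⌈3 * slack n T⌉₊ + 1) (by omega) (by omega)).2.2
  have h3 := (g.regular (u + 1 + chainLength n T)).partition_le
  have e : u + 1 + chainLength n T = u + 1 + (⌈3 * slack n T⌉₊ + 1) + 1 := by omega
  rw [e, support_succ', ← e] at h3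
  have h4 := (h1.trans h3).trans h2
  have hZ := (g.regular (u + 1)).partition_pos
  have h5 := Real.log_le_log (by positivity) h4
  have h6 := g.log_partition_ge h le_rfl
  rw [Real.log_mul (by positivity) hZ.ne', Real.log_mul (by positivity) hK.ne', Real.log_pow,
    Real.log_pow, hk, one_div, Real.log_inv] at h5
  push_cast at h5
  have h7 := Nat.le_ceil (3 * slack n T)
  have hs := slack_pos g.pos g.lt
  have h8 : (2 / 5 : ℝ) ≤ Real.log (4 / 5) + Real.log 2 := by
    rw [← Real.log_mul (by norm_num) (by norm_num), Real.le_log_iff_exp_le (by norm_num)]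
    have h9 : Real.exp (2 / 5) ^ 5 ≤ (8 / 5) ^ 5 := by
      rw [← Real.exp_nat_mul]
      have e2 : Real.exp ((5 : ℕ) * (2 / 5)) = Real.exp 1 ^ 2 := by
        rw [← Real.exp_nat_mul]; norm_num
      rw [e2]
      calc Real.exp 1 ^ 2 ≤ 2.7182818286 ^ 2 := by
            gcongr; exact Real.exp_one_lt_d9.le
        _ ≤ _ := by norm_num
    have := le_of_pow_le_pow_left₀ (by norm_num) (by norm_num) h9
    linarith
  have h9 := Real.log_two_lt_d9
  have h10 : (0 : ℝ) ≤ ⌈3 * slack n T⌉₊ := Nat.cast_nonneg _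
  nlinarith

/-- At round `u` the regret is at most `-16/η₁`. The remaining rounds number at most `40 n log T`,
cost at most 2 each, and `n log T ≤ 10^(-6)/η₁`. -/
theorem sum_meanLoss_sub_le_of_outside_lt (g : IsGame n T K R) {u M : ℕ} (hu : 1 ≤ u)
    (huM : u ≤ M) (h : Tame n T K R u) (hg : ∀ s ≤ M, Good (params n T) K R s)
    (hnr : ∀ s, 1 ≤ s → s ≤ M → ¬ Restart (params n T) K R s)
    (ho : Outside (params n T) K R u) {y : E n} (hy : y ∈ K) :
    ∑ t ∈ Finset.Icc 1 M, meanLoss (params n T) K R t - cumLoss (params n T) K R M y ≤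
      -3 * ((params n T).eta1)⁻¹ := by
  obtain ⟨u, rfl⟩ := Nat.exists_eq_add_of_le' hu
  obtain ⟨h1, h2⟩ := g.sum_meanLoss_sub_le_of_outside h (hg _ huM) ho
  have hbig := mul_log_le_inv_eta1 g.pos g.lt h1
  have h3 := g.lt_add_chainLength (N := M + 1) hu h (fun s hs => hg s (by omega))
    (fun s h1 h2 => hnr s h1 (by omega)) ho hbig
  have h4 := chainLength_le g.pos g.lt
  have h5 := g.sum_meanLoss_sub_le_add huM (fun s hs => hg s hs.le) y
  have h6 := h2 y hy
  have h7 := slack_le_alpha_mul_gamma g.pos g.lt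
  have h8 := gamma_le g.pos g.lt
  have hα := alpha_pos g.pos g.lt
  have h9 : 100 * (slack n T + 20) ≤ (params n T).alpha := by
    have : (params n T).alpha * (params n T).gamma ≤ (params n T).alpha * (1 / 4) := by gcongr
    linarith
  have hη := inv_pos.2 g.eta1_pos
  have h10 : (slack n T + 20) * ((params n T).eta1)⁻¹ ≤
      (params n T).alpha / 100 * ((params n T).eta1)⁻¹ := by gcongr; linarith
  have h11 : (M : ℝ) - ((u + 1 : ℕ) : ℝ) ≤ chainLength n T := by
    have : (M : ℝ) ≤ ((u + 1 + chainLength n T : ℕ) : ℝ) := by exact_mod_cast (by omega)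
    push_cast at this ⊢
    linarith
  have hX := le_mul_log g.pos g.lt
  linarith [hbig.1]

end IsGame

/-! ### The regret up to the fault time -/

/-! ### The numerical form of the bound -/

section Numerics

variable {n T : ℕ}

lemma rpow_add_half {x : ℝ} (hx : 0 < x) (k : ℕ) : x ^ ((k : ℝ) + 1 / 2) = x ^ k * Real.sqrt x := by
  rw [Real.rpow_add hx, Real.rpow_natCast, Real.sqrt_eq_rpow]

lemma inv_lam (n T : ℕ) : ((params n T).lam)⁻¹ =
    10 ^ 6 * (1600 * Real.exp 1) ^ 4 * (2 * Real.exp 1) ^ 34 * ((n : ℝ) ^ 8 * Real.log T ^ 6) := by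
  have h : (params n T).alpha = (2 * Real.exp 1) ^ 17 * (n : ℝ) ^ 2 * Real.log T ^ 2 := rfl
  rw [lam_eq, ← inv_pow, inv_div, eps_eq, h, div_pow, one_div, inv_pow, inv_pow, div_inv_eq_mul]
  ring

/-- The three factors are of order `n log T`, `√(n T log T)` and `n⁸ log⁶ T`. -/
lemma final_bound (hn : 1 ≤ n) (hT : n < T) :
    (slack n T + 6) * ((params n T).eta1)⁻¹ * ((params n T).lam)⁻¹ ≤
      (6 : ℝ) ^ 90 * (n : ℝ) ^ (9.5 : ℝ) * Real.log T ^ (7.5 : ℝ) * Real.sqrt T := by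
  have hX := le_mul_log hn hT
  have hL : 0 < Real.log T := by have := log_two_le_log hn hT; linarith
  have hn0 : (0 : ℝ) < n := by exact_mod_cast (by omega : 0 < n)
  have e1 : (n : ℝ) ^ (9.5 : ℝ) = (n : ℝ) ^ 9 * Real.sqrt n := by
    rw [← rpow_add_half hn0]; norm_num
  have e2 : Real.log T ^ (7.5 : ℝ) = Real.log T ^ 7 * Real.sqrt (Real.log T) := by
    rw [← rpow_add_half hL]; norm_num
  have e3 : Real.sqrt (n * T * Real.log T) =
      Real.sqrt n * Real.sqrt T * Real.sqrt (Real.log T) := by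
    rw [Real.sqrt_mul (by positivity), Real.sqrt_mul (by positivity)]
  have h1 : slack n T + 6 ≤ 21 * (n * Real.log T) := by unfold slack; linarith
  have h2 : Real.exp 1 ≤ 3 := by have := Real.exp_one_lt_d9; linarith
  rw [inv_eta1, inv_lam, e1, e2, e3]
  set s := Real.sqrt n * Real.sqrt T * Real.sqrt (Real.log T)
  calc (slack n T + 6) * (20 * Real.exp 1 ^ 2 * s) * (10 ^ 6 * (1600 * Real.exp 1) ^ 4 *
        (2 * Real.exp 1) ^ 34 * ((n : ℝ) ^ 8 * Real.log T ^ 6))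
      ≤ (21 * (n * Real.log T)) * (20 * 3 ^ 2 * s) * (10 ^ 6 * (1600 * 3) ^ 4 *
        (2 * 3) ^ 34 * ((n : ℝ) ^ 8 * Real.log T ^ 6)) := by gcongr
    _ = (21 * (20 * 3 ^ 2) * (10 ^ 6 * (1600 * 3) ^ 4 * (2 * 3) ^ 34)) *
        ((n : ℝ) ^ 9 * Real.log T ^ 7 * s) := by ring
    _ ≤ 6 ^ 90 * ((n : ℝ) ^ 9 * Real.log T ^ 7 * s) := by
        gcongr
        norm_num
    _ = _ := by simp only [s]; ring

end Numerics

/-! ### Elementary properties of the restart time and of the fault time -/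

section Times

variable {n : ℕ} {P : Params} {K : Set (E n)} {R : Transcript n}

lemma restartTime_mem : restartTime P K R ∈ ({t | 1 ≤ t ∧ Restart P K R t} ∪ {P.T} : Set ℕ) :=
  Nat.sInf_mem ⟨P.T, Or.inr rfl⟩

lemma restartTime_le : restartTime P K R ≤ P.T := Nat.sInf_le (Or.inr rfl)

lemma not_restart_of_lt {t : ℕ} (h1 : 1 ≤ t) (h : t < restartTime P K R) : ¬ Restart P K R t :=
  fun hr => Nat.notMem_of_lt_sInf h (Or.inl ⟨h1, hr⟩)

lemma faultTime_le : faultTime P K R ≤ restartTime P K R := Nat.sInf_le (Or.inr rfl)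

lemma one_le_faultTime (hT : 1 ≤ P.T) : 1 ≤ faultTime P K R := by
  have h1 : 1 ≤ restartTime P K R := by
    rcases restartTime_mem (P := P) (K := K) (R := R) with h | h
    · exact h.1
    · rw [mem_singleton_iff.1 h]; exact hT
  rcases Nat.sInf_mem (s := {t | 1 ≤ t ∧ t ≤ restartTime P K R ∧
      (¬ Good P K R t ∨ R.action t ∉ typicalAt P K R t)} ∪ {restartTime P K R})
      ⟨_, Or.inr rfl⟩ with h | h
  · exact h.1
  · have : faultTime P K R = restartTime P K R := h
    rw [this]; exact h1

lemma good_of_lt_faultTime {t : ℕ} (h1 : 1 ≤ t) (h : t < faultTime P K R) : Good P K R t := by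
  by_contra hc
  exact Nat.notMem_of_lt_sInf h (Or.inl ⟨h1, h.le.trans faultTime_le, Or.inl hc⟩)

end Times

namespace IsGame

variable {n T : ℕ} {K : Set (E n)} {R : Transcript n}

/-- Dividing by `λ < 1` only enlarges a negative quantity; the margin `3/η₁` also covers the `1/η₁`
lost in `regret_le` and the trivial bound 1 for the last round. -/
lemma sum_sub_le_of_neg (g : IsGame n T K R) {M : ℕ} (hM : M ≤ T)
    (hg : ∀ t ≤ M, Good (params n T) K R t) (hact : R.action (M + 1) ∈ K) {y : E n} (hy : y ∈ K)
    (h : ∑ t ∈ Finset.Icc 1 M, meanLoss (params n T) K R t - cumLoss (params n T) K R M y ≤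
      -3 * ((params n T).eta1)⁻¹) :
    ∑ t ∈ Finset.Icc 1 (M + 1), (R.loss t (R.action t) - R.loss t y) ≤ 0 := by
  have hi := hundred_le_inv_eta1 g.pos g.lt
  have hl0 := lam_pos g.pos g.lt
  have hl1 := lam_lt_one g.pos g.lt
  have h1 := g.regret_le hM hg hy
  rw [Finset.sum_Icc_succ_top (by omega)]
  have h2 := ((g.loss (M + 1)).mem _ hact).2
  have h3 := ((g.loss (M + 1)).mem _ hy).1
  have h4 : (∑ t ∈ Finset.Icc 1 M, meanLoss (params n T) K R t - cumLoss (params n T) K R M y + 1) /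
      (params n T).lam ≤ -2 * ((params n T).eta1)⁻¹ := by
    rw [div_le_iff₀ hl0]
    nlinarith
  rw [one_div] at h1
  linarith

theorem regret_le_of_faultTime (g : IsGame n T K R) (hact : ∀ t, R.action t ∈ K) {y : E n}
    (hy : y ∈ K) :
    ∑ t ∈ Finset.Icc 1 (faultTime (params n T) K R), (R.loss t (R.action t) - R.loss t y) ≤
      if faultTime (params n T) K R = restartTime (params n T) K R ∧
          restartTime (params n T) K R = T then
        (6 : ℝ) ^ 90 * (n : ℝ) ^ (9.5 : ℝ) * Real.log T ^ (7.5 : ℝ) * Real.sqrt T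
      else if faultTime (params n T) K R = restartTime (params n T) K R ∧
          restartTime (params n T) K R < T then 0
      else (faultTime (params n T) K R : ℝ) := by
  have hτT : restartTime (params n T) K R ≤ T := restartTime_le
  have hNτ := faultTime_le (P := params n T) (K := K) (R := R)
  have hgood : ∀ t < faultTime (params n T) K R, Good (params n T) K R t := by
    intro t ht
    rcases Nat.eq_zero_or_pos t with rfl | h1
    · exact good_zero
    · exact good_of_lt_faultTime h1 ht
  have hnr : ∀ t, 1 ≤ t → t < faultTime (params n T) K R → ¬ Restart (params n T) K R t :=
    fun t h1 h2 => not_restart_of_lt h1 (h2.trans_le hNτ)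
  have hmem := restartTime_mem (P := params n T) (K := K) (R := R)
  -- The fault time is `M + 1`. Accuracy is known only through round `M`, even when the fault time
  -- equals the restart time, so the last round is always treated separately.
  obtain ⟨M, hM⟩ := Nat.exists_eq_add_of_le' (one_le_faultTime (P := params n T) (K := K) (R := R)
    (by have := g.lt; change 1 ≤ T; omega))
  have htriv : ∑ t ∈ Finset.Icc 1 (faultTime (params n T) K R),
      (R.loss t (R.action t) - R.loss t y) ≤ faultTime (params n T) K R := by
    refine (Finset.sum_le_card_nsmul _ _ 1 fun t _ => ?_).trans (by simp)
    have h2 := ((g.loss t).mem _ (hact t)).2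
    have h3 := ((g.loss t).mem _ hy).1
    linarith
  have hL : 0 ≤ Real.log T := Real.log_natCast_nonneg T
  have hpos : 0 ≤ (6 : ℝ) ^ 90 * (n : ℝ) ^ (9.5 : ℝ) * Real.log T ^ (7.5 : ℝ) * Real.sqrt T := by
    positivity
  generalize faultTime (params n T) K R = N at *
  subst hM
  have hMT : M ≤ T := by omega
  have hgM : ∀ t ≤ M, Good (params n T) K R t := fun t ht => hgood t (by omega)
  by_cases hin : ∀ t, 1 ≤ t → t < M + 1 → Inside (params n T) K R t
  · have htame : Tame n T K R (M + 1) := ⟨by omega, hgood, hin⟩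
    split_ifs with h1 h2
    · have h3 := g.regret_le hMT hgM hy
      have h4 := g.sum_meanLoss_sub_le htame hy
      have h5 := final_bound g.pos g.lt
      refine le_trans ?_ h5
      have hi := hundred_le_inv_eta1 g.pos g.lt
      have hl0 := lam_pos g.pos g.lt
      have hl1 : 1 ≤ ((params n T).lam)⁻¹ := (one_le_inv₀ hl0).2 (lam_lt_one g.pos g.lt).le
      rw [Finset.sum_Icc_succ_top (by omega)]
      have h6 := ((g.loss (M + 1)).mem _ (hact (M + 1))).2
      have h7 := ((g.loss (M + 1)).mem _ hy).1
      rw [div_eq_mul_inv, one_div] at h3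
      have h8 := mul_le_mul_of_nonneg_right (add_le_add_left h4 1) (by linarith : 0 ≤ ((params n T).lam)⁻¹)
      nlinarith
    · have h3 : Restart (params n T) K R (M + 1) := by
        rcases hmem with h | h
        · rw [h2.1]; exact h.2
        · have h4 : restartTime (params n T) K R = T := h
          omega
      exact g.sum_sub_le_of_neg hMT hgM (hact _) hy (g.sum_meanLoss_sub_le_of_restart htame h3 hy)
    · exact htriv
  · classical
    -- Let `u` be the first round after which the minimum is not inside. The rounds before `u` are
    -- tame, and the regret is nonpositive whichever of the three bounds is claimed.
    have hex : ∃ t, 1 ≤ t ∧ t < M + 1 ∧ ¬ Inside (params n T) K R t := by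
      by_contra hc
      exact hin fun t h1 h2 => by
        by_contra h3
        exact hc ⟨t, h1, h2, h3⟩
    obtain ⟨hu1, huM, hu⟩ := Nat.find_spec hex
    have hmin := fun t (ht : t < Nat.find hex) => Nat.find_min hex ht
    generalize Nat.find hex = u at *
    have htame : Tame n T K R u := by
      refine ⟨by omega, fun t ht => hgood t (by omega), fun t h1 h2 => ?_⟩
      by_contra h3
      exact hmin t h2 ⟨h1, by omega, h3⟩
    have ho : Outside (params n T) K R u :=
      (g.inside_or_outside (hgood u huM) (hnr u hu1 huM)).resolve_left hu
    have h1 := g.sum_sub_le_of_neg hMT hgM (hact _) hy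
      (g.sum_meanLoss_sub_le_of_outside_lt hu1 (by omega) htame hgM
        (fun s h1 h2 => hnr s h1 (by omega)) ho hy)
    split_ifs
    · exact h1.trans hpos
    · exact h1
    · exact h1.trans (Nat.cast_nonneg _)

end IsGame

end KernelBandit

end

/-- The inequality holds at every sample point, not just almost every one: the concentration enters
only through the definition of the fault time. -/
theorem mainTheorem2 (n T : ℕ) (hn : 1 ≤ n) (hT : n < T)
    (K : Set (KernelBandit.E n)) (hK_compact : IsCompact K) (hK_convex : Convex ℝ K)
    (hK_ball : ∃ c, Metric.closedBall c 1 ⊆ K) (hK_diam : Metric.diam K ≤ T)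
    {Ω : Type*} [MeasurableSpace Ω] (μ : Measure Ω) [IsProbabilityMeasure μ]
    (l : ℕ → Ω → KernelBandit.E n → ℝ) (draw x : ℕ → Ω → KernelBandit.E n)
    (hrun : KernelBandit.IsRun μ (KernelBandit.params n T) K l draw x) :
    ∀ᵐ ω ∂μ, ∀ τ 𝒯 : ℕ,
      τ = KernelBandit.restartTime (KernelBandit.params n T) K (KernelBandit.transcript x l ω) →
      𝒯 = KernelBandit.faultTime (KernelBandit.params n T) K (KernelBandit.transcript x l ω) →
      ∀ y ∈ K, ∑ t ∈ Finset.Icc 1 𝒯, (l t ω (x t ω) - l t ω y) ≤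
        if 𝒯 = τ ∧ τ = T then
          (6 : ℝ) ^ 90 * (n : ℝ) ^ (9.5 : ℝ) * Real.log T ^ (7.5 : ℝ) * Real.sqrt T
        else if 𝒯 = τ ∧ τ < T then 0
        else (𝒯 : ℝ) := by
  refine Filter.Eventually.of_forall fun ω τ N hτ hN y hy => ?_
  subst hτ hN
  have hbody : KernelBandit.IsBody K := by
    obtain ⟨c, hc⟩ := hK_ball
    refine ⟨hK_compact, hK_convex, c, ?_⟩
    exact interior_mono hc (Metric.ball_subset_interior_closedBall
      (Metric.mem_ball_self one_pos))
  have g : KernelBandit.IsGame n T K (KernelBandit.transcript x l ω) :=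
    { pos := hn
      lt := hT
      body := hbody
      diam := fun a ha b hb => by
        rw [← dist_eq_norm]
        exact (Metric.dist_le_diam_of_mem hK_compact.isBounded ha hb).trans hK_diam
      loss := fun t => ⟨hrun.convex_loss t ω, hrun.loss_mem t ω, hrun.lipschitz_loss t ω⟩ }
  exact g.regret_le_of_faultTime (fun t => hrun.action_mem t ω) hy
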